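/- **Setting.** Let $\mathcal A$ be an infinite radially symmetric metric antitree: a connected simple graph with vertex set $V$ (infinite) and root $o$, with finite spheres $S_n=\{v: d(o,v)=n\}$, $s_n=\#S_n$, in which two vertices are adjacent if and only if they lie in $S_n$ and $S_{n+1}$ for some $n\ge 0$, every edge between $S_n$ and $S_{n+1}$ having the same length $\ell_n>0$. Put $t_n=\sum_{k<n}\ell_k$, $I_n=[t_n,t_{n+1})$, $\mathcal L=\sum_{n\ge0}\ell_n\in(0,\infty]$ and $\mu=\sum_{n\ge 0}s_ns_{n+1}\mathbf 1_{I_n}$ on $[0,\mathcal L)$. Each edge between $S_n$ and $S_{n+1}$ is identified with $I_n$ through the distance to the root, and $L^2(\mathcal A)=\bigoplus_e L^2(e)$. The pre-minimal Kirchhoff Laplacian $\mathbf H_0$ in $L^2(\mathcal A)$ acts edgewise as $f\mapsto -f''$ on the compactly supported functions (those vanishing on all but finitely many edges) that are $H^2$ on every edge, are continuous at every vertex, and for which the sum of the outgoing derivatives at every vertex is $0$. Define the following subspaces of $L^2(\mathcal A)$. * $\mathcal F_{\rm sym}$: the functions that depend only on the distance to the root. * $\mathcal F_n=\widetilde{\mathcal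 F}_n\cap\mathcal F_{\rm sym}^\perp$ for $n\ge1$, where $\widetilde{\mathcal F}_n=\bigoplus_{v\in S_n}\widetilde{\mathcal F}_v$ and $\widetilde{\mathcal F}_v$ consists of the functions that vanish off the edges at $v$ and depend on these edges only on the distance to the root. * $\mathcal F_n^0$ for $n\ge 1$: the functions vanishing off the edges between $S_n$ and $S_{n+1}$ such that for each $u\in S_n$ the sum of $f_e$ over the edges $e$ from $u$ to $S_{n+1}$ is zero, and for each $v\in S_{n+1}$ the sum of $f_e$ over the edges $e$ from $S_n$ to $v$ is zero. Define the following Sturm–Liouville operators. * $\mathrm H_0=-\frac1\mu\frac{d}{dt}\mu\frac{d}{dt}$ in $L^2([0,\mathcal L);\mu)$ on the functions $f$ with compact support in $[0,\mathcal L)$ such that $f,\mu f'\in AC_{\rm loc}([0,\mathcal L))$, $\frac1\mu(\mu f')'\in L^2([0,\mathcal L);\mu)$ and $f'(0)=0$. * $\mathrm h_n=-\frac{d^2}{dt^2}$ in $L^2(I_n)$ on $\{f\in H^2(I_n): f(t_n+)=f(t_{n+1}-)=0\}$, $n\ge1$. * $\widetilde{\mathrm h}_n=-\frac1\mu\frac{d}{dt}\mu\frac{d}{dt}$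 in $L^2((t_{n-1},t_{n+1});\mu)$ with Dirichlet conditions at $t_{n-1}$ and $t_{n+1}$, $n\ge1$. **Theorem.** The operators $\mathbf H_0$ and $\mathrm H_0$ are closable; let $\mathbf H=\overline{\mathbf H_0}$ (the minimal Kirchhoff Laplacian) and $\mathrm H=\overline{\mathrm H_0}$. There is an orthogonal decomposition $$L^2(\mathcal A)=\mathcal F_{\rm sym}\oplus\bigoplus_{n\ge1}\mathcal F_n\oplus\bigoplus_{n\ge1}\mathcal F_n^0,$$ and each of its components is a (closed) reducing subspace of $\mathbf H$. Moreover, $\mathbf H$ is unitarily equivalent to the orthogonal sum $$\mathrm H\ \oplus\ \bigoplus_{n\ge1}\Big(\bigoplus_{j=1}^{(s_n-1)(s_{n+1}-1)}\mathrm h_n\Big)\ \oplus\ \bigoplus_{n\ge1}\Big(\bigoplus_{j=1}^{s_n-1}\widetilde{\mathrm h}_n\Big)$$ by a unitary operator that maps $\mathcal F_{\rm sym}$ onto the space of the first summand, $\mathcal F_n^0$ onto the space of the $(s_n-1)(s_{n+1}-1)$ copies of $\mathrm h_n$, and $\mathcal F_n$ onto the space of the $s_n-1$ copies of $\widetilde{\mathrm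 h}_n$, for every $n\ge 1$. -/

import Mathlib

open MeasureTheory Set

/-! ### Unbounded operators in Hilbert spaces -/

section Operators

/-- `K` is a reducing subspace of the operator `T`: `K` is closed and `T` splits as the orthogonal
sum of its parts in `K` and in `Kᗮ`. -/
def Reduces {E : Type*} [NormedAddCommGroup E] [InnerProductSpace ℂ E]
    (K : Submodule ℂ E) (T : E →ₗ.[ℂ] E) : Prop :=
  IsClosed (K : Set E) ∧
    ∀ f : T.domain, ∃ f₁ f₂ : T.domain, f = f₁ + f₂ ∧
      (f₁ : E) ∈ K ∧ T f₁ ∈ K ∧ (f₂ : E) ∈ Kᗮ ∧ T f₂ ∈ Kᗮ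

/-- `S = Φ T Φ⁻¹`, domains included. -/
def Intertwines {E F : Type*} [NormedAddCommGroup E] [InnerProductSpace ℂ E]
    [NormedAddCommGroup F] [InnerProductSpace ℂ F]
    (Φ : E ≃ₗᵢ[ℂ] F) (T : E →ₗ.[ℂ] E) (S : F →ₗ.[ℂ] F) : Prop :=
  ∀ f g : E, (f, g) ∈ T.graph ↔ (Φ f, Φ g) ∈ S.graph

/-- The graph of the orthogonal sum of the operators `T i`. -/
def orthSumGraph {ι : Type*} {E : ι → Type*} [∀ i, NormedAddCommGroup (E i)]
    [∀ i, InnerProductSpace ℂ (E i)] (T : ∀ i, E i →ₗ.[ℂ] E i) :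
    Submodule ℂ (lp E 2 × lp E 2) where
  carrier := {p | ∀ i, (p.1 i, p.2 i) ∈ (T i).graph}
  add_mem' := fun hp hq i => (T i).graph.add_mem (hp i) (hq i)
  zero_mem' := fun i => (T i).graph.zero_mem
  smul_mem' := fun c _ hp i => (T i).graph.smul_mem c (hp i)

/-- The orthogonal sum of the operators `T i` in the Hilbert sum `⨁ E i`: the domain consists of
all `f` with `f i ∈ dom (T i)` and `∑ ‖T i (f i)‖² < ∞`, and it acts componentwise. -/
noncomputable def orthSum {ι : Type*} {E : ι → Type*} [∀ i, NormedAddCommGroup (E i)]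
    [∀ i, InnerProductSpace ℂ (E i)] (T : ∀ i, E i →ₗ.[ℂ] E i) : lp E 2 →ₗ.[ℂ] lp E 2 :=
  (orthSumGraph T).toLinearPMap

theorem orthSum_graph {ι : Type*} {E : ι → Type*} [∀ i, NormedAddCommGroup (E i)]
    [∀ i, InnerProductSpace ℂ (E i)] (T : ∀ i, E i →ₗ.[ℂ] E i) :
    (orthSum T).graph = orthSumGraph T := by
  refine Submodule.toLinearPMap_graph_eq _ fun p hp h0 => ?_
  ext i
  refine LinearPMap.graph_fst_eq_zero_snd (T i) (hp i) ?_
  simp [h0]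

end Operators

/-! ### Sturm–Liouville operators `-(1/w) d/dt w d/dt` on an interval -/

section SturmLiouville

/-- On the interval `J`: `F` and `Q` are locally absolutely continuous, `Q = w F'` and
`h = -(1/w) (w F')'` almost everywhere. It is used for positive weights `w` and measures `ν` with
the same null sets as Lebesgue measure on `J`. For `w = 1` it says `F, F' ∈ AC` and `h = -F''`; if
moreover `J` is compact and `h` is square integrable, this means that `F ∈ H²(J)`. -/
structure IsSL (ν : Measure ℝ) (w : ℝ → ℝ) (J : Set ℝ) (F Q h : ℝ → ℂ) : Prop where
  ac : ∀ a b, a ≤ b → Icc a b ⊆ J → AbsolutelyContinuousOnInterval F a b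
  ac_quasi : ∀ a b, a ≤ b → Icc a b ⊆ J → AbsolutelyContinuousOnInterval Q a b
  deriv_eq : ∀ᵐ x ∂ν, HasDerivAt F ((w x : ℂ)⁻¹ * Q x) x
  deriv_quasi_eq : ∀ᵐ x ∂ν, HasDerivAt Q (-((w x : ℂ) * h x)) x

variable {ν : Measure ℝ} {w : ℝ → ℝ} {J : Set ℝ} {F Q h F' Q' h' k : ℝ → ℂ}

theorem IsSL.add (H : IsSL ν w J F Q h) (H' : IsSL ν w J F' Q' h')
    (hk : ∀ᵐ x ∂ν, k x = h x + h' x) : IsSL ν w J (F + F') (Q + Q') k where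
  ac a b hab hJ := (H.ac a b hab hJ).add (H'.ac a b hab hJ)
  ac_quasi a b hab hJ := (H.ac_quasi a b hab hJ).add (H'.ac_quasi a b hab hJ)
  deriv_eq := by
    filter_upwards [H.deriv_eq, H'.deriv_eq] with x h1 h2
    simpa [mul_add] using h1.add h2
  deriv_quasi_eq := by
    filter_upwards [H.deriv_quasi_eq, H'.deriv_quasi_eq, hk] with x h1 h2 h3
    rw [h3, mul_add, neg_add]
    exact h1.add h2

theorem IsSL.smul (c : ℂ) (H : IsSL ν w J F Q h) (hk : ∀ᵐ x ∂ν, k x = c * h x) :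
    IsSL ν w J (c • F) (c • Q) k where
  ac a b hab hJ := (H.ac a b hab hJ).const_smul c
  ac_quasi a b hab hJ := (H.ac_quasi a b hab hJ).const_smul c
  deriv_eq := by
    filter_upwards [H.deriv_eq] with x h1
    have := h1.const_smul c
    simpa [mul_left_comm] using this
  deriv_quasi_eq := by
    filter_upwards [H.deriv_quasi_eq, hk] with x h1 h2
    have := h1.const_smul c
    rw [h2]
    simpa [mul_left_comm] using this

theorem IsSL.zero (hk : ∀ᵐ x ∂ν, k x = 0) : IsSL ν w J 0 0 k where
  ac a b _ _ := (contDiff_zero_fun (𝕜 := ℝ) (E := ℝ) (F := ℂ) (n := 1)).contDiffOn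
    |>.absolutelyContinuousOnInterval
  ac_quasi a b _ _ := (contDiff_zero_fun (𝕜 := ℝ) (E := ℝ) (F := ℂ) (n := 1)).contDiffOn
    |>.absolutelyContinuousOnInterval
  deriv_eq := by
    filter_upwards with x
    simp
  deriv_quasi_eq := by
    filter_upwards [hk] with x hx
    simp [hx]

/-- `h` is determined by the class of `F` modulo null sets. -/
theorem IsSL.eq_zero (hJ : J.OrdConnected) (hν : ν ≪ volume.restrict J)
    (hν' : volume.restrict J ≪ ν) (hw : ∀ x ∈ J, w x ≠ 0) (H : IsSL ν w J F Q h)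
    (hF : ∀ᵐ x ∂ν, F x = 0) : ∀ᵐ x ∂ν, h x = 0 := by
  have hint : ∀ᵐ x ∂ν, x ∈ interior J := by
    apply hν.ae_le
    have hc : Convex ℝ J := hJ.convex
    have h1 : ∀ᵐ x ∂(volume.restrict J), x ∈ J := ae_restrict_mem₀ (hc.nullMeasurableSet _)
    have h2 : ∀ᵐ x ∂(volume.restrict J), x ∉ frontier J :=
      ae_restrict_of_ae (measure_eq_zero_iff_ae_notMem.1 (hc.addHaar_frontier volume))
    filter_upwards [h1, h2] with x hx1 hx2
    by_contra hx
    exact hx2 ⟨subset_closure hx1, hx⟩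
  have key : ∀ G : ℝ → ℂ, (∀ a b, a ≤ b → Icc a b ⊆ J → AbsolutelyContinuousOnInterval G a b) →
      (∀ᵐ x ∂ν, G x = 0) → ∀ x ∈ interior J, HasDerivAt G 0 x := by
    intro G hG h0
    have hcont : ContinuousOn G (interior J) := by
      intro x hx
      obtain ⟨ε, hε, hball⟩ := Metric.isOpen_iff.1 isOpen_interior x hx
      have hsub : Icc (x - ε / 2) (x + ε / 2) ⊆ J := fun y hy => interior_subset (hball (by
        rw [Metric.mem_ball, Real.dist_eq, abs_lt]
        constructor <;> linarith [hy.1, hy.2]))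
      have hac := (hG _ _ (by linarith) hsub).continuousOn
      rw [uIcc_of_le (by linarith)] at hac
      exact (hac.continuousAt (Icc_mem_nhds (by linarith) (by linarith))).continuousWithinAt
    have heq : EqOn G (fun _ => (0 : ℂ)) (interior J) := by
      refine Measure.eqOn_open_of_ae_eq (μ := volume) ?_ isOpen_interior hcont continuousOn_const
      exact ae_restrict_of_ae_restrict_of_subset interior_subset (hν'.ae_le h0)
    intro x hx
    refine (hasDerivAt_const x (0 : ℂ)).congr_of_eventuallyEq ?_
    filter_upwards [isOpen_interior.mem_nhds hx] with y hy using heq hy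
  have hQ : ∀ᵐ x ∂ν, Q x = 0 := by
    filter_upwards [hint, H.deriv_eq] with x hx h1
    have := h1.unique (key F H.ac hF x hx)
    have hwx : (w x : ℂ) ≠ 0 := by exact_mod_cast hw x (interior_subset hx)
    simpa [hwx] using this
  filter_upwards [hint, H.deriv_quasi_eq] with x hx h1
  have := h1.unique (key Q H.ac_quasi hQ x hx)
  have hwx : (w x : ℂ) ≠ 0 := by exact_mod_cast hw x (interior_subset hx)
  simpa [hwx] using this

/-- The graph of `-(1/w) d/dt w d/dt` in `L²(ν)` on functions `F` on `J` for which `(F, w F')`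
satisfies the linear side conditions `B`. -/
def slGraph (ν : Measure ℝ) (w : ℝ → ℝ) (J : Set ℝ) (B : Submodule ℂ ((ℝ → ℂ) × (ℝ → ℂ))) :
    Submodule ℂ (Lp ℂ 2 ν × Lp ℂ 2 ν) where
  carrier := {p | ∃ F Q : ℝ → ℂ, p.1 =ᵐ[ν] F ∧ IsSL ν w J F Q p.2 ∧ (F, Q) ∈ B}
  add_mem' := by
    rintro ⟨f, g⟩ ⟨f', g'⟩ ⟨F, Q, hf, hs, hB⟩ ⟨F', Q', hf', hs', hB'⟩
    refine ⟨F + F', Q + Q', (Lp.coeFn_add f f').trans (hf.add hf'), hs.add hs' ?_,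
      B.add_mem hB hB'⟩
    exact Lp.coeFn_add g g'
  zero_mem' := ⟨0, 0, Lp.coeFn_zero _ _ _, .zero (Lp.coeFn_zero _ _ _), B.zero_mem⟩
  smul_mem' := by
    rintro c ⟨f, g⟩ ⟨F, Q, hf, hs, hB⟩
    refine ⟨c • F, c • Q, (Lp.coeFn_smul c f).trans (hf.const_smul c), hs.smul c ?_,
      B.smul_mem c hB⟩
    exact Lp.coeFn_smul c g

/-- The operator `-(1/w) d/dt w d/dt` in `L²(ν)` with the side conditions `B`. -/
noncomputable def slOp (ν : Measure ℝ) (w : ℝ → ℝ) (J : Set ℝ)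
    (B : Submodule ℂ ((ℝ → ℂ) × (ℝ → ℂ))) : Lp ℂ 2 ν →ₗ.[ℂ] Lp ℂ 2 ν :=
  (slGraph ν w J B).toLinearPMap

theorem slOp_graph (hJ : J.OrdConnected) (hν : ν ≪ volume.restrict J)
    (hν' : volume.restrict J ≪ ν) (hw : ∀ x ∈ J, w x ≠ 0)
    (B : Submodule ℂ ((ℝ → ℂ) × (ℝ → ℂ))) : (slOp ν w J B).graph = slGraph ν w J B := by
  refine Submodule.toLinearPMap_graph_eq _ ?_
  rintro ⟨f, g⟩ ⟨F, Q, hf, hs, -⟩ h0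
  obtain rfl : f = 0 := h0
  have hF : ∀ᵐ x ∂ν, F x = 0 := hf.symm.trans (Lp.coeFn_zero _ _ _)
  have hg : g =ᵐ[ν] 0 := hs.eq_zero hJ hν hν' hw hF
  exact Lp.ext (hg.trans (Lp.coeFn_zero _ _ _).symm)

/-- Dirichlet conditions at `a` and `b`. -/
def dirichletConditions (a b : ℝ) : Submodule ℂ ((ℝ → ℂ) × (ℝ → ℂ)) where
  carrier := {p | p.1 a = 0 ∧ p.1 b = 0}
  add_mem' := by
    rintro p q ⟨h1, h2⟩ ⟨h3, h4⟩
    simp [h1, h2, h3, h4]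
  zero_mem' := by simp
  smul_mem' := by
    rintro c p ⟨h1, h2⟩
    simp [h1, h2]

/-- The Neumann condition at `0`, and compact support in `J = [0, L)`. -/
def neumannCompactSupport (J : Set ℝ) (hJ : 0 ∈ J) : Submodule ℂ ((ℝ → ℂ) × (ℝ → ℂ)) where
  carrier := {p | p.2 0 = 0 ∧ ∃ c ∈ J, ∀ x ∈ J, c ≤ x → p.1 x = 0}
  add_mem' := by
    rintro p q ⟨h1, c, hc, h2⟩ ⟨h3, d, hd, h4⟩
    refine ⟨by simp [h1, h3], max c d, ?_, fun x hx hcx => ?_⟩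
    · rcases max_choice c d with h | h <;> rw [h] <;> assumption
    · simp [h2 x hx (le_trans (le_max_left _ _) hcx), h4 x hx (le_trans (le_max_right _ _) hcx)]
  zero_mem' := ⟨rfl, 0, hJ, fun _ _ _ => rfl⟩
  smul_mem' := by
    rintro a p ⟨h1, c, hc, h2⟩
    exact ⟨by simp [h1], c, hc, fun x hx hcx => by simp [h2 x hx hcx]⟩

end SturmLiouville

/-! ### Radially symmetric antitrees -/

/-- A radially symmetric metric antitree on the vertex set `V`: a connected locally finite simple
graph with a root, in which two vertices are adjacent exactly when they lie in consecutive spheres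
around the root; all edges between the `n`-th and the `(n+1)`-st sphere have length `ℓ n`. -/
structure RadialAntitree (V : Type*) where
  graph : SimpleGraph V
  root : V
  connected : graph.Connected
  adj_iff : ∀ u v, graph.Adj u v ↔
    graph.dist root v = graph.dist root u + 1 ∨ graph.dist root u = graph.dist root v + 1
  finite_sphere : ∀ n, {v | graph.dist root v = n}.Finite
  ℓ : ℕ → ℝ
  ℓ_pos : ∀ n, 0 < ℓ n

namespace RadialAntitree

variable {V : Type*} (A : RadialAntitree V)

/-- The combinatorial sphere `S_n` around the root. -/
abbrev Sphere (n : ℕ) : Type _ := {v : V // A.graph.dist A.root v = n}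

noncomputable instance (n : ℕ) : Fintype (A.Sphere n) := (A.finite_sphere n).fintype

/-- The sphere numbers `s_n`. -/
noncomputable def s (n : ℕ) : ℕ := Fintype.card (A.Sphere n)

/-- The edges, directed away from the root: `⟨n, (u, v)⟩` joins `u ∈ S_n` to `v ∈ S_(n+1)`. -/
abbrev Edge : Type _ := Σ n : ℕ, A.Sphere n × A.Sphere (n + 1)

/-- `t_n = ℓ_0 + ⋯ + ℓ_(n-1)`, the distance of `S_n` from the root. -/
noncomputable def t (n : ℕ) : ℝ := ∑ k ∈ Finset.range n, A.ℓ k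

/-- Lebesgue measure on `[t_n, t_(n+1)]`. Each edge `⟨n, (u, v)⟩` is identified with this interval,
of length `ℓ_n`, through the distance to the root. -/
noncomputable def cellMeasure (n : ℕ) : Measure ℝ := volume.restrict (Icc (A.t n) (A.t (n + 1)))

/-- The Hilbert space `L²(A) = ⨁_e L²(e)`. -/
abbrev L2 : Type _ := lp (fun e : A.Edge => Lp ℂ 2 (A.cellMeasure e.1)) 2

/-- The restriction of `f` to the edge joining `u ∈ S_n` to `v ∈ S_(n+1)`. -/
noncomputable def onEdge (f : A.L2) (n : ℕ) (u : A.Sphere n) (v : A.Sphere (n + 1)) :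
    Lp ℂ 2 (A.cellMeasure n) := f ⟨n, (u, v)⟩

@[simp] theorem onEdge_add (f g : A.L2) (n : ℕ) (u : A.Sphere n) (v : A.Sphere (n + 1)) :
    A.onEdge (f + g) n u v = A.onEdge f n u v + A.onEdge g n u v := rfl

@[simp] theorem onEdge_smul (c : ℂ) (f : A.L2) (n : ℕ) (u : A.Sphere n) (v : A.Sphere (n + 1)) :
    A.onEdge (c • f) n u v = c • A.onEdge f n u v := rfl

@[simp] theorem onEdge_zero (n : ℕ) (u : A.Sphere n) (v : A.Sphere (n + 1)) :
    A.onEdge 0 n u v = 0 := rfl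

/-- The functions `F` with edgewise derivative `Q` (in the direction away from the root) satisfy the
Kirchhoff conditions: at every vertex they are continuous, and the sum of the outgoing derivatives
over all edges at the vertex vanishes. -/
structure Kirchhoff (F Q : A.Edge → ℝ → ℂ) : Prop where
  continuous : ∃ φ : V → ℂ, ∀ n (u : A.Sphere n) (v : A.Sphere (n + 1)),
    F ⟨n, (u, v)⟩ (A.t n) = φ u ∧ F ⟨n, (u, v)⟩ (A.t (n + 1)) = φ v
  flux_root : ∀ u : A.Sphere 0, ∑ v : A.Sphere 1, Q ⟨0, (u, v)⟩ (A.t 0) = 0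
  flux : ∀ n (v : A.Sphere (n + 1)),
    ∑ w : A.Sphere (n + 2), Q ⟨n + 1, (v, w)⟩ (A.t (n + 1)) +
      ∑ u : A.Sphere n, -Q ⟨n, (u, v)⟩ (A.t (n + 1)) = 0

/-- The graph of the pre-minimal Kirchhoff Laplacian `H₀`: edgewise `H²` functions of compact
support satisfying the Kirchhoff conditions, mapped to their negative edgewise second derivative. -/
def preKirchhoffGraph : Submodule ℂ (A.L2 × A.L2) where
  carrier := {p | {e | p.1 e ≠ 0}.Finite ∧ ∃ F Q : A.Edge → ℝ → ℂ,
    (∀ e, p.1 e =ᵐ[A.cellMeasure e.1] F e ∧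
      IsSL (A.cellMeasure e.1) (fun _ => 1) (Icc (A.t e.1) (A.t (e.1 + 1))) (F e) (Q e) (p.2 e)) ∧
    A.Kirchhoff F Q}
  add_mem' := by
    rintro ⟨f, g⟩ ⟨f', g'⟩ ⟨hfin, F, Q, hs, ⟨φ, hφ⟩, hr, hx⟩ ⟨hfin', F', Q', hs', ⟨φ', hφ'⟩, hr', hx'⟩
    refine ⟨(hfin.union hfin').subset ?_, F + F', Q + Q', fun e => ⟨?_, ?_⟩, ⟨φ + φ', ?_⟩, ?_, ?_⟩
    · intro e he
      by_contra hc
      simp only [mem_union, mem_ofPred_eq, not_or, not_not] at hc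
      exact he (by simp [hc.1, hc.2])
    · exact (Lp.coeFn_add (f e) (f' e)).trans ((hs e).1.add (hs' e).1)
    · exact (hs e).2.add (hs' e).2 (Lp.coeFn_add (g e) (g' e))
    · intro n u v
      simp [hφ n u v, hφ' n u v]
    · intro u
      simp [Finset.sum_add_distrib, hr u, hr' u]
    · intro n v
      have h1 := hx n v
      have h2 := hx' n v
      simp only [Pi.add_apply, neg_add, Finset.sum_add_distrib] at h1 h2 ⊢
      linear_combination h1 + h2
  zero_mem' := by
    refine ⟨by simp, 0, 0, fun e => ⟨Lp.coeFn_zero _ _ _, .zero (Lp.coeFn_zero _ _ _)⟩,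
      ⟨0, ?_⟩, ?_, ?_⟩ <;> simp
  smul_mem' := by
    rintro c ⟨f, g⟩ ⟨hfin, F, Q, hs, ⟨φ, hφ⟩, hr, hx⟩
    refine ⟨hfin.subset ?_, c • F, c • Q, fun e => ⟨?_, ?_⟩, ⟨c • φ, ?_⟩, ?_, ?_⟩
    · intro e he (hc : f e = 0)
      exact he (by simp [hc])
    · exact (Lp.coeFn_smul c (f e)).trans ((hs e).1.const_smul c)
    · exact (hs e).2.smul c (Lp.coeFn_smul c (g e))
    · intro n u v
      simp [hφ n u v]
    · intro u
      have := hr u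
      simp [← Finset.mul_sum, this]
    · intro n v
      have h1 := hx n v
      simp only [Pi.smul_apply, smul_eq_mul, ← mul_neg, ← Finset.mul_sum] at h1 ⊢
      rw [← mul_add, h1, mul_zero]

/-- The pre-minimal Kirchhoff Laplacian `H₀`. -/
noncomputable def preKirchhoff : A.L2 →ₗ.[ℂ] A.L2 := A.preKirchhoffGraph.toLinearPMap

/-- The minimal Kirchhoff Laplacian `H`, the closure of `H₀`. -/
noncomputable def kirchhoff : A.L2 →ₗ.[ℂ] A.L2 := A.preKirchhoff.closure

theorem t_lt (n : ℕ) : A.t n < A.t (n + 1) := by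
  simp [t, Finset.sum_range_succ, A.ℓ_pos n]

theorem preKirchhoff_graph : A.preKirchhoff.graph = A.preKirchhoffGraph := by
  refine Submodule.toLinearPMap_graph_eq _ ?_
  rintro ⟨f, g⟩ ⟨-, F, Q, hs, -⟩ h0
  obtain rfl : f = 0 := h0
  ext1
  funext e
  have hF : ∀ᵐ x ∂A.cellMeasure e.1, F e x = 0 :=
    (hs e).1.symm.trans (Lp.coeFn_zero _ _ _)
  have hg : g e =ᵐ[A.cellMeasure e.1] 0 := (hs e).2.eq_zero ordConnected_Icc
    (Measure.AbsolutelyContinuous.refl _) (Measure.AbsolutelyContinuous.refl _) (by simp) hF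
  exact Lp.ext (hg.trans (Lp.coeFn_zero _ _ _).symm)

/-! ### The subspaces of the decomposition -/

/-- `F_sym`: the functions that depend only on the distance to the root. -/
def symSubspace : Submodule ℂ A.L2 where
  carrier := {f | ∀ n (e e' : A.Sphere n × A.Sphere (n + 1)), f ⟨n, e⟩ = f ⟨n, e'⟩}
  add_mem' := fun {f g} hf hg n e e' => by simp [hf n e e', hg n e e']
  zero_mem' := fun n e e' => by simp
  smul_mem' := fun c f hf n e e' => by simp [hf n e e']

/-- `F_n⁰`: the functions supported on the edges between `S_n` and `S_(n+1)` whose sum over the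
edges leaving `u` vanishes for each `u ∈ S_n`, and whose sum over the edges entering `v` vanishes
for each `v ∈ S_(n+1)`. -/
def zeroSubspace (n : ℕ) : Submodule ℂ A.L2 where
  carrier := {f | (∀ m e, m ≠ n → f ⟨m, e⟩ = 0) ∧
    (∀ u : A.Sphere n, ∑ v : A.Sphere (n + 1), A.onEdge f n u v = 0) ∧
    (∀ v : A.Sphere (n + 1), ∑ u : A.Sphere n, A.onEdge f n u v = 0)}
  add_mem' := by
    rintro f g ⟨h1, h2, h3⟩ ⟨h1', h2', h3'⟩
    refine ⟨fun m e hm => ?_, fun u => ?_, fun v => ?_⟩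
    · simp [h1 m e hm, h1' m e hm]
    · simp [Finset.sum_add_distrib, h2 u, h2' u]
    · simp [Finset.sum_add_distrib, h3 v, h3' v]
  zero_mem' := by simp
  smul_mem' := by
    rintro c f ⟨h1, h2, h3⟩
    refine ⟨fun m e hm => ?_, fun u => ?_, fun v => ?_⟩
    · simp [h1 m e hm]
    · simp [← Finset.smul_sum, h2 u]
    · simp [← Finset.smul_sum, h3 v]

/-- The edge `⟨m, (u, w)⟩` is incident to the vertex `v`. -/
def Incident (v : V) (e : A.Edge) : Prop := (e.2.1 : V) = v ∨ (e.2.2 : V) = v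

/-- The functions that vanish off the star of `v` and depend on this star only on the distance to
the root. -/
def starSubspace (v : V) : Submodule ℂ A.L2 where
  carrier := {f | (∀ e, ¬ A.Incident v e → f e = 0) ∧
    ∀ n (e e' : A.Sphere n × A.Sphere (n + 1)), A.Incident v ⟨n, e⟩ → A.Incident v ⟨n, e'⟩ →
      f ⟨n, e⟩ = f ⟨n, e'⟩}
  add_mem' := by
    rintro f g ⟨h1, h2⟩ ⟨h1', h2'⟩
    refine ⟨fun e he => ?_, fun n e e' he he' => ?_⟩
    · simp [h1 e he, h1' e he]
    · simp [h2 n e e' he he', h2' n e e' he he']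
  zero_mem' := by simp
  smul_mem' := by
    rintro c f ⟨h1, h2⟩
    refine ⟨fun e he => ?_, fun n e e' he he' => ?_⟩
    · simp [h1 e he]
    · simp [h2 n e e' he he']

/-- `F_n = (⨁_{v ∈ S_n} starSubspace v) ⊖ F_sym`. -/
noncomputable def sphereSubspace (n : ℕ) : Submodule ℂ A.L2 :=
  (⨆ v : A.Sphere n, A.starSubspace v) ⊓ A.symSubspaceᗮ

/-- The index set of the decomposition. -/
inductive Block : Type
  | sym
  | sphere (n : ℕ)
  | zero (n : ℕ)

/-- The subspaces `F_sym`, `F_n` and `F_n⁰`, where `n` runs through `1, 2, …`. -/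
noncomputable def subspace : Block → Submodule ℂ A.L2
  | .sym => A.symSubspace
  | .sphere n => A.sphereSubspace (n + 1)
  | .zero n => A.zeroSubspace (n + 1)

/-! ### The Sturm–Liouville model -/

/-- The weight `μ`, equal to `s_n s_(n+1)` on `[t_n, t_(n+1))`. -/
noncomputable def weight (x : ℝ) : ℝ :=
  ∑' n, (Ico (A.t n) (A.t (n + 1))).indicator (fun _ => (A.s n * A.s (n + 1) : ℝ)) x

/-- The interval `[0, L)`, `L = ∑ ℓ_n ≤ ∞`. -/
def radialInterval : Set ℝ := {x | 0 ≤ x ∧ ∃ n, x < A.t n}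

theorem zero_mem_radialInterval : 0 ∈ A.radialInterval :=
  ⟨le_rfl, 1, by simpa [t] using A.ℓ_pos 0⟩

/-- The measure `μ(x) dx` on `J`. -/
noncomputable def weightedMeasure (J : Set ℝ) : Measure ℝ :=
  (volume.restrict J).withDensity fun x => ENNReal.ofReal (A.weight x)

/-- The pre-minimal operator `-(1/μ) d/dt μ d/dt` in `L²([0, L); μ)` with the Neumann condition
at `0`, on functions of compact support in `[0, L)`. -/
noncomputable def preRadial :
    Lp ℂ 2 (A.weightedMeasure A.radialInterval) →ₗ.[ℂ]
      Lp ℂ 2 (A.weightedMeasure A.radialInterval) :=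
  slOp (A.weightedMeasure A.radialInterval) A.weight A.radialInterval
    (neumannCompactSupport A.radialInterval A.zero_mem_radialInterval)

/-- The Dirichlet Laplacian `h_n` in `L²(t_n, t_(n+1))`. -/
noncomputable def dirichlet (n : ℕ) :
    Lp ℂ 2 (A.cellMeasure n) →ₗ.[ℂ] Lp ℂ 2 (A.cellMeasure n) :=
  slOp (A.cellMeasure n) (fun _ => 1) (Icc (A.t n) (A.t (n + 1)))
    (dirichletConditions (A.t n) (A.t (n + 1)))

/-- The operator `-(1/μ) d/dt μ d/dt` in `L²((t_n, t_(n+2)); μ)` with Dirichlet conditions at both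
endpoints. -/
noncomputable def weightedDirichlet (n : ℕ) :
    Lp ℂ 2 (A.weightedMeasure (Icc (A.t n) (A.t (n + 2)))) →ₗ.[ℂ]
      Lp ℂ 2 (A.weightedMeasure (Icc (A.t n) (A.t (n + 2)))) :=
  slOp (A.weightedMeasure (Icc (A.t n) (A.t (n + 2)))) A.weight (Icc (A.t n) (A.t (n + 2)))
    (dirichletConditions (A.t n) (A.t (n + 2)))

section Graphs

theorem t_mono : Monotone A.t := monotone_nat_of_le_succ fun n => (A.t_lt n).le

theorem dirichlet_graph (n : ℕ) : (A.dirichlet n).graph =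
    slGraph (A.cellMeasure n) (fun _ => 1) (Icc (A.t n) (A.t (n + 1)))
      (dirichletConditions (A.t n) (A.t (n + 1))) :=
  slOp_graph ordConnected_Icc (Measure.AbsolutelyContinuous.refl _)
    (Measure.AbsolutelyContinuous.refl _) (by simp) _

theorem s_pos [Infinite V] (n : ℕ) : 0 < A.s n := by
  by_contra hn
  have hn0 : IsEmpty (A.Sphere n) := Fintype.card_eq_zero_iff.1 (Nat.eq_zero_of_not_pos hn)
  have hall : ∀ m v, A.graph.dist A.root v ≠ n + m := by
    intro m
    induction m with
    | zero => exact fun v hv => hn0.false ⟨v, hv⟩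
    | succ m ih =>
      intro v hv
      obtain ⟨p, hp⟩ := A.connected.exists_walk_length_eq_dist v A.root
      rw [SimpleGraph.dist_comm, hv] at hp
      cases p with
      | nil => simp at hp
      | cons h q =>
        rename_i u
        simp only [SimpleGraph.Walk.length_cons] at hp
        have h1 := SimpleGraph.dist_le q
        rw [SimpleGraph.dist_comm] at h1
        have h2 := (A.adj_iff _ _).1 h
        exact ih u (by omega)
  have hfin : (⋃ k ∈ Finset.range n, {v | A.graph.dist A.root v = k}).Finite :=
    (Finset.range n).finite_toSet.biUnion fun k _ => A.finite_sphere k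
  refine Set.infinite_univ (hfin.subset fun v _ => ?_)
  have hv : A.graph.dist A.root v < n := by
    by_contra hc
    obtain ⟨m, hm⟩ := Nat.exists_eq_add_of_le (not_lt.1 hc)
    exact hall m v hm
  simpa using hv

theorem weight_eq {n : ℕ} {x : ℝ} (hx : x ∈ Ico (A.t n) (A.t (n + 1))) :
    A.weight x = A.s n * A.s (n + 1) := by
  unfold weight
  rw [tsum_eq_single n, indicator_of_mem hx]
  intro m hm
  refine indicator_of_notMem (fun hx' => ?_) _
  rcases lt_or_gt_of_ne hm with h | h
  · exact absurd (A.t_mono h) (not_le.2 (hx.1.trans_lt hx'.2))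
  · exact absurd (A.t_mono h) (not_le.2 (hx'.1.trans_lt hx.2))

theorem weight_pos [Infinite V] {x : ℝ} (hx : x ∈ A.radialInterval) : 0 < A.weight x := by
  classical
  have hex := hx.2
  obtain ⟨n, hn⟩ : ∃ n, Nat.find hex = n + 1 := by
    refine Nat.exists_eq_succ_of_ne_zero fun h0 => ?_
    have := Nat.find_spec hex
    rw [h0] at this
    exact absurd hx.1 (not_le.2 (by simpa [t] using this))
  have h1 : x < A.t (n + 1) := hn ▸ Nat.find_spec hex
  have h2 : A.t n ≤ x := not_lt.1 (Nat.find_min hex (by omega))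
  rw [A.weight_eq ⟨h2, h1⟩]
  exact mul_pos (by exact_mod_cast A.s_pos n) (by exact_mod_cast A.s_pos (n + 1))

theorem measurable_weight : Measurable A.weight := by
  have : A.weight = fun x => ∑' n, (Ico (A.t n) (A.t (n + 1))).indicator
    (fun _ => (A.s n * A.s (n + 1) : ℝ)) x := rfl
  rw [this]
  exact Measurable.tsum fun n => measurable_const.indicator measurableSet_Ico

theorem ac_weightedMeasure [Infinite V] {J : Set ℝ} (hJm : MeasurableSet J)
    (hJ : J ⊆ A.radialInterval) : volume.restrict J ≪ A.weightedMeasure J := by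
  refine withDensity_absolutelyContinuous' A.measurable_weight.ennreal_ofReal.aemeasurable ?_
  filter_upwards [ae_restrict_mem hJm] with x hx
  simpa using A.weight_pos (hJ hx)

theorem ordConnected_radialInterval : A.radialInterval.OrdConnected := by
  refine ⟨fun x hx y hy z hz => ?_⟩
  obtain ⟨n, hn⟩ := hy.2
  exact ⟨hx.1.trans hz.1, n, hz.2.trans_lt hn⟩

theorem Icc_subset_radialInterval (n m : ℕ) : Icc (A.t n) (A.t m) ⊆ A.radialInterval := by
  intro x hx
  have h0 : A.t 0 ≤ A.t n := A.t_mono (Nat.zero_le n)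
  exact ⟨le_trans (by simpa [t] using h0) hx.1, m + 1, hx.2.trans_lt (A.t_lt m)⟩

theorem preRadial_graph [Infinite V] : A.preRadial.graph =
    slGraph (A.weightedMeasure A.radialInterval) A.weight A.radialInterval
      (neumannCompactSupport A.radialInterval A.zero_mem_radialInterval) :=
  slOp_graph A.ordConnected_radialInterval (withDensity_absolutelyContinuous _ _)
    (A.ac_weightedMeasure A.ordConnected_radialInterval.measurableSet subset_rfl)
    (fun _ hx => (A.weight_pos hx).ne') _

theorem weightedDirichlet_graph [Infinite V] (n : ℕ) : (A.weightedDirichlet n).graph =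
    slGraph (A.weightedMeasure (Icc (A.t n) (A.t (n + 2)))) A.weight (Icc (A.t n) (A.t (n + 2)))
      (dirichletConditions (A.t n) (A.t (n + 2))) :=
  slOp_graph ordConnected_Icc (withDensity_absolutelyContinuous _ _)
    (A.ac_weightedMeasure measurableSet_Icc (A.Icc_subset_radialInterval _ _))
    (fun _ hx => (A.weight_pos (A.Icc_subset_radialInterval _ _ hx)).ne') _

end Graphs

/-- The summands of the model: one radial one, and for every `n ≥ 1` (written `n + 1`)
`(s_n - 1)(s_(n+1) - 1)` Dirichlet ones and `s_n - 1` weighted ones. -/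
inductive Summand : Type
  | sym
  | dirichlet (n : ℕ) (j : Fin ((A.s (n + 1) - 1) * (A.s (n + 2) - 1)))
  | weighted (n : ℕ) (j : Fin (A.s (n + 1) - 1))

/-- The subspace of `L²(A)` to which a summand belongs. -/
def Summand.block : A.Summand → Block
  | .sym => .sym
  | .dirichlet n _ => .zero n
  | .weighted n _ => .sphere n

/-- The underlying measures of the summands. -/
noncomputable def summandMeasure : A.Summand → Measure ℝ
  | .sym => A.weightedMeasure A.radialInterval
  | .dirichlet n _ => A.cellMeasure (n + 1)
  | .weighted n _ => A.weightedMeasure (Icc (A.t n) (A.t (n + 2)))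

/-- The operators in the summands. -/
noncomputable def summandOp :
    ∀ i : A.Summand, Lp ℂ 2 (A.summandMeasure i) →ₗ.[ℂ] Lp ℂ 2 (A.summandMeasure i)
  | .sym => A.preRadial.closure
  | .dirichlet n _ => A.dirichlet (n + 1)
  | .weighted n _ => A.weightedDirichlet n

/-- The Hilbert space of the model. -/
abbrev Model : Type := lp (fun i : A.Summand => Lp ℂ 2 (A.summandMeasure i)) 2

end RadialAntitree

/-! ### Absolutely continuous primitives and the integral form of the equation -/

section Primitive

/-! All edges between two consecutive spheres are identified with the same interval, so on such a
cell $L^2$ is $\mathbb C^{S_m\times S_{m+1}}\otimes L^2(I_m)$. The finite-dimensional factor splits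
orthogonally into the constants, the zero-sum functions of the lower vertex, the zero-sum functions
of the upper vertex, and the matrices with vanishing row and column sums. Orthonormal bases of
zero-sum functions (`sphereBasis`) therefore attach to every summand `i` of the model a number
`coeff i e` for each edge, and `embed i` multiplies a function of the distance to the root by these
numbers. The two zero-sum pieces adjacent to one sphere share a summand, because the vertex
conditions at that sphere couple them.

The map `embed i` is isometric, since the squared coefficients of a cell add up to the density of
the measure of the summand (`isCellSum_summand`). The coefficients are orthogonal and complete in
every cell (`coeff_orthogonal`, `eq_zero_of_coeff`), so the embeddings form a Hilbert sum
(`isHilbertSum_embed`); this is the unitary `modelEquiv`.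

For the operators, continuity at a sphere becomes continuity of the component, and the flux
condition becomes continuity of its quasi-derivative $\mu F'$. At a sphere where the coefficients at
every vertex sum to zero, continuity becomes a Dirichlet condition and the flux condition is empty.
Hence the summand operators embed into the pre-minimal graph (`embed_radial_mem`,
`embed_dirichlet_graph_mem`, `embed_weighted_graph_mem`), and components of pairs in that graph
solve the model problems (`modelEquiv_sym_mem`, `modelEquiv_dirichlet_mem`,
`modelEquiv_weighted_mem`).

On a compact interval the solutions are a bounded operator applied to the right-hand side plus two
free constants, so the edgewise graphs and the Dirichlet graphs are closed. This yields closability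
and, by passing to limits on both sides, `intertwines`. Each subspace is the set of vectors whose
components outside one block vanish (`mem_subspace_iff`), which gives the decomposition and the
reduction. -/

theorem IntervalIntegrable.absolutelyContinuousOnInterval_primitive {φ : ℝ → ℂ} {a b : ℝ}
    (h : IntervalIntegrable φ volume a b) :
    AbsolutelyContinuousOnInterval (fun x => ∫ s in a..x, φ s) a b := by
  have hn := h.norm.absolutelyContinuousOnInterval_intervalIntegral (c := a) left_mem_uIcc
  -- The variation sums of the complex primitive are dominated by those of the real primitive of the
  -- norm, which is known to be absolutely continuous.
  refine squeeze_zero' (.of_forall fun E => Finset.sum_nonneg fun i _ => dist_nonneg) ?_ hn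
  refine Filter.eventually_inf_principal.2 (.of_forall fun E hE => ?_)
  refine Finset.sum_le_sum fun i hi => ?_
  have key : ∀ x ∈ uIcc a b, ∀ y ∈ uIcc a b,
      dist (∫ s in a..x, φ s) (∫ s in a..y, φ s) ≤
        dist (∫ s in a..x, ‖φ s‖) (∫ s in a..y, ‖φ s‖) := by
    intro x hx y hy
    have hax := h.mono_set (uIcc_subset_uIcc left_mem_uIcc hx)
    have hay := h.mono_set (uIcc_subset_uIcc left_mem_uIcc hy)
    rw [dist_eq_norm, Real.dist_eq, intervalIntegral.integral_interval_sub_left hax hay,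
      intervalIntegral.integral_interval_sub_left hax.norm hay.norm]
    exact intervalIntegral.norm_integral_le_abs_integral_norm
  exact key _ (hE.1 i hi).1 _ (hE.1 i hi).2

theorem ae_mem_Ioo_restrict_Icc (a b : ℝ) : ∀ᵐ x ∂volume.restrict (Icc a b), x ∈ Ioo a b := by
  rw [← restrict_Ioo_eq_restrict_Icc]
  exact ae_restrict_mem measurableSet_Ioo

theorem IntervalIntegrable.ae_hasDerivAt_primitive {φ : ℝ → ℂ} {a b c d : ℝ} (hac : a ≤ c)
    (hdb : d ≤ b) (h : IntervalIntegrable φ volume a b) :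
    ∀ᵐ x ∂volume.restrict (Icc c d), HasDerivAt (fun x => ∫ s in a..x, φ s) (φ x) x := by
  filter_upwards [ae_restrict_of_ae h.ae_hasDerivAt_integral, ae_mem_Ioo_restrict_Icc c d]
    with x hx hx'
  have : x ∈ Icc a b := ⟨hac.trans hx'.1.le, hx'.2.le.trans hdb⟩
  have hab := this.1.trans this.2
  exact hx (by rwa [uIcc_of_le hab]) a (by simp)

/-- The difference of the function and the primitive is absolutely continuous with derivative zero
almost everywhere, hence constant. -/
theorem AbsolutelyContinuousOnInterval.eq_add_integral {F φ : ℝ → ℂ} {a b : ℝ} (hab : a ≤ b)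
    (hF : AbsolutelyContinuousOnInterval F a b) (hφ : IntervalIntegrable φ volume a b)
    (hd : ∀ᵐ x ∂volume.restrict (Icc a b), HasDerivAt F (φ x) x) :
    ∀ x ∈ Icc a b, F x = F a + ∫ s in a..x, φ s := by
  obtain ⟨C, hC⟩ := (hF.sub
    hφ.absolutelyContinuousOnInterval_primitive).const_of_ae_hasDerivAt_zero (by
      rw [uIcc_of_le hab, ← ae_restrict_iff' measurableSet_Icc]
      filter_upwards [hd, hφ.ae_hasDerivAt_primitive le_rfl le_rfl] with x h1 h2
      simpa using h1.sub h2)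
  intro x hx
  rw [uIcc_of_le hab] at hC
  have h1 := hC x hx
  have h2 := hC a (left_mem_Icc.2 hab)
  simp only [Pi.sub_apply, intervalIntegral.integral_same, sub_zero] at h1 h2
  rw [h2, ← h1]
  ring

theorem AbsolutelyContinuousOnInterval.const (c : ℂ) (a b : ℝ) :
    AbsolutelyContinuousOnInterval (fun _ => c) a b :=
  (contDiff_const (𝕜 := ℝ) (n := 1)).contDiffOn.absolutelyContinuousOnInterval

end Primitive

/-! ### Closedness of Sturm–Liouville operators on compact intervals -/

section Closed

variable {ν : Measure ℝ} {w : ℝ → ℝ} {a b : ℝ}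

/-- The quasi-derivative of a solution with vanishing initial values. -/
noncomputable def quasiPrimitive (w : ℝ → ℝ) (a : ℝ) (h : ℝ → ℂ) (x : ℝ) : ℂ :=
  ∫ s in a..x, -((w s : ℂ) * h s)

/-- The function with prescribed quasi-derivative `Q` that vanishes at `a`. -/
noncomputable def weightPrimitive (w : ℝ → ℝ) (a : ℝ) (Q : ℝ → ℂ) (x : ℝ) : ℂ :=
  ∫ s in a..x, (w s : ℂ)⁻¹ * Q s

/-- The weight `w` on `[a, b]` is bounded from above and from below and the measure `ν` is
comparable with Lebesgue measure on `[a, b]`. -/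
structure IsRegularWeight (ν : Measure ℝ) (w : ℝ → ℝ) (a b C : ℝ) (K : NNReal) : Prop where
  lt : a < b
  measurable : Measurable w
  pos : ∀ x ∈ Icc a b, 0 < w x
  le : ∀ x ∈ Icc a b, w x ≤ C
  inv_le : ∀ x ∈ Icc a b, (w x)⁻¹ ≤ C
  ac : ν ≪ volume.restrict (Icc a b)
  le_smul : volume.restrict (Icc a b) ≤ K • ν
  finite : IsFiniteMeasure ν

namespace IsRegularWeight

variable {C : ℝ} {K : NNReal}

theorem ac' (R : IsRegularWeight ν w a b C K) : volume.restrict (Icc a b) ≪ ν :=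
  Measure.absolutelyContinuous_of_le_smul R.le_smul

theorem bound_nonneg (R : IsRegularWeight ν w a b C K) : 0 ≤ C :=
  (R.pos a (left_mem_Icc.2 R.lt.le)).le.trans (R.le a (left_mem_Icc.2 R.lt.le))

theorem integrableOn (R : IsRegularWeight ν w a b C K) {h : ℝ → ℂ} (hh : Integrable h ν) :
    IntegrableOn h (Icc a b) := by
  refine Integrable.of_measure_le_smul (c := (K : ENNReal)) ENNReal.coe_ne_top ?_ hh
  exact R.le_smul

theorem intervalIntegrable_mul (R : IsRegularWeight ν w a b C K) {h : ℝ → ℂ}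
    (hh : IntegrableOn h (Icc a b)) :
    IntervalIntegrable (fun s => -((w s : ℂ) * h s)) volume a b := by
  rw [intervalIntegrable_iff_integrableOn_Icc_of_le R.lt.le]
  refine (Integrable.bdd_mul (c := C) hh ?_ ?_).neg
  · exact (Complex.measurable_ofReal.comp R.measurable).aestronglyMeasurable
  · filter_upwards [ae_restrict_mem measurableSet_Icc] with x hx
    rw [Complex.norm_real, Real.norm_of_nonneg (R.pos x hx).le]
    exact R.le x hx

theorem intervalIntegrable_inv_mul (R : IsRegularWeight ν w a b C K) {Q : ℝ → ℂ}
    (hQ : ContinuousOn Q (Icc a b)) :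
    IntervalIntegrable (fun s => (w s : ℂ)⁻¹ * Q s) volume a b := by
  rw [intervalIntegrable_iff_integrableOn_Icc_of_le R.lt.le]
  refine Integrable.bdd_mul (c := C) (hQ.integrableOn_Icc) ?_ ?_
  · exact (Complex.measurable_ofReal.comp R.measurable).inv.aestronglyMeasurable
  · filter_upwards [ae_restrict_mem measurableSet_Icc] with x hx
    rw [norm_inv, Complex.norm_real, Real.norm_of_nonneg (R.pos x hx).le]
    exact R.inv_le x hx

theorem continuousOn_quasiPrimitive (R : IsRegularWeight ν w a b C K) {h : ℝ → ℂ}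
    (hh : IntegrableOn h (Icc a b)) : ContinuousOn (quasiPrimitive w a h) (Icc a b) := by
  have := (R.intervalIntegrable_mul hh).absolutelyContinuousOnInterval_primitive.continuousOn
  rwa [uIcc_of_le R.lt.le] at this

/-- Solutions of the equation are given by iterated integrals. -/
theorem eq_integral (R : IsRegularWeight ν w a b C K) {F Q h : ℝ → ℂ}
    (hh : IntegrableOn h (Icc a b)) (H : IsSL ν w (Icc a b) F Q h) :
    (∀ x ∈ Icc a b, Q x = Q a + quasiPrimitive w a h x) ∧
      ∀ x ∈ Icc a b, F x = F a + weightPrimitive w a Q x := by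
  have hQ := H.ac_quasi a b R.lt.le subset_rfl
  refine ⟨?_, ?_⟩
  · exact hQ.eq_add_integral R.lt.le (R.intervalIntegrable_mul hh) (R.ac'.ae_le H.deriv_quasi_eq)
  · refine (H.ac a b R.lt.le subset_rfl).eq_add_integral R.lt.le ?_ (R.ac'.ae_le H.deriv_eq)
    refine R.intervalIntegrable_inv_mul ?_
    have := hQ.continuousOn
    rwa [uIcc_of_le R.lt.le] at this

theorem isSL_of_integral (R : IsRegularWeight ν w a b C K) {h : ℝ → ℂ}
    (hh : IntegrableOn h (Icc a b)) (f₀ q₀ : ℂ) :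
    IsSL ν w (Icc a b) (fun x => f₀ + weightPrimitive w a (fun s => q₀ + quasiPrimitive w a h s) x)
      (fun x => q₀ + quasiPrimitive w a h x) h := by
  have h1 := R.intervalIntegrable_mul hh
  have h2 := R.intervalIntegrable_inv_mul (Q := fun x => q₀ + quasiPrimitive w a h x)
    (continuousOn_const.add (R.continuousOn_quasiPrimitive hh))
  have hmono : ∀ c d, c ≤ d → Icc c d ⊆ Icc a b → uIcc c d ⊆ uIcc a b := fun c d hcd hs => by
    rwa [uIcc_of_le hcd, uIcc_of_le R.lt.le]
  refine ⟨fun c d hcd hs => ?_, fun c d hcd hs => ?_, R.ac.ae_le ?_, R.ac.ae_le ?_⟩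
  · exact ((AbsolutelyContinuousOnInterval.const f₀ a b).add
      h2.absolutelyContinuousOnInterval_primitive).mono (hmono c d hcd hs)
  · exact ((AbsolutelyContinuousOnInterval.const q₀ a b).add
      h1.absolutelyContinuousOnInterval_primitive).mono (hmono c d hcd hs)
  · filter_upwards [h2.ae_hasDerivAt_primitive le_rfl le_rfl] with x hx
    exact hx.const_add f₀
  · filter_upwards [h1.ae_hasDerivAt_primitive le_rfl le_rfl] with x hx
    exact hx.const_add q₀

theorem integrable_Lp (R : IsRegularWeight ν w a b C K) (h : Lp ℂ 2 ν) :
    IntegrableOn h (Icc a b) := by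
  have := R.finite
  exact R.integrableOn ((Lp.memLp h).integrable (by norm_num))

/-- The `L¹` norm on `[a, b]` is bounded by the `L²` norm. -/
theorem integral_norm_le (R : IsRegularWeight ν w a b C K) :
    ∃ c, 0 ≤ c ∧ ∀ h : Lp ℂ 2 ν, ∫ x in Icc a b, ‖h x‖ ≤ c * ‖h‖ := by
  have := R.finite
  refine ⟨K * ν.real univ ^ ((1 : ℝ) / 2), by positivity, fun h => ?_⟩
  have hi : Integrable h ν := (Lp.memLp h).integrable (by norm_num)
  have h1 : ∫ x in Icc a b, ‖h x‖ ≤ ∫ x, ‖h x‖ ∂(K • ν) :=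
    integral_mono_measure R.le_smul (.of_forall fun x => norm_nonneg _)
      (hi.norm.smul_measure (c := (K : ENNReal)) ENNReal.coe_ne_top)
  have h2 : ∫ x, ‖h x‖ ∂ν ≤ ν.real univ ^ ((1 : ℝ) / 2) * ‖h‖ := by
    have e := eLpNorm_le_eLpNorm_mul_rpow_measure_univ (μ := ν) (p := 1) (q := 2) (f := h)
      (by norm_num) (Lp.aestronglyMeasurable h)
    rw [integral_norm_eq_lintegral_enorm hi.1, ← eLpNorm_one_eq_lintegral_enorm, Lp.norm_def]
    have := ENNReal.toReal_mono (ENNReal.mul_ne_top (Lp.eLpNorm_ne_top h)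
      (ENNReal.rpow_ne_top_of_nonneg (by norm_num) (measure_ne_top ν univ))) e
    refine this.trans_eq ?_
    rw [ENNReal.toReal_mul, ← ENNReal.toReal_rpow, mul_comm]
    norm_num [Measure.real]
  rw [integral_smul_nnreal_measure] at h1
  calc _ ≤ _ := h1
    _ = K * ∫ x, ‖h x‖ ∂ν := by simp [NNReal.smul_def]
    _ ≤ _ := by
      rw [mul_assoc]
      gcongr

theorem norm_quasiPrimitive_le (R : IsRegularWeight ν w a b C K) {h : ℝ → ℂ}
    (hh : IntegrableOn h (Icc a b)) {x : ℝ} (hx : x ∈ Icc a b) :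
    ‖quasiPrimitive w a h x‖ ≤ C * ∫ s in Icc a b, ‖h s‖ := by
  have hi := R.intervalIntegrable_mul hh
  rw [intervalIntegrable_iff_integrableOn_Icc_of_le R.lt.le] at hi
  calc ‖quasiPrimitive w a h x‖ ≤ ∫ s in Ioc a x, ‖-((w s : ℂ) * h s)‖ := by
        rw [quasiPrimitive, intervalIntegral.integral_of_le hx.1]
        exact norm_integral_le_integral_norm _
    _ ≤ ∫ s in Icc a b, ‖-((w s : ℂ) * h s)‖ :=
        setIntegral_mono_set hi.norm (.of_forall fun _ => norm_nonneg _)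
          (Ioc_subset_Icc_self.trans (Icc_subset_Icc_right hx.2)).eventuallyLE
    _ ≤ ∫ s in Icc a b, C * ‖h s‖ := by
        refine setIntegral_mono_on hi.norm (hh.norm.const_mul C) measurableSet_Icc fun s hs => ?_
        rw [norm_neg, norm_mul, Complex.norm_real, Real.norm_of_nonneg (R.pos s hs).le]
        gcongr
        exact R.le s hs
    _ = _ := integral_const_mul _ _

theorem norm_weightPrimitive_le (R : IsRegularWeight ν w a b C K) {Q : ℝ → ℂ} {M : ℝ}
    (hM : ∀ x ∈ Icc a b, ‖Q x‖ ≤ M) {x : ℝ} (hx : x ∈ Icc a b) :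
    ‖weightPrimitive w a Q x‖ ≤ C * M * (b - a) := by
  have hM0 : 0 ≤ M := (norm_nonneg _).trans (hM a (left_mem_Icc.2 R.lt.le))
  have : ‖weightPrimitive w a Q x‖ ≤ C * M * |x - a| := by
    refine intervalIntegral.norm_integral_le_of_norm_le_const fun s hs => ?_
    rw [uIoc_of_le hx.1] at hs
    have hs' : s ∈ Icc a b := ⟨hs.1.le, hs.2.trans hx.2⟩
    rw [norm_mul, norm_inv, Complex.norm_real, Real.norm_of_nonneg (R.pos s hs').le]
    exact mul_le_mul (R.inv_le s hs') (hM s hs') (norm_nonneg _) R.bound_nonneg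
  refine this.trans ?_
  rw [abs_of_nonneg (by linarith [hx.1])]
  have := R.bound_nonneg
  gcongr
  exact hx.2

/-- The solution with vanishing initial values. -/
noncomputable def _root_.initialSolution (w : ℝ → ℝ) (a : ℝ) (h : ℝ → ℂ) : ℝ → ℂ :=
  weightPrimitive w a (quasiPrimitive w a h)

/-- The integrals do not see null sets, so almost everywhere additivity of representatives becomes
additivity at every point. The pointwise form is needed at the endpoint `b`. -/
theorem initialSolution_add (R : IsRegularWeight ν w a b C K) (g h : Lp ℂ 2 ν) {x : ℝ}
    (hx : x ∈ Icc a b) : initialSolution w a ((g + h : Lp ℂ 2 ν)) x =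
      initialSolution w a g x + initialSolution w a h x := by
  have hg := R.integrable_Lp g
  have hh := R.integrable_Lp h
  have hsub : ∀ y ∈ Icc a b, uIcc a y ⊆ uIcc a b := fun y hy => by
    rw [uIcc_of_le hy.1, uIcc_of_le R.lt.le]
    exact Icc_subset_Icc_right hy.2
  have hq : ∀ y ∈ Icc a b, quasiPrimitive w a ((g + h : Lp ℂ 2 ν)) y =
      quasiPrimitive w a g y + quasiPrimitive w a h y := by
    intro y hy
    rw [quasiPrimitive, quasiPrimitive, quasiPrimitive, ← intervalIntegral.integral_add
      ((R.intervalIntegrable_mul hg).mono_set (hsub y hy))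
      ((R.intervalIntegrable_mul hh).mono_set (hsub y hy))]
    refine intervalIntegral.integral_congr_ae_restrict ?_
    have : ∀ᵐ s ∂volume.restrict (Icc a b), (g + h : Lp ℂ 2 ν) s = g s + h s :=
      R.ac'.ae_le (Lp.coeFn_add g h)
    refine ae_restrict_of_ae_restrict_of_subset ?_ (this.mono fun s hs => ?_)
    · rw [uIoc_of_le hy.1]
      exact Ioc_subset_Icc_self.trans (Icc_subset_Icc_right hy.2)
    · simp only [hs]
      ring
  rw [initialSolution, initialSolution, initialSolution, weightPrimitive, weightPrimitive,
    weightPrimitive, ← intervalIntegral.integral_add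
      ((R.intervalIntegrable_inv_mul (R.continuousOn_quasiPrimitive hg)).mono_set (hsub x hx))
      ((R.intervalIntegrable_inv_mul (R.continuousOn_quasiPrimitive hh)).mono_set (hsub x hx))]
  refine intervalIntegral.integral_congr fun s hs => ?_
  rw [uIcc_of_le hx.1] at hs
  simp only [hq s ⟨hs.1, hs.2.trans hx.2⟩]
  ring

theorem initialSolution_smul (R : IsRegularWeight ν w a b C K) (c : ℂ) (h : Lp ℂ 2 ν) {x : ℝ}
    (hx : x ∈ Icc a b) : initialSolution w a ((c • h : Lp ℂ 2 ν)) x =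
      c * initialSolution w a h x := by
  have hq : ∀ y ∈ Icc a b, quasiPrimitive w a ((c • h : Lp ℂ 2 ν)) y =
      c * quasiPrimitive w a h y := by
    intro y hy
    rw [quasiPrimitive, quasiPrimitive, ← intervalIntegral.integral_const_mul]
    refine intervalIntegral.integral_congr_ae_restrict ?_
    have : ∀ᵐ s ∂volume.restrict (Icc a b), (c • h : Lp ℂ 2 ν) s = c • h s :=
      R.ac'.ae_le (Lp.coeFn_smul c h)
    refine ae_restrict_of_ae_restrict_of_subset ?_ (this.mono fun s hs => ?_)
    · rw [uIoc_of_le hy.1]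
      exact Ioc_subset_Icc_self.trans (Icc_subset_Icc_right hy.2)
    · simp only [hs, smul_eq_mul]
      ring
  rw [initialSolution, initialSolution, weightPrimitive, weightPrimitive,
    ← intervalIntegral.integral_const_mul]
  refine intervalIntegral.integral_congr fun s hs => ?_
  rw [uIcc_of_le hx.1] at hs
  simp only [hq s ⟨hs.1, hs.2.trans hx.2⟩]
  ring

/-- The supremum bound in terms of the $L^2$ norm makes both the solution operator and the
evaluation at the right endpoint continuous. -/
theorem norm_initialSolution_le (R : IsRegularWeight ν w a b C K) :
    ∃ c, 0 ≤ c ∧ ∀ (h : Lp ℂ 2 ν), ∀ x ∈ Icc a b, ‖initialSolution w a h x‖ ≤ c * ‖h‖ := by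
  obtain ⟨c, hc, hle⟩ := R.integral_norm_le
  have hC := R.bound_nonneg
  have hab : 0 ≤ b - a := by linarith [R.lt]
  refine ⟨C * (C * c) * (b - a), by positivity, fun h x hx => ?_⟩
  have := R.norm_weightPrimitive_le (M := C * (c * ‖h‖)) (fun y hy =>
    (R.norm_quasiPrimitive_le (R.integrable_Lp h) hy).trans
      (mul_le_mul_of_nonneg_left (hle h) hC)) hx
  refine this.trans_eq ?_
  ring

theorem memLp_of_continuousOn (R : IsRegularWeight ν w a b C K) {F : ℝ → ℂ}
    (hF : ContinuousOn F (Icc a b)) : MemLp F 2 ν := by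
  have := R.finite
  obtain ⟨M, hM⟩ := isCompact_Icc.exists_bound_of_continuousOn hF
  refine MemLp.of_bound ?_ M ?_
  · exact (hF.aestronglyMeasurable measurableSet_Icc).mono_ac R.ac
  · exact R.ac.ae_le ((ae_restrict_mem measurableSet_Icc).mono fun x hx => hM x hx)

theorem continuousOn_weightPrimitive (R : IsRegularWeight ν w a b C K) {Q : ℝ → ℂ}
    (hQ : ContinuousOn Q (Icc a b)) : ContinuousOn (weightPrimitive w a Q) (Icc a b) := by
  have :=
    (R.intervalIntegrable_inv_mul hQ).absolutelyContinuousOnInterval_primitive.continuousOn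
  rwa [uIcc_of_le R.lt.le] at this

theorem memLp_initialSolution (R : IsRegularWeight ν w a b C K) (h : Lp ℂ 2 ν) :
    MemLp (initialSolution w a h) 2 ν :=
  R.memLp_of_continuousOn
    (R.continuousOn_weightPrimitive (R.continuousOn_quasiPrimitive (R.integrable_Lp h)))

theorem ae_mem (R : IsRegularWeight ν w a b C K) : ∀ᵐ x ∂ν, x ∈ Icc a b :=
  R.ac.ae_le (ae_restrict_mem measurableSet_Icc)

/-- `initialSolution` as a bounded operator. -/
noncomputable def solutionCLM (R : IsRegularWeight ν w a b C K) : Lp ℂ 2 ν →L[ℂ] Lp ℂ 2 ν :=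
  haveI := R.finite
  LinearMap.mkContinuousOfExistsBound
    { toFun := fun h => (R.memLp_initialSolution h).toLp
      map_add' := fun g h => by
        rw [← MemLp.toLp_add]
        exact MemLp.toLp_congr _ _ (R.ae_mem.mono fun x hx => R.initialSolution_add g h hx)
      map_smul' := fun c h => by
        rw [RingHom.id_apply, ← MemLp.toLp_const_smul]
        exact MemLp.toLp_congr _ _ (R.ae_mem.mono fun x hx => R.initialSolution_smul c h hx) }
    (by
      obtain ⟨c, hc, hle⟩ := R.norm_initialSolution_le
      refine ⟨ν.real univ ^ (2 : ENNReal).toReal⁻¹ * c, fun h => ?_⟩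
      refine (Lp.norm_le_of_ae_bound (C := c * ‖h‖) (by positivity) ?_).trans_eq ?_
      · filter_upwards [R.ae_mem, (R.memLp_initialSolution h).coeFn_toLp] with x hx hx'
        simp only [LinearMap.coe_mk, AddHom.coe_mk]
        rw [hx']
        exact hle h x hx
      · rw [mul_assoc]
        rfl)

theorem coeFn_solutionCLM (R : IsRegularWeight ν w a b C K) (h : Lp ℂ 2 ν) :
    R.solutionCLM h =ᵐ[ν] initialSolution w a h :=
  (R.memLp_initialSolution h).coeFn_toLp

/-- The value of `initialSolution` at the right endpoint as a bounded functional. -/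
noncomputable def endValueCLM (R : IsRegularWeight ν w a b C K) : Lp ℂ 2 ν →L[ℂ] ℂ :=
  LinearMap.mkContinuousOfExistsBound
    { toFun := fun h => initialSolution w a h b
      map_add' := fun g h => R.initialSolution_add g h (right_mem_Icc.2 R.lt.le)
      map_smul' := fun c h => R.initialSolution_smul c h (right_mem_Icc.2 R.lt.le) }
    (by
      obtain ⟨c, -, hle⟩ := R.norm_initialSolution_le
      exact ⟨c, fun h => hle h b (right_mem_Icc.2 R.lt.le)⟩)

/-- The constant function `1` as an element of `L²(ν)`. -/
noncomputable def oneLp (R : IsRegularWeight ν w a b C K) : Lp ℂ 2 ν :=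
  (R.memLp_of_continuousOn (F := fun _ => 1) continuousOn_const).toLp

/-- The function `∫ 1/w` as an element of `L²(ν)`. -/
noncomputable def weightLp (R : IsRegularWeight ν w a b C K) : Lp ℂ 2 ν :=
  (R.memLp_of_continuousOn (F := weightPrimitive w a fun _ => 1)
    (R.continuousOn_weightPrimitive continuousOn_const)).toLp

theorem weightPrimitive_const_add (R : IsRegularWeight ν w a b C K) (h : Lp ℂ 2 ν) (q₀ : ℂ) {x : ℝ}
    (hx : x ∈ Icc a b) : weightPrimitive w a (fun s => q₀ + quasiPrimitive w a h s) x =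
      q₀ * weightPrimitive w a (fun _ => 1) x + initialSolution w a h x := by
  have hsub : uIcc a x ⊆ uIcc a b := by
    rw [uIcc_of_le hx.1, uIcc_of_le R.lt.le]
    exact Icc_subset_Icc_right hx.2
  have h1 := (R.intervalIntegrable_inv_mul (Q := fun _ => 1) continuousOn_const).mono_set hsub
  have h2 := (R.intervalIntegrable_inv_mul
    (R.continuousOn_quasiPrimitive (R.integrable_Lp h))).mono_set hsub
  rw [initialSolution, weightPrimitive, weightPrimitive, weightPrimitive,
    ← intervalIntegral.integral_const_mul, ← intervalIntegral.integral_add (h1.const_mul q₀) h2]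
  refine intervalIntegral.integral_congr fun s _ => ?_
  ring

/-- Integrating the equation twice leaves only the initial value and the initial quasi-derivative
free, so the graph is parametrised by the right-hand side and two constants. Since `F` and `Q` are
recovered only on `[a, b]`, the conditions `B` must not look elsewhere; this is `hB`. -/
theorem mem_slGraph_iff (R : IsRegularWeight ν w a b C K)
    (B : Submodule ℂ ((ℝ → ℂ) × (ℝ → ℂ)))
    (hB : ∀ F Q F' Q' : ℝ → ℂ, EqOn F F' (Icc a b) → EqOn Q Q' (Icc a b) → (F, Q) ∈ B →
      (F', Q') ∈ B) (p : Lp ℂ 2 ν × Lp ℂ 2 ν) :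
    p ∈ slGraph ν w (Icc a b) B ↔ ∃ f₀ q₀ : ℂ,
      p.1 = f₀ • R.oneLp + q₀ • R.weightLp + R.solutionCLM p.2 ∧
      ((fun x => f₀ + (q₀ * weightPrimitive w a (fun _ => 1) x + initialSolution w a p.2 x)),
        fun x => q₀ + quasiPrimitive w a p.2 x) ∈ B := by
  have hone : R.oneLp =ᵐ[ν] fun _ => (1 : ℂ) := MemLp.coeFn_toLp _
  have hwei : R.weightLp =ᵐ[ν] weightPrimitive w a fun _ => 1 := MemLp.coeFn_toLp _
  have hexp : ∀ f₀ q₀ : ℂ, (f₀ • R.oneLp + q₀ • R.weightLp + R.solutionCLM p.2 : Lp ℂ 2 ν) =ᵐ[ν]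
      fun x => f₀ + (q₀ * weightPrimitive w a (fun _ => 1) x + initialSolution w a p.2 x) := by
    intro f₀ q₀
    filter_upwards [hone, hwei, R.coeFn_solutionCLM p.2,
      Lp.coeFn_add (f₀ • R.oneLp + q₀ • R.weightLp) (R.solutionCLM p.2),
      Lp.coeFn_add (f₀ • R.oneLp) (q₀ • R.weightLp), Lp.coeFn_smul f₀ R.oneLp,
      Lp.coeFn_smul q₀ R.weightLp] with x h1 h2 h3 h4 h5 h6 h7
    simp only [h4, h5, h6, h7, h1, h2, h3, Pi.add_apply, Pi.smul_apply, smul_eq_mul]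
    ring
  have hint := R.integrable_Lp p.2
  constructor
  · rintro ⟨F, Q, hF, hs, hFQ⟩
    obtain ⟨hQ, hFeq⟩ := R.eq_integral hint hs
    have hFeq' : ∀ x ∈ Icc a b, F x = F a +
        (Q a * weightPrimitive w a (fun _ => 1) x + initialSolution w a p.2 x) := by
      intro x hx
      rw [hFeq x hx, ← R.weightPrimitive_const_add p.2 (Q a) hx]
      congr 1
      refine intervalIntegral.integral_congr fun s hs => ?_
      rw [uIcc_of_le hx.1] at hs
      simp only [hQ s ⟨hs.1, hs.2.trans hx.2⟩]
    refine ⟨F a, Q a, Lp.ext ?_, hB _ _ _ _ hFeq' hQ hFQ⟩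
    filter_upwards [hF, hexp (F a) (Q a), R.ae_mem] with x h1 h2 h3
    rw [h1, h2, hFeq' x h3]
  · rintro ⟨f₀, q₀, h1, h2⟩
    have hsl := R.isSL_of_integral hint f₀ q₀
    refine ⟨_, _, ?_, hsl, hB _ _ _ _ (fun x hx => ?_) (fun _ _ => rfl) h2⟩
    · rw [h1]
      filter_upwards [hexp f₀ q₀, R.ae_mem] with x h3 h4
      rw [h3, ← R.weightPrimitive_const_add p.2 q₀ h4]
    · simp only [← R.weightPrimitive_const_add p.2 q₀ hx]

/-- Without boundary conditions, membership means that `p.1 - R.solutionCLM p.2` lies in the span of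
two vectors. The graph is a preimage of a finite-dimensional subspace under a continuous map. -/
theorem isClosed_slGraph_top (R : IsRegularWeight ν w a b C K) :
    IsClosed (slGraph ν w (Icc a b) ⊤ : Set (Lp ℂ 2 ν × Lp ℂ 2 ν)) := by
  have heq : (slGraph ν w (Icc a b) ⊤ : Set (Lp ℂ 2 ν × Lp ℂ 2 ν)) =
      (fun p => p.1 - R.solutionCLM p.2) ⁻¹'
        (Submodule.span ℂ {R.oneLp, R.weightLp} : Set (Lp ℂ 2 ν)) := by
    ext p
    rw [SetLike.mem_coe, R.mem_slGraph_iff ⊤ (fun _ _ _ _ _ _ _ => trivial), mem_preimage,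
      SetLike.mem_coe, Submodule.mem_span_pair]
    simp only [Submodule.mem_top, and_true, eq_sub_iff_add_eq, eq_comm]
  have : FiniteDimensional ℂ (Submodule.span ℂ {R.oneLp, R.weightLp}) :=
    FiniteDimensional.span_of_finite ℂ (by simp)
  rw [heq]
  exact (Submodule.closed_of_finiteDimensional _).preimage
    (continuous_fst.sub (R.solutionCLM.continuous.comp continuous_snd))

/-- The value is the integral of a positive function. It is the divisor when the Dirichlet condition
at `b` is solved for the initial quasi-derivative. -/
theorem weightPrimitive_one_ne_zero (R : IsRegularWeight ν w a b C K) :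
    weightPrimitive w a (fun _ => 1) b ≠ 0 := by
  have h1 := R.intervalIntegrable_inv_mul (Q := fun _ => 1) continuousOn_const
  have hre : weightPrimitive w a (fun _ => 1) b = ((∫ s in a..b, (w s)⁻¹ : ℝ) : ℂ) := by
    rw [weightPrimitive, ← intervalIntegral.integral_ofReal]
    simp
  rw [hre]
  have hi : IntervalIntegrable (fun s => (w s)⁻¹) volume a b := by
    have := h1.norm
    rw [intervalIntegrable_iff_integrableOn_Icc_of_le R.lt.le] at this ⊢
    refine this.congr ?_
    filter_upwards [ae_restrict_mem measurableSet_Icc] with x hx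
    simp [(R.pos x hx).le]
  exact_mod_cast (intervalIntegral.intervalIntegral_pos_of_pos_on hi
    (fun x hx => inv_pos.2 (R.pos x (Ioo_subset_Icc_self hx))) R.lt).ne'

/-- The condition at `a` forces $f_0=0$, and the one at `b` forces $q_0=-(Th)(b)/W$, where $T$ is
the solution operator. No constant remains free, and `p.1` is a continuous function of `p.2`. -/
theorem isClosed_slGraph_dirichlet (R : IsRegularWeight ν w a b C K) :
    IsClosed (slGraph ν w (Icc a b) (dirichletConditions a b) : Set (Lp ℂ 2 ν × Lp ℂ 2 ν)) := by
  set W := weightPrimitive w a (fun _ => 1) b with hW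
  have hW0 : W ≠ 0 := R.weightPrimitive_one_ne_zero
  have : (slGraph ν w (Icc a b) (dirichletConditions a b) : Set (Lp ℂ 2 ν × Lp ℂ 2 ν)) =
      {p | p.1 = (-(R.endValueCLM p.2 / W)) • R.weightLp + R.solutionCLM p.2} := by
    ext p
    have hend : R.endValueCLM p.2 = initialSolution w a p.2 b := rfl
    have ha : weightPrimitive w a (fun _ => 1) a = 0 := by simp [weightPrimitive]
    have ha' : initialSolution w a p.2 a = 0 := by simp [initialSolution, weightPrimitive]
    rw [SetLike.mem_coe, R.mem_slGraph_iff, mem_ofPred_eq]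
    · constructor
      · rintro ⟨f₀, q₀, h1, h2, h3⟩
        simp only [ha, ha', mul_zero, add_zero] at h2
        simp only [h2, zero_add, ← hW, ← hend] at h3
        have : q₀ = -(R.endValueCLM p.2 / W) := by
          field_simp
          linear_combination h3
        rw [h1, h2, this, zero_smul, zero_add]
      · intro h
        refine ⟨0, -(R.endValueCLM p.2 / W), by rw [zero_smul, zero_add]; exact h, ?_, ?_⟩
        · simp only [ha, ha']
          simp
        · simp only [← hW, ← hend]
          field_simp
          ring
    · rintro F Q F' Q' hF hQ ⟨h1, h2⟩
      exact ⟨(hF (left_mem_Icc.2 R.lt.le)).symm.trans h1,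
        (hF (right_mem_Icc.2 R.lt.le)).symm.trans h2⟩
  rw [this]
  refine isClosed_eq continuous_fst (Continuous.add ?_ ?_)
  · exact ((R.endValueCLM.continuous.comp continuous_snd).div_const W).neg.smul continuous_const
  · exact R.solutionCLM.continuous.comp continuous_snd

end IsRegularWeight

end Closed

/-! ### Functions with values in `L²` of a cell times a fixed coefficient on every edge -/

namespace RadialAntitree

variable {V : Type*} (A : RadialAntitree V)

/-- The sum of the squared coefficients over the edges between two consecutive spheres. -/
noncomputable def cellWeight (c : A.Edge → ℂ) (m : ℕ) : NNReal :=
  ∑ e : A.Sphere m × A.Sphere (m + 1), ‖c ⟨m, e⟩‖₊ ^ 2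

/-- `ν` is Lebesgue measure on every cell, weighted with the squared coefficients. -/
def IsCellSum (c : A.Edge → ℂ) (ν : Measure ℝ) : Prop :=
  ν = Measure.sum fun m => A.cellWeight c m • A.cellMeasure m

/-- Restriction of square integrable functions to a smaller measure. -/
noncomputable def _root_.MeasureTheory.Lp.ofMeasureLE {μ ν : Measure ℝ}
    (h : ∃ K : NNReal, μ ≤ K • ν) : Lp ℂ 2 ν →ₗ[ℂ] Lp ℂ 2 μ where
  toFun f := ((Lp.memLp f).of_measure_le_smul (c := (h.choose : ENNReal)) ENNReal.coe_ne_top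
    h.choose_spec).toLp f
  map_add' f g := by
    rw [← MemLp.toLp_add]
    exact MemLp.toLp_congr _ _
      ((Measure.absolutelyContinuous_of_le_smul h.choose_spec).ae_le (Lp.coeFn_add f g))
  map_smul' c f := by
    rw [RingHom.id_apply, ← MemLp.toLp_const_smul]
    exact MemLp.toLp_congr _ _
      ((Measure.absolutelyContinuous_of_le_smul h.choose_spec).ae_le (Lp.coeFn_smul c f))

theorem _root_.MeasureTheory.Lp.coeFn_ofMeasureLE {μ ν : Measure ℝ}
    (h : ∃ K : NNReal, μ ≤ K • ν) (f : Lp ℂ 2 ν) : Lp.ofMeasureLE h f =ᵐ[μ] f :=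
  ((Lp.memLp f).of_measure_le_smul (c := (h.choose : ENNReal)) ENNReal.coe_ne_top
    h.choose_spec).coeFn_toLp

open Classical in
/-- Restriction to a cell (and zero if the cell is not charged by `ν`). -/
noncomputable def cellRestrict (ν : Measure ℝ) (m : ℕ) :
    Lp ℂ 2 ν →ₗ[ℂ] Lp ℂ 2 (A.cellMeasure m) :=
  -- The value `0` does no harm in `embed`: there, on a cell that `ν` does not charge, all
  -- coefficients multiplying the restriction vanish.
  if h : ∃ K : NNReal, A.cellMeasure m ≤ K • ν then Lp.ofMeasureLE h else 0

variable {A} {c d : A.Edge → ℂ} {ν ν' : Measure ℝ} {m : ℕ}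

theorem cellWeight_eq_zero : A.cellWeight c m = 0 ↔ ∀ e, c ⟨m, e⟩ = 0 := by
  simp [cellWeight]

theorem cellWeight_eq : ((A.cellWeight c m : ℝ) : ℂ) = ∑ e, starRingEnd ℂ (c ⟨m, e⟩) * c ⟨m, e⟩ := by
  simp [cellWeight, RCLike.conj_mul]

theorem IsCellSum.le_smul (hν : A.IsCellSum c ν) (hm : A.cellWeight c m ≠ 0) :
    A.cellMeasure m ≤ (A.cellWeight c m)⁻¹ • ν := by
  have h1 : A.cellWeight c m • A.cellMeasure m ≤ ν :=
    (Measure.le_sum (fun m => A.cellWeight c m • A.cellMeasure m) m).trans_eq hν.symm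
  calc A.cellMeasure m = (A.cellWeight c m)⁻¹ • A.cellWeight c m • A.cellMeasure m := by
        rw [smul_smul, inv_mul_cancel₀ hm, one_smul]
    _ ≤ _ := by gcongr

theorem IsCellSum.ac (hν : A.IsCellSum c ν) (hm : A.cellWeight c m ≠ 0) :
    A.cellMeasure m ≪ ν :=
  Measure.absolutelyContinuous_of_le_smul (hν.le_smul hm)

theorem IsCellSum.coeFn_cellRestrict (hν : A.IsCellSum c ν) (hm : A.cellWeight c m ≠ 0)
    (x : Lp ℂ 2 ν) : A.cellRestrict ν m x =ᵐ[A.cellMeasure m] x := by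
  rw [cellRestrict, dif_pos ⟨_, hν.le_smul hm⟩]
  exact Lp.coeFn_ofMeasureLE _ x

theorem IsCellSum.ae (hν : A.IsCellSum c ν) {p : ℝ → Prop}
    (h : ∀ m, A.cellWeight c m ≠ 0 → ∀ᵐ x ∂A.cellMeasure m, p x) : ∀ᵐ x ∂ν, p x := by
  rw [hν, Measure.ae_sum_iff]
  intro m
  by_cases hm : A.cellWeight c m = 0
  · simp [hm]
  · exact Measure.ae_smul_measure (h m hm) _

theorem _root_.MeasureTheory.Lp.enorm_sq_eq_lintegral {μ : Measure ℝ} (f : Lp ℂ 2 μ) :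
    ‖f‖ₑ ^ 2 = ∫⁻ x, ‖f x‖ₑ ^ 2 ∂μ := by
  have := eLpNorm_nnreal_pow_eq_lintegral (f := f) (μ := μ) (p := 2) (by norm_num)
  rw [Lp.enorm_def]
  simpa using this

/-- All edges of a cell carry multiples of the same function, so their squared norms add up to its
squared norm times the sum of the squared coefficients, which is the weight of `ν` there. In
extended nonnegative reals this needs no prior summability and then provides it. -/
theorem IsCellSum.tsum_enorm_sq (hν : A.IsCellSum c ν) (x : Lp ℂ 2 ν) :
    ∑' e : A.Edge, ‖c e • A.cellRestrict ν e.1 x‖ₑ ^ 2 = ‖x‖ₑ ^ 2 := by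
  have hR : ‖x‖ₑ ^ 2 = ∑' m, ∫⁻ y, ‖x y‖ₑ ^ 2 ∂(A.cellWeight c m • A.cellMeasure m) := by
    rw [Lp.enorm_sq_eq_lintegral, ← lintegral_sum_measure]
    exact congrArg (fun μ => ∫⁻ y, ‖x y‖ₑ ^ 2 ∂μ) hν
  rw [ENNReal.tsum_sigma', hR]
  refine tsum_congr fun m => ?_
  rw [tsum_fintype, lintegral_smul_measure]
  by_cases hm : A.cellWeight c m = 0
  · rw [hm, zero_smul]
    exact Finset.sum_eq_zero fun e _ => by simp [cellWeight_eq_zero.1 hm e]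
  have h1 : ∫⁻ y, ‖x y‖ₑ ^ 2 ∂A.cellMeasure m = ‖A.cellRestrict ν m x‖ₑ ^ 2 := by
    rw [Lp.enorm_sq_eq_lintegral]
    refine lintegral_congr_ae ?_
    filter_upwards [hν.coeFn_cellRestrict hm x] with y hy
    rw [hy]
  simp only [h1, enorm_smul, mul_pow]
  rw [ENNReal.smul_def, smul_eq_mul, cellWeight]
  push_cast
  rw [Finset.sum_mul]
  rfl

theorem IsCellSum.summable_norm_sq (hν : A.IsCellSum c ν) (x : Lp ℂ 2 ν) :
    Summable fun e : A.Edge => ‖c e • A.cellRestrict ν e.1 x‖ ^ 2 := by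
  have h : ∑' e : A.Edge, ‖c e • A.cellRestrict ν e.1 x‖ₑ ^ 2 ≠ ⊤ := by
    rw [hν.tsum_enorm_sq]
    simp
  simpa using ENNReal.summable_toReal h

/-- The isometric embedding that multiplies a function of the distance to the root by the given
coefficient on every edge. -/
noncomputable def IsCellSum.embed (hν : A.IsCellSum c ν) : Lp ℂ 2 ν →ₗᵢ[ℂ] A.L2 where
  toFun x := ⟨fun e => c e • A.cellRestrict ν e.1 x, memℓp_gen (by
    simpa using hν.summable_norm_sq x)⟩
  map_add' x y := by
    ext1
    funext e
    exact (congrArg (c e • ·) (map_add _ x y)).trans (smul_add _ _ _)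
  map_smul' a x := by
    ext1
    funext e
    exact (congrArg (c e • ·) (map_smul _ a x)).trans (smul_comm _ _ _)
  norm_map' x := by
    have h := lp.norm_rpow_eq_tsum (p := 2) (by norm_num)
      (⟨fun e => c e • A.cellRestrict ν e.1 x, memℓp_gen (by
        simpa using hν.summable_norm_sq x)⟩ : A.L2)
    have h2 := congrArg ENNReal.toReal (hν.tsum_enorm_sq x)
    rw [ENNReal.tsum_toReal_eq (by simp)] at h2
    simp only [ENNReal.toReal_pow, toReal_enorm] at h2
    simp only [ENNReal.toReal_ofNat, Real.rpow_ofNat] at h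
    rw [h2] at h
    exact (pow_left_inj₀ (norm_nonneg _) (norm_nonneg _) two_ne_zero).1 h

@[simp] theorem IsCellSum.embed_apply (hν : A.IsCellSum c ν) (x : Lp ℂ 2 ν) (e : A.Edge) :
    hν.embed x e = c e • A.cellRestrict ν e.1 x := rfl

variable (A) in
/-- The restriction of `f` to an edge of a given cell. -/
def onCell (f : A.L2) (m : ℕ) (e : A.Sphere m × A.Sphere (m + 1)) : Lp ℂ 2 (A.cellMeasure m) :=
  f ⟨m, e⟩

theorem IsCellSum.onCell_embed (hν : A.IsCellSum c ν) (x : Lp ℂ 2 ν) (m : ℕ)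
    (e : A.Sphere m × A.Sphere (m + 1)) :
    A.onCell (hν.embed x) m e = c ⟨m, e⟩ • A.cellRestrict ν m x := rfl

/-! ### Orthogonality tested cell by cell -/

theorem hasSum_inner_cells (f g : A.L2) :
    HasSum (fun m => ∑ e, inner ℂ (A.onCell f m e) (A.onCell g m e)) (inner ℂ f g) :=
  (lp.hasSum_inner f g).sigma fun m => hasSum_fintype fun e =>
    inner ℂ (A.onCell f m e) (A.onCell g m e)

theorem inner_eq_zero_of_cells {f g : A.L2}
    (h : ∀ m, ∑ e, inner ℂ (A.onCell f m e) (A.onCell g m e) = 0) : inner ℂ f g = 0 := by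
  have h1 := hasSum_inner_cells f g
  simp only [h] at h1
  exact h1.unique hasSum_zero

/-- An embedded vector is one function times the coefficients on each cell, so its inner product
with `f` sees only the weighted sums of `f` over the cells. -/
theorem inner_embed_eq_zero (hν : A.IsCellSum c ν) {f : A.L2}
    (h : ∀ m, ∑ e, starRingEnd ℂ (c ⟨m, e⟩) • A.onCell f m e = 0) (x : Lp ℂ 2 ν) :
    inner ℂ (hν.embed x) f = 0 := by
  refine inner_eq_zero_of_cells fun m => ?_
  simp only [IsCellSum.onCell_embed, inner_smul_left]
  simp only [← inner_smul_right, ← inner_sum, h, inner_zero_right]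

theorem inner_embed_embed_eq_zero (hν : A.IsCellSum c ν) (hν' : A.IsCellSum d ν')
    (h : ∀ m, ∑ e, starRingEnd ℂ (c ⟨m, e⟩) * d ⟨m, e⟩ = 0) (x : Lp ℂ 2 ν) (y : Lp ℂ 2 ν') :
    inner ℂ (hν.embed x) (hν'.embed y) = 0 := by
  refine inner_embed_eq_zero hν (fun m => ?_) x
  simp only [IsCellSum.onCell_embed, smul_smul, ← Finset.sum_smul, h, zero_smul]

theorem eq_of_mem_cells {k : ℕ} {x : ℝ} (hk : x ∈ Ioo (A.t k) (A.t (k + 1)))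
    (hm : x ∈ Icc (A.t m) (A.t (m + 1))) : k = m := by
  rcases lt_trichotomy k m with h | h | h
  · exact absurd (hk.2.trans_le ((A.t_mono h).trans hm.1)) (lt_irrefl _)
  · exact h
  · exact absurd ((hm.2.trans (A.t_mono h)).trans_lt hk.1) (lt_irrefl _)

theorem ae_mem_Ioo_cell (m : ℕ) :
    ∀ᵐ x ∂A.cellMeasure m, x ∈ Ioo (A.t m) (A.t (m + 1)) :=
  ae_mem_Ioo_restrict_Icc _ _

theorem IsCellSum.restrict_cell (hν : A.IsCellSum c ν) (m : ℕ) :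
    ν.restrict (Icc (A.t m) (A.t (m + 1))) = A.cellWeight c m • A.cellMeasure m := by
  rw [hν, Measure.restrict_sum _ measurableSet_Icc]
  ext s hs
  rw [Measure.sum_apply _ hs, tsum_eq_single m]
  · rw [Measure.restrict_smul, cellMeasure, Measure.restrict_restrict measurableSet_Icc, inter_self]
  · intro k hk
    have : (A.cellMeasure k).restrict (Icc (A.t m) (A.t (m + 1))) = 0 := by
      rw [Measure.restrict_eq_zero, measure_eq_zero_iff_ae_notMem]
      filter_upwards [A.ae_mem_Ioo_cell k] with x hx hx'
      exact hk (eq_of_mem_cells hx hx')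
    rw [Measure.restrict_smul, this]
    simp

/-- Extension by zero from a cell. -/
theorem IsCellSum.exists_extension (hν : A.IsCellSum c ν) (m : ℕ)
    (h : Lp ℂ 2 (A.cellMeasure m)) : ∃ x : Lp ℂ 2 ν, (A.cellWeight c m ≠ 0 →
      A.cellRestrict ν m x = h) ∧ ∀ k ≠ m, A.cellWeight c k ≠ 0 → A.cellRestrict ν k x = 0 := by
  have hmem : MemLp ((Icc (A.t m) (A.t (m + 1))).indicator h) 2 ν := by
    rw [memLp_indicator_iff_restrict measurableSet_Icc, hν.restrict_cell]
    exact (Lp.memLp h).smul_measure ENNReal.coe_ne_top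
  refine ⟨hmem.toLp, fun hm => Lp.ext ?_, fun k hkm hk => Lp.ext ?_⟩
  · filter_upwards [hν.coeFn_cellRestrict hm hmem.toLp, (hν.ac hm).ae_le hmem.coeFn_toLp,
      A.ae_mem_Ioo_cell m] with x h1 h2 h3
    rw [h1, h2, indicator_of_mem (Ioo_subset_Icc_self h3)]
  · filter_upwards [hν.coeFn_cellRestrict hk hmem.toLp, (hν.ac hk).ae_le hmem.coeFn_toLp,
      A.ae_mem_Ioo_cell k, Lp.coeFn_zero ℂ 2 (A.cellMeasure k)] with x h1 h2 h3 h4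
    rw [h1, h2, h4, indicator_of_notMem fun h5 => hkm (eq_of_mem_cells h3 h5), Pi.zero_apply]

/-- The converse of `inner_embed_eq_zero`: testing with vectors supported on the single cell `m`
isolates the weighted sum over that cell. -/
theorem IsCellSum.sum_conj_eq_zero (hν : A.IsCellSum c ν) {f : A.L2}
    (hf : ∀ x, inner ℂ (hν.embed x) f = 0) (m : ℕ) :
    ∑ e, starRingEnd ℂ (c ⟨m, e⟩) • A.onCell f m e = 0 := by
  by_cases hm : A.cellWeight c m = 0
  · exact Finset.sum_eq_zero fun e _ => by simp [cellWeight_eq_zero.1 hm e]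
  refine ext_inner_left ℂ fun h => ?_
  obtain ⟨x, hx, hx'⟩ := hν.exists_extension m h
  have h1 := hasSum_inner_cells (hν.embed x) f
  rw [hf x] at h1
  have h2 := h1.unique (hasSum_single m fun k hk => Finset.sum_eq_zero fun e _ => ?_)
  · rw [inner_zero_right, h2, inner_sum]
    refine Finset.sum_congr rfl fun e _ => ?_
    rw [hν.onCell_embed, hx hm, inner_smul_left, inner_smul_right]
  · rw [hν.onCell_embed]
    by_cases hk0 : A.cellWeight c k = 0
    · simp [cellWeight_eq_zero.1 hk0 e]
    · simp [hx' k hk hk0]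

end RadialAntitree

/-! ### Bases of the space of functions with vanishing sum -/

/-- Zero sum means orthogonality to the constant vector, whose complement has dimension one less
than the number of points; `ψ` is an orthonormal basis of it. The last clause is completeness. -/
theorem exists_sumZero_basis (S : Type*) [Fintype S] [Nonempty S] :
    ∃ ψ : Fin (Fintype.card S - 1) → S → ℂ, (∀ j, ∑ v, ψ j v = 0) ∧
      (∀ j k, ∑ v, starRingEnd ℂ (ψ j v) * ψ k v = if j = k then 1 else 0) ∧
      ∀ G : S → ℂ, ∑ v, G v = 0 → (∀ j, ∑ v, starRingEnd ℂ (ψ j v) * G v = 0) → G = 0 := by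
  set u : EuclideanSpace ℂ S := WithLp.toLp 2 fun _ => 1 with hu
  have hinner : ∀ x y : EuclideanSpace ℂ S, inner ℂ x y = ∑ v, starRingEnd ℂ (x v) * y v := by
    intro x y
    simp [PiLp.inner_apply, mul_comm]
  have hu0 : u ≠ 0 := by
    intro h
    obtain ⟨v⟩ := ‹Nonempty S›
    have := congrArg (fun x : EuclideanSpace ℂ S => x v) h
    simp [hu] at this
  have hmem : ∀ x : EuclideanSpace ℂ S, x ∈ (Submodule.span ℂ {u})ᗮ ↔ ∑ v, x v = 0 := by
    intro x
    rw [Submodule.mem_orthogonal_singleton_iff_inner_right, hinner]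
    simp [hu]
  have : Fact (Module.finrank ℂ (EuclideanSpace ℂ S) = (Fintype.card S - 1) + 1) :=
    ⟨by rw [finrank_euclideanSpace, Nat.sub_add_cancel Fintype.card_pos]⟩
  have hrank := Submodule.finrank_orthogonal_span_singleton (𝕜 := ℂ) (n := Fintype.card S - 1) hu0
  set b := (stdOrthonormalBasis ℂ (Submodule.span ℂ {u})ᗮ).reindex (finCongr hrank)
  refine ⟨fun j v => (b j : EuclideanSpace ℂ S) v, fun j => (hmem _).1 (b j).2, fun j k => ?_,
    fun G hG h => ?_⟩
  · rw [← hinner, ← Submodule.coe_inner]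
    exact orthonormal_iff_ite.1 b.orthonormal j k
  · have hg : (⟨WithLp.toLp 2 G, (hmem _).2 hG⟩ : (Submodule.span ℂ {u})ᗮ) = 0 := by
      refine InnerProductSpace.ext_inner_left_basis b.toBasis fun j => ?_
      rw [inner_zero_right, Submodule.coe_inner, hinner]
      simpa using h j
    funext v
    have := congrArg (fun x : (Submodule.span ℂ {u})ᗮ => (x : EuclideanSpace ℂ S) v) hg
    simpa using this

/-! ### Edge coefficients of the summands: orthogonality and completeness in every cell -/

namespace RadialAntitree

variable {V : Type*} (A : RadialAntitree V)

instance nonempty_sphere [Infinite V] (n : ℕ) : Nonempty (A.Sphere n) :=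
  Fintype.card_pos_iff.1 (A.s_pos n)

theorem s_zero : A.s 0 = 1 := by
  refine Fintype.card_eq_one_iff.2 ⟨⟨A.root, by simp⟩, fun v => Subtype.ext ?_⟩
  exact ((A.connected.dist_eq_zero_iff).1 v.2).symm

instance subsingleton_sphere_zero : Subsingleton (A.Sphere 0) :=
  Fintype.card_le_one_iff_subsingleton.1 A.s_zero.le

variable [Infinite V]

open Classical in
/-- An orthonormal basis of the space of functions on `S_n` with vanishing sum, extended by zero to
all vertices. -/
noncomputable def sphereBasis (n : ℕ) (j : Fin (A.s n - 1)) (v : V) : ℂ :=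
  if h : A.graph.dist A.root v = n then (exists_sumZero_basis (A.Sphere n)).choose j ⟨v, h⟩ else 0

theorem sphereBasis_of_ne {n m : ℕ} (h : m ≠ n) (j : Fin (A.s n - 1)) (v : A.Sphere m) :
    A.sphereBasis n j v = 0 :=
  dif_neg fun h' => h (v.2.symm.trans h')

theorem sphereBasis_coe {n : ℕ} (j : Fin (A.s n - 1)) (v : A.Sphere n) :
    A.sphereBasis n j v = (exists_sumZero_basis (A.Sphere n)).choose j v :=
  dif_pos v.2

theorem sum_sphereBasis (n m : ℕ) (j : Fin (A.s n - 1)) :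
    ∑ v : A.Sphere m, A.sphereBasis n j v = 0 := by
  by_cases h : m = n
  · subst h
    simp only [sphereBasis_coe]
    exact (exists_sumZero_basis (A.Sphere m)).choose_spec.1 j
  · simp [A.sphereBasis_of_ne h]

theorem sphereBasis_orthonormal (n : ℕ) (j k : Fin (A.s n - 1)) :
    ∑ v : A.Sphere n, starRingEnd ℂ (A.sphereBasis n j v) * A.sphereBasis n k v =
      if j = k then 1 else 0 := by
  simp only [sphereBasis_coe]
  exact (exists_sumZero_basis (A.Sphere n)).choose_spec.2.1 j k

theorem eq_zero_of_sphereBasis {n : ℕ} {G : A.Sphere n → ℂ} (h0 : ∑ v, G v = 0)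
    (h : ∀ j, ∑ v : A.Sphere n, starRingEnd ℂ (A.sphereBasis n j v) * G v = 0) : G = 0 := by
  simp only [sphereBasis_coe] at h
  exact (exists_sumZero_basis (A.Sphere n)).choose_spec.2.2 G h0 h

/-- The coefficients on the edges of the functions belonging to a summand. -/
noncomputable def coeff : A.Summand → A.Edge → ℂ
  | .sym => fun _ => 1
  -- Products of two zero-sum bases form a basis of the matrices with vanishing row and column sums.
  | .dirichlet n j => fun e => A.sphereBasis (n + 1) (finProdFinEquiv.symm j).1 e.2.1 *
      A.sphereBasis (n + 2) (finProdFinEquiv.symm j).2 e.2.2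
  -- On each cell at most one of the two terms is nonzero. The square root makes the squared
  -- coefficients add up to `s n * s (n+1)` on the lower cell and `s (n+1) * s (n+2)` on the upper
  -- one, that is, to the weight `μ`.
  | .weighted n j => fun e => (Real.sqrt (A.s (n + 1)) : ℂ) *
      (A.sphereBasis (n + 1) j e.2.1 + A.sphereBasis (n + 1) j e.2.2)

theorem coeff_dirichlet_of_ne {n m : ℕ} (h : m ≠ n + 1)
    (j : Fin ((A.s (n + 1) - 1) * (A.s (n + 2) - 1))) (e : A.Sphere m × A.Sphere (m + 1)) :
    A.coeff (.dirichlet n j) ⟨m, e⟩ = 0 := by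
  simp [coeff, A.sphereBasis_of_ne h]

theorem coeff_weighted_left (n : ℕ) (j : Fin (A.s (n + 1) - 1))
    (e : A.Sphere n × A.Sphere (n + 1)) : A.coeff (.weighted n j) ⟨n, e⟩ =
      (Real.sqrt (A.s (n + 1)) : ℂ) * A.sphereBasis (n + 1) j e.2 := by
  simp [coeff, A.sphereBasis_of_ne (Nat.ne_of_lt (Nat.lt_succ_self n))]

theorem coeff_weighted_right (n : ℕ) (j : Fin (A.s (n + 1) - 1))
    (e : A.Sphere (n + 1) × A.Sphere (n + 2)) : A.coeff (.weighted n j) ⟨n + 1, e⟩ =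
      (Real.sqrt (A.s (n + 1)) : ℂ) * A.sphereBasis (n + 1) j e.1 := by
  simp [coeff, A.sphereBasis_of_ne (Nat.succ_ne_self (n + 1))]

theorem coeff_weighted_of_ne {n m : ℕ} (h : m ≠ n) (h' : m ≠ n + 1) (j : Fin (A.s (n + 1) - 1))
    (e : A.Sphere m × A.Sphere (m + 1)) : A.coeff (.weighted n j) ⟨m, e⟩ = 0 := by
  simp [coeff, A.sphereBasis_of_ne h', A.sphereBasis_of_ne fun h1 => h (Nat.succ_injective h1)]

/-- The coefficients of the summands other than the radial one sum to zero in every cell. -/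
theorem sum_coeff_eq_zero {i : A.Summand} (hi : i.block ≠ .sym) (m : ℕ) :
    ∑ e, A.coeff i ⟨m, e⟩ = 0 := by
  cases i with
  | sym => exact absurd rfl hi
  | dirichlet n j =>
    simp only [coeff]
    rw [Fintype.sum_prod_type]
    simp only [← Finset.mul_sum, sum_sphereBasis, mul_zero, Finset.sum_const_zero]
  | weighted n j =>
    simp only [coeff, ← Finset.mul_sum, Finset.sum_add_distrib]
    rw [Fintype.sum_prod_type, Fintype.sum_prod_type_right]
    simp [← Finset.mul_sum, sum_sphereBasis]

theorem sum_coeff_dirichlet_right (n m : ℕ) (j : Fin ((A.s (n + 1) - 1) * (A.s (n + 2) - 1)))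
    (u : A.Sphere m) : ∑ v, A.coeff (.dirichlet n j) ⟨m, (u, v)⟩ = 0 := by
  simp only [coeff, ← Finset.mul_sum, sum_sphereBasis, mul_zero]

theorem sum_coeff_dirichlet_left (n m : ℕ) (j : Fin ((A.s (n + 1) - 1) * (A.s (n + 2) - 1)))
    (v : A.Sphere (m + 1)) : ∑ u, A.coeff (.dirichlet n j) ⟨m, (u, v)⟩ = 0 := by
  simp only [coeff, ← Finset.sum_mul, sum_sphereBasis, zero_mul]

omit [Infinite V] in
theorem sqrt_mul_sqrt_s (n : ℕ) : (Real.sqrt (A.s n) : ℂ) * Real.sqrt (A.s n) = A.s n := by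
  rw [← Complex.ofReal_mul, Real.mul_self_sqrt (by positivity)]
  simp

theorem cellWeight_sym (m : ℕ) : A.cellWeight (A.coeff .sym) m = A.s m * A.s (m + 1) := by
  simp [cellWeight, coeff, s]

theorem sum_conj_coeff_dirichlet (n : ℕ) (j k : Fin ((A.s (n + 1) - 1) * (A.s (n + 2) - 1))) :
    ∑ e, starRingEnd ℂ (A.coeff (.dirichlet n j) ⟨n + 1, e⟩) *
      A.coeff (.dirichlet n k) ⟨n + 1, e⟩ = if j = k then 1 else 0 := by
  have h : ∑ e, starRingEnd ℂ (A.coeff (.dirichlet n j) ⟨n + 1, e⟩) *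
      A.coeff (.dirichlet n k) ⟨n + 1, e⟩ =
      (if (finProdFinEquiv.symm j).1 = (finProdFinEquiv.symm k).1 then 1 else 0) *
      (if (finProdFinEquiv.symm j).2 = (finProdFinEquiv.symm k).2 then 1 else 0) := by
    rw [← A.sphereBasis_orthonormal (n + 1), ← A.sphereBasis_orthonormal (n + 2),
      Finset.sum_mul_sum, Fintype.sum_prod_type]
    refine Finset.sum_congr rfl fun u _ => Finset.sum_congr rfl fun v _ => ?_
    simp only [coeff, map_mul]
    ring
  have hiff : j = k ↔ (finProdFinEquiv.symm j).1 = (finProdFinEquiv.symm k).1 ∧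
      (finProdFinEquiv.symm j).2 = (finProdFinEquiv.symm k).2 := by
    rw [← Prod.ext_iff, EmbeddingLike.apply_eq_iff_eq]
  rw [h]
  simp only [hiff, mul_ite, mul_one, mul_zero, ← ite_and]
  exact if_congr And.comm rfl rfl

theorem sum_conj_coeff_weighted_left (n : ℕ) (j k : Fin (A.s (n + 1) - 1)) :
    ∑ e, starRingEnd ℂ (A.coeff (.weighted n j) ⟨n, e⟩) * A.coeff (.weighted n k) ⟨n, e⟩ =
      A.s n * A.s (n + 1) * if j = k then 1 else 0 := by
  have h : ∀ (u : A.Sphere n) (v : A.Sphere (n + 1)),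
      starRingEnd ℂ (A.coeff (.weighted n j) ⟨n, (u, v)⟩) * A.coeff (.weighted n k) ⟨n, (u, v)⟩ =
      A.s (n + 1) * (starRingEnd ℂ (A.sphereBasis (n + 1) j v) * A.sphereBasis (n + 1) k v) := by
    intro u v
    rw [coeff_weighted_left, coeff_weighted_left, ← sqrt_mul_sqrt_s, map_mul, Complex.conj_ofReal]
    ring
  rw [Fintype.sum_prod_type]
  simp only [h, ← Finset.mul_sum, sphereBasis_orthonormal]
  simp only [Finset.sum_const, Finset.card_univ, nsmul_eq_mul, s]
  ring

theorem sum_conj_coeff_weighted_right (n : ℕ) (j k : Fin (A.s (n + 1) - 1)) :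
    ∑ e, starRingEnd ℂ (A.coeff (.weighted n j) ⟨n + 1, e⟩) *
      A.coeff (.weighted n k) ⟨n + 1, e⟩ =
      A.s (n + 1) * A.s (n + 2) * if j = k then 1 else 0 := by
  have h : ∀ (u : A.Sphere (n + 1)) (v : A.Sphere (n + 2)),
      starRingEnd ℂ (A.coeff (.weighted n j) ⟨n + 1, (u, v)⟩) *
        A.coeff (.weighted n k) ⟨n + 1, (u, v)⟩ =
      A.s (n + 1) * (starRingEnd ℂ (A.sphereBasis (n + 1) j u) * A.sphereBasis (n + 1) k u) := by
    intro u v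
    rw [coeff_weighted_right, coeff_weighted_right, ← sqrt_mul_sqrt_s, map_mul,
      Complex.conj_ofReal]
    ring
  rw [Fintype.sum_prod_type_right]
  simp only [h, ← Finset.mul_sum, sphereBasis_orthonormal]
  simp only [Finset.sum_const, Finset.card_univ, nsmul_eq_mul, s]
  ring

theorem cellWeight_dirichlet (n : ℕ) (j : Fin ((A.s (n + 1) - 1) * (A.s (n + 2) - 1))) :
    A.cellWeight (A.coeff (.dirichlet n j)) (n + 1) = 1 := by
  have h := A.sum_conj_coeff_dirichlet n j j
  rw [← cellWeight_eq, if_pos rfl] at h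
  exact_mod_cast h

theorem cellWeight_weighted_left (n : ℕ) (j : Fin (A.s (n + 1) - 1)) :
    A.cellWeight (A.coeff (.weighted n j)) n = A.s n * A.s (n + 1) := by
  have h := A.sum_conj_coeff_weighted_left n j j
  rw [← cellWeight_eq, if_pos rfl, mul_one] at h
  exact_mod_cast h

theorem cellWeight_weighted_right (n : ℕ) (j : Fin (A.s (n + 1) - 1)) :
    A.cellWeight (A.coeff (.weighted n j)) (n + 1) = A.s (n + 1) * A.s (n + 2) := by
  have h := A.sum_conj_coeff_weighted_right n j j
  rw [← cellWeight_eq, if_pos rfl, mul_one] at h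
  exact_mod_cast h

/-- The coefficients of different summands are orthogonal in every cell. -/
theorem coeff_orthogonal {i j : A.Summand} (hij : i ≠ j) (m : ℕ) :
    ∑ e, starRingEnd ℂ (A.coeff i ⟨m, e⟩) * A.coeff j ⟨m, e⟩ = 0 := by
  have hsym : ∀ {i j : A.Summand}, ∑ e, starRingEnd ℂ (A.coeff i ⟨m, e⟩) * A.coeff j ⟨m, e⟩ = 0 →
      ∑ e, starRingEnd ℂ (A.coeff j ⟨m, e⟩) * A.coeff i ⟨m, e⟩ = 0 := by
    intro i j h
    have := congrArg (starRingEnd ℂ) h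
    simpa [map_sum, mul_comm] using this
  have h1 : ∀ j : A.Summand, j ≠ .sym →
      ∑ e, starRingEnd ℂ (A.coeff .sym ⟨m, e⟩) * A.coeff j ⟨m, e⟩ = 0 := by
    intro j hj
    have : ∀ e, A.coeff .sym e = 1 := fun _ => rfl
    simp only [this, map_one, one_mul]
    refine A.sum_coeff_eq_zero ?_ m
    cases j <;> simp [Summand.block] at hj ⊢
  -- A Dirichlet coefficient has vanishing row and column sums, whereas a weighted coefficient is a
  -- function of one end plus a function of the other.
  have h2 : ∀ n k n' k', ∑ e, starRingEnd ℂ (A.coeff (.dirichlet n k) ⟨m, e⟩) *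
      A.coeff (.weighted n' k') ⟨m, e⟩ = 0 := by
    intro n k n' k'
    have hs : ∀ u : A.Sphere m,
        ∑ v, starRingEnd ℂ (A.coeff (.dirichlet n k) ⟨m, (u, v)⟩) = 0 := fun u => by
      rw [← map_sum, sum_coeff_dirichlet_right, map_zero]
    have hs' : ∀ v : A.Sphere (m + 1),
        ∑ u, starRingEnd ℂ (A.coeff (.dirichlet n k) ⟨m, (u, v)⟩) = 0 := fun u => by
      rw [← map_sum, sum_coeff_dirichlet_left, map_zero]
    have hw : ∀ e : A.Sphere m × A.Sphere (m + 1), A.coeff (.weighted n' k') ⟨m, e⟩ =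
      Real.sqrt (A.s (n' + 1)) * A.sphereBasis (n' + 1) k' e.1 +
        Real.sqrt (A.s (n' + 1)) * A.sphereBasis (n' + 1) k' e.2 := fun e => mul_add _ _ _
    simp only [hw, mul_add, Finset.sum_add_distrib]
    rw [Fintype.sum_prod_type, Fintype.sum_prod_type_right]
    simp only [← Finset.sum_mul, hs, hs', zero_mul, Finset.sum_const_zero, add_zero]
  cases i with
  | sym => exact h1 j hij.symm
  | dirichlet n k =>
    cases j with
    | sym => exact hsym (h1 _ hij)
    | weighted n' k' => exact h2 n k n' k'
    | dirichlet n' k' =>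
      by_cases hm : m = n + 1
      · by_cases hm' : m = n' + 1
        · subst hm
          obtain rfl : n = n' := by omega
          rw [sum_conj_coeff_dirichlet, if_neg fun h => hij (congrArg _ h)]
        · simp [A.coeff_dirichlet_of_ne hm']
      · simp [A.coeff_dirichlet_of_ne hm]
  | weighted n k =>
    cases j with
    | sym => exact hsym (h1 _ hij)
    | dirichlet n' k' => exact hsym (h2 n' k' n k)
    | weighted n' k' =>
      -- Two different spheres share a cell only if they are consecutive. On it one coefficient
      -- depends on the lower vertex and the other on the upper vertex, so the sum factorises into
      -- zero sums.
      have key : ∀ n k n' k', n < n' → ∑ e, starRingEnd ℂ (A.coeff (.weighted n k) ⟨m, e⟩) *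
          A.coeff (.weighted n' k') ⟨m, e⟩ = 0 := by
        intro n k n' k' hn
        by_cases hm : m = n'
        · by_cases hm' : m = n + 1
          · subst hm'
            subst hm
            rw [Fintype.sum_prod_type]
            simp only [coeff_weighted_left, coeff_weighted_right, ← Finset.mul_sum,
              sum_sphereBasis, mul_zero, Finset.sum_const_zero]
          · simp [A.coeff_weighted_of_ne (show m ≠ n by omega) hm']
        · by_cases hm' : m = n' + 1
          · simp [A.coeff_weighted_of_ne (show m ≠ n by omega) (by omega)]
          · simp [A.coeff_weighted_of_ne hm hm']
      rcases lt_trichotomy n n' with h | h | h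
      · exact key _ _ _ _ h
      · subst h
        have hk : k ≠ k' := fun h => hij (congrArg _ h)
        by_cases hm : m = n
        · subst hm
          rw [sum_conj_coeff_weighted_left, if_neg hk, mul_zero]
        · by_cases hm' : m = n + 1
          · subst hm'
            rw [sum_conj_coeff_weighted_right, if_neg hk, mul_zero]
          · simp [A.coeff_weighted_of_ne hm hm']
      · exact hsym (key _ _ _ _ h)

/-- A function on the edges of a cell that is orthogonal to all coefficients vanishes. -/
theorem eq_zero_of_coeff {m : ℕ} {g : A.Sphere m × A.Sphere (m + 1) → ℂ}
    (h : ∀ i, ∑ e, starRingEnd ℂ (A.coeff i ⟨m, e⟩) * g e = 0) : g = 0 := by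
  have h0 : ∑ e, g e = 0 := by simpa [coeff] using h .sym
  have hsqrt : ∀ n, (Real.sqrt (A.s n) : ℂ) ≠ 0 := fun n => by
    have := A.s_pos n
    simp [this.ne']
  -- The column sums have total zero by the radial summand, and they are orthogonal to the zero-sum
  -- basis by the weighted summands of the upper sphere.
  have hright : (fun v => ∑ u, g (u, v)) = 0 := by
    refine A.eq_zero_of_sphereBasis ?_ fun j => ?_
    · rw [← Fintype.sum_prod_type_right]
      exact h0
    · have := h (.weighted m j)
      rw [Fintype.sum_prod_type_right] at this
      simp only [coeff_weighted_left, map_mul, mul_assoc, ← Finset.mul_sum, mul_eq_zero,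
        Complex.conj_ofReal, hsqrt, false_or] at this
      exact this
  cases m with
  -- The root is the only lower vertex, so the column sums are the entries themselves.
  | zero =>
    funext ⟨u, v⟩
    have := congrFun hright v
    rwa [Fintype.sum_subsingleton _ u] at this
  | succ n =>
    have hleft : (fun u => ∑ v, g (u, v)) = 0 := by
      refine A.eq_zero_of_sphereBasis ?_ fun j => ?_
      · rw [← Fintype.sum_prod_type]
        exact h0
      · have := h (.weighted n j)
        rw [Fintype.sum_prod_type] at this
        simp only [coeff_weighted_right, map_mul, mul_assoc, ← Finset.mul_sum, mul_eq_zero,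
          Complex.conj_ofReal, hsqrt, false_or] at this
        exact this
    -- Once the row and column sums vanish, the Dirichlet coefficients give completeness in two
    -- stages: `hj` removes the dependence on the upper vertex, and the last step the dependence on
    -- the lower one.
    have hj : ∀ j, (fun v => ∑ u : A.Sphere (n + 1), starRingEnd ℂ (A.sphereBasis (n + 1) j u) * g (u, v)) = 0 := by
      intro j
      refine A.eq_zero_of_sphereBasis ?_ fun k => ?_
      · rw [Finset.sum_comm]
        refine Finset.sum_eq_zero fun u _ => ?_
        rw [← Finset.mul_sum]
        exact mul_eq_zero_of_right _ (congrFun hleft u)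
      · have := h (.dirichlet n (finProdFinEquiv (j, k)))
        rw [Fintype.sum_prod_type_right] at this
        simp only [coeff, Equiv.symm_apply_apply, map_mul] at this
        rw [← this]
        refine Finset.sum_congr rfl fun v _ => ?_
        rw [Finset.mul_sum]
        refine Finset.sum_congr rfl fun u _ => ?_
        ring
    funext ⟨u, v⟩
    exact congrFun (A.eq_zero_of_sphereBasis (G := fun u => g (u, v)) (congrFun hright v)
      fun j => congrFun (hj j) v) u

end RadialAntitree

/-! ### The unitary equivalence -/

namespace RadialAntitree

variable {V : Type*} (A : RadialAntitree V)

theorem mem_radialInterval_iff {x : ℝ} :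
    x ∈ A.radialInterval ↔ ∃ m, x ∈ Ico (A.t m) (A.t (m + 1)) := by
  classical
  constructor
  · rintro ⟨h0, hex⟩
    obtain ⟨n, hn⟩ : ∃ n, Nat.find hex = n + 1 := by
      refine Nat.exists_eq_succ_of_ne_zero fun hz => ?_
      have := Nat.find_spec hex
      rw [hz] at this
      exact absurd h0 (not_le.2 (by simpa [t] using this))
    exact ⟨n, not_lt.1 (Nat.find_min hex (by omega)), hn ▸ Nat.find_spec hex⟩
  · rintro ⟨m, h1, h2⟩
    exact A.Icc_subset_radialInterval m (m + 1) ⟨h1, h2.le⟩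

theorem withDensity_cell (m : ℕ) :
    (volume.restrict (Ico (A.t m) (A.t (m + 1)))).withDensity
      (fun x => ENNReal.ofReal (A.weight x)) =
      ((A.s m * A.s (m + 1) : ℕ) : NNReal) • A.cellMeasure m := by
  rw [withDensity_congr_ae (g := fun _ => ((A.s m * A.s (m + 1) : ℕ) : ENNReal)),
    withDensity_const, restrict_Ico_eq_restrict_Icc]
  · rw [ENNReal.smul_def]
    simp [cellMeasure]
  · filter_upwards [ae_restrict_mem measurableSet_Ico] with x hx
    rw [A.weight_eq hx, ← Nat.cast_mul, ENNReal.ofReal_natCast]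

/-- The zeros of `κ` mark the cells outside `J`. Equality up to null sets suffices, which admits the
closed interval `[t_n, t_(n+2)]` as well as the half-open radial interval. -/
theorem weightedMeasure_eq_sum {J : Set ℝ} {κ : ℕ → NNReal}
    (hJ : J =ᵐ[volume] ⋃ m, if κ m = 0 then ∅ else Ico (A.t m) (A.t (m + 1)))
    (hκ : ∀ m, κ m ≠ 0 → κ m = A.s m * A.s (m + 1)) :
    A.weightedMeasure J = Measure.sum fun m => κ m • A.cellMeasure m := by
  rw [weightedMeasure, Measure.restrict_congr_set hJ, Measure.restrict_iUnion, withDensity_sum]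
  · congr 1
    funext m
    split_ifs with h
    · simp [h]
    · rw [A.withDensity_cell, hκ m h, Nat.cast_mul]
  · intro k m hkm
    rw [Function.onFun]
    split_ifs
    · simp
    · simp
    · simp
    · refine Set.disjoint_left.2 fun x hx hx' => hkm ?_
      rcases lt_trichotomy k m with h | h | h
      · exact absurd (hx.2.trans_le ((A.t_mono h).trans hx'.1)) (lt_irrefl _)
      · exact h
      · exact absurd (hx'.2.trans_le ((A.t_mono h).trans hx.1)) (lt_irrefl _)
  · intro m
    split_ifs
    · exact MeasurableSet.empty
    · exact measurableSet_Ico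

/-- Restriction to an edge as a bounded operator. -/
noncomputable def onCellCLM (m : ℕ) (e : A.Sphere m × A.Sphere (m + 1)) :
    A.L2 →L[ℂ] Lp ℂ 2 (A.cellMeasure m) :=
  lp.evalCLM ℂ (fun e : A.Edge => Lp ℂ 2 (A.cellMeasure e.1)) 2 ⟨m, e⟩

@[simp] theorem onCellCLM_apply (f : A.L2) (m : ℕ) (e : A.Sphere m × A.Sphere (m + 1)) :
    A.onCellCLM m e f = A.onCell f m e := rfl

variable [Infinite V]

theorem isCellSum_summand (i : A.Summand) : A.IsCellSum (A.coeff i) (A.summandMeasure i) := by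
  have hs : ∀ n, (A.s n : NNReal) ≠ 0 := fun n => by exact_mod_cast (A.s_pos n).ne'
  cases i with
  | sym =>
    have h : A.radialInterval = ⋃ m, if A.cellWeight (A.coeff .sym) m = 0 then ∅ else
        Ico (A.t m) (A.t (m + 1)) := by
      ext x
      simp [cellWeight_sym, hs, mem_radialInterval_iff]
    exact A.weightedMeasure_eq_sum (.of_eq h) fun m _ => A.cellWeight_sym m
  | dirichlet n j =>
    refine Measure.ext fun s hs => ?_
    rw [Measure.sum_apply _ hs, tsum_eq_single (n + 1), cellWeight_dirichlet, one_smul]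
    · rfl
    · intro m hm
      rw [cellWeight_eq_zero.2 (A.coeff_dirichlet_of_ne hm j)]
      simp
  | weighted n j =>
    have h0 : ∀ m, A.cellWeight (A.coeff (.weighted n j)) m ≠ 0 ↔ m = n ∨ m = n + 1 := by
      intro m
      constructor
      · intro h
        by_contra hc
        rw [not_or] at hc
        exact h (cellWeight_eq_zero.2 (A.coeff_weighted_of_ne hc.1 hc.2 j))
      · rintro (rfl | rfl)
        · simp [cellWeight_weighted_left, hs]
        · simp [cellWeight_weighted_right, hs]
    refine A.weightedMeasure_eq_sum ?_ fun m hm => ?_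
    · have h : Ico (A.t n) (A.t (n + 2)) = ⋃ m, if A.cellWeight (A.coeff (.weighted n j)) m = 0
          then ∅ else Ico (A.t m) (A.t (m + 1)) := ?_
      · exact Ico_ae_eq_Icc.symm.trans (.of_eq h)
      rw [← Ico_union_Ico_eq_Ico (A.t_lt n).le (A.t_lt (n + 1)).le]
      ext x
      rw [mem_iUnion]
      constructor
      · rintro (h | h)
        · exact ⟨n, by rwa [if_neg ((h0 n).2 (.inl rfl))]⟩
        · exact ⟨n + 1, by rwa [if_neg ((h0 (n + 1)).2 (.inr rfl))]⟩
      · rintro ⟨m, hm⟩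
        split_ifs at hm with h
        · exact absurd hm (notMem_empty x)
        · rcases (h0 m).1 h with rfl | rfl
          · exact .inl hm
          · exact .inr hm
    · rcases (h0 m).1 hm with rfl | rfl
      · exact A.cellWeight_weighted_left m j
      · exact A.cellWeight_weighted_right n j

/-- The isometric embedding of a summand. -/
noncomputable def embed (i : A.Summand) : Lp ℂ 2 (A.summandMeasure i) →ₗᵢ[ℂ] A.L2 :=
  (A.isCellSum_summand i).embed

theorem onCell_embed (i : A.Summand) (x : Lp ℂ 2 (A.summandMeasure i)) (m : ℕ)
    (e : A.Sphere m × A.Sphere (m + 1)) :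
    A.onCell (A.embed i x) m e =
      A.coeff i ⟨m, e⟩ • A.cellRestrict (A.summandMeasure i) m x := rfl

/-- The ranges are orthogonal because the coefficients are, in every cell. A vector orthogonal to
all ranges has vanishing weighted sums on every cell, and completeness of the coefficients makes it
zero. -/
theorem isHilbertSum_embed :
    IsHilbertSum ℂ (fun i => Lp ℂ 2 (A.summandMeasure i)) A.embed := by
  refine IsHilbertSum.mk (fun i j hij x y => inner_embed_embed_eq_zero _ _
    (A.coeff_orthogonal hij) x y) ?_
  rw [top_le_iff, Submodule.topologicalClosure_eq_top_iff, Submodule.eq_bot_iff]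
  intro f hf
  have h1 : ∀ i m, ∑ e, starRingEnd ℂ (A.coeff i ⟨m, e⟩) • A.onCell f m e = 0 := fun i m =>
    (A.isCellSum_summand i).sum_conj_eq_zero (fun x => (Submodule.mem_orthogonal _ _).1 hf _
      (Submodule.mem_iSup_of_mem i (LinearMap.mem_range_self _ x))) m
  have h2 : ∀ m e, A.onCell f m e = 0 := by
    intro m e
    refine ext_inner_left ℂ fun h => ?_
    -- Pairing with a fixed `h` reduces the vector-valued statement to scalar functions on the
    -- edges.
    have := A.eq_zero_of_coeff (m := m) (g := fun e => inner ℂ h (A.onCell f m e)) fun i => by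
      simp only [← inner_smul_right, ← inner_sum, h1, inner_zero_right]
    rw [inner_zero_right]
    exact congrFun this e
  ext1
  funext e
  exact h2 e.1 e.2

/-- The unitary equivalence of `L²` of the antitree with the Hilbert space of the model. -/
noncomputable def modelEquiv : A.L2 ≃ₗᵢ[ℂ] A.Model := A.isHilbertSum_embed.linearIsometryEquiv

theorem hasSum_embed (f : A.L2) : HasSum (fun i => A.embed i (A.modelEquiv f i)) f := by
  have := A.isHilbertSum_embed.hasSum_linearIsometryEquiv_symm (A.modelEquiv f)
  rwa [← modelEquiv, LinearIsometryEquiv.symm_apply_apply] at this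

theorem sum_conj_coeff_self (i : A.Summand) (m : ℕ) :
    ∑ e, starRingEnd ℂ (A.coeff i ⟨m, e⟩) * A.coeff i ⟨m, e⟩ =
      ((A.cellWeight (A.coeff i) m : ℝ) : ℂ) := cellWeight_eq.symm

/-- The components of `f` in the model are weighted averages over the edges. -/
theorem sum_conj_onCell (f : A.L2) (i : A.Summand) (m : ℕ) :
    ∑ e, starRingEnd ℂ (A.coeff i ⟨m, e⟩) • A.onCell f m e =
      ((A.cellWeight (A.coeff i) m : ℝ) : ℂ) •
        A.cellRestrict (A.summandMeasure i) m (A.modelEquiv f i) := by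
  -- The weighted sum over the cell is a bounded operator, so it passes through the expansion of
  -- `f`; orthogonality of the coefficients leaves only the term of `i`.
  have h1 := (A.hasSum_embed f).mapL
    (∑ e, starRingEnd ℂ (A.coeff i ⟨m, e⟩) • A.onCellCLM m e)
  have h2 : ∀ j, (∑ e, starRingEnd ℂ (A.coeff i ⟨m, e⟩) • A.onCellCLM m e)
      (A.embed j (A.modelEquiv f j)) =
      (∑ e, starRingEnd ℂ (A.coeff i ⟨m, e⟩) * A.coeff j ⟨m, e⟩) •
        A.cellRestrict (A.summandMeasure j) m (A.modelEquiv f j) := by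
    intro j
    simp [onCell_embed, smul_smul, Finset.sum_smul]
  simp only [h2] at h1
  have h3 := h1.unique (hasSum_single i fun j hj => by
    rw [A.coeff_orthogonal (Ne.symm hj), zero_smul])
  rw [sum_conj_coeff_self] at h3
  rw [← h3]
  simp

theorem modelEquiv_symm_single [DecidableEq A.Summand] (i : A.Summand)
    (x : Lp ℂ 2 (A.summandMeasure i)) :
    A.modelEquiv.symm (lp.single 2 i x) = A.embed i x :=
  A.isHilbertSum_embed.linearIsometryEquiv_symm_apply_single x

theorem modelEquiv_apply_eq_zero {f : A.L2} {i : A.Summand}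
    (h : ∀ x, inner ℂ (A.embed i x) f = 0) : A.modelEquiv f i = 0 := by
  classical
  refine ext_inner_left ℂ fun x => ?_
  rw [inner_zero_right, ← h x, ← modelEquiv_symm_single,
    LinearIsometryEquiv.inner_map_eq_flip, LinearIsometryEquiv.symm_symm, lp.inner_single_left]

/-! ### The subspaces in terms of the model -/

theorem inner_embed_eq_zero_of_sums {f : A.L2} {i : A.Summand}
    (h : ∀ m, ∑ e, starRingEnd ℂ (A.coeff i ⟨m, e⟩) • A.onCell f m e = 0)
    (x : Lp ℂ 2 (A.summandMeasure i)) : inner ℂ (A.embed i x) f = 0 :=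
  inner_embed_eq_zero (A.isCellSum_summand i) h x

theorem sum_conj_onCell_of_sym {f : A.L2} (hf : f ∈ A.symSubspace) {i : A.Summand}
    (hi : i.block ≠ .sym) (m : ℕ) :
    ∑ e, starRingEnd ℂ (A.coeff i ⟨m, e⟩) • A.onCell f m e = 0 := by
  obtain ⟨e₀⟩ : Nonempty (A.Sphere m × A.Sphere (m + 1)) := inferInstance
  have h : ∀ e, A.onCell f m e = A.onCell f m e₀ := fun e => hf m e e₀
  simp only [h, ← Finset.sum_smul, ← map_sum, A.sum_coeff_eq_zero hi, map_zero, zero_smul]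

theorem embed_sym_mem (x : Lp ℂ 2 (A.summandMeasure .sym)) :
    A.embed .sym x ∈ A.symSubspace := fun _ _ _ => rfl

theorem embed_dirichlet_mem (n : ℕ) (j : Fin ((A.s (n + 1) - 1) * (A.s (n + 2) - 1)))
    (x : Lp ℂ 2 (A.summandMeasure (.dirichlet n j))) :
    A.embed (.dirichlet n j) x ∈ A.zeroSubspace (n + 1) := by
  refine ⟨fun m e hm => ?_, fun u => ?_, fun v => ?_⟩
  · change A.onCell _ m e = 0
    rw [onCell_embed, A.coeff_dirichlet_of_ne hm, zero_smul]
  · change ∑ v, A.onCell _ (n + 1) (u, v) = 0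
    simp only [onCell_embed, ← Finset.sum_smul, sum_coeff_dirichlet_right, zero_smul]
  · change ∑ u, A.onCell _ (n + 1) (u, v) = 0
    simp only [onCell_embed, ← Finset.sum_smul, sum_coeff_dirichlet_left, zero_smul]

omit [Infinite V] in
theorem incident_left_iff {n : ℕ} (v : A.Sphere (n + 1)) (e : A.Sphere n × A.Sphere (n + 1)) :
    A.Incident v ⟨n, e⟩ ↔ e.2 = v := by
  constructor
  · rintro (h | h)
    · have h1 := e.1.2
      rw [show (e.1 : V) = v from h, v.2] at h1
      omega
    · exact Subtype.ext h
  · rintro rfl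
    exact .inr rfl

omit [Infinite V] in
theorem incident_right_iff {n : ℕ} (v : A.Sphere (n + 1))
    (e : A.Sphere (n + 1) × A.Sphere (n + 2)) : A.Incident v ⟨n + 1, e⟩ ↔ e.1 = v := by
  constructor
  · rintro (h | h)
    · exact Subtype.ext h
    · have h1 := e.2.2
      rw [show (e.2 : V) = v from h, v.2] at h1
      omega
  · rintro rfl
    exact .inl rfl

omit [Infinite V] in
theorem not_incident {n m : ℕ} (h : m ≠ n) (h' : m ≠ n + 1) (v : A.Sphere (n + 1))
    (e : A.Sphere m × A.Sphere (m + 1)) : ¬ A.Incident v ⟨m, e⟩ := by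
  rintro (h1 | h1)
  · have h2 := e.1.2
    rw [show (e.1 : V) = v from h1, v.2] at h2
    omega
  · have h2 := e.2.2
    rw [show (e.2 : V) = v from h1, v.2] at h2
    omega

open Classical in
/-- The restriction of `f` to the star of a vertex. -/
noncomputable def starPart (v : V) (f : A.L2) : A.L2 :=
  ⟨fun e => if A.Incident v e then f e else 0, memℓp_gen (by
    have hf : Summable fun e => ‖f e‖ ^ (2 : ENNReal).toReal := (lp.memℓp f).summable (by norm_num)
    refine Summable.of_nonneg_of_le (fun e => by positivity) (fun e => ?_) hf
    split_ifs
    · exact le_rfl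
    · rw [norm_zero]
      simp)⟩

open Classical in
omit [Infinite V] in
theorem starPart_apply (v : V) (f : A.L2) (e : A.Edge) :
    A.starPart v f e = if A.Incident v e then f e else 0 := rfl

/-- Each edge of the two cells in question has exactly one end on the sphere, so the vector is the
sum of its star parts. Its coefficient depends on that end only, hence is constant on each half of a
star; zero sums give orthogonality to the radial functions. -/
theorem embed_weighted_mem (n : ℕ) (j : Fin (A.s (n + 1) - 1))
    (x : Lp ℂ 2 (A.summandMeasure (.weighted n j))) :
    A.embed (.weighted n j) x ∈ A.sphereSubspace (n + 1) := by
  classical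
  have hout : ∀ m e, m ≠ n → m ≠ n + 1 → A.embed (.weighted n j) x ⟨m, e⟩ = 0 := by
    intro m e h h'
    change A.onCell _ m e = 0
    rw [onCell_embed, A.coeff_weighted_of_ne h h', zero_smul]
  refine ⟨?_, (Submodule.mem_orthogonal _ _).2 fun f hf => ?_⟩
  · have hsum : A.embed (.weighted n j) x =
        ∑ v : A.Sphere (n + 1), A.starPart v (A.embed (.weighted n j) x) := by
      ext1
      funext ⟨m, e⟩
      rw [lp.coeFn_sum, Finset.sum_apply]
      simp only [starPart_apply]
      by_cases h : m = n
      · subst h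
        simp only [incident_left_iff]
        rw [Finset.sum_ite_eq, if_pos (Finset.mem_univ _)]
      · by_cases h' : m = n + 1
        · subst h'
          simp only [incident_right_iff]
          rw [Finset.sum_ite_eq, if_pos (Finset.mem_univ _)]
        · simp [A.not_incident h h', hout m e h h']
    rw [hsum]
    refine Submodule.sum_mem _ fun v _ => Submodule.mem_iSup_of_mem v ⟨fun e he => ?_,
      fun m e e' he he' => ?_⟩
    · rw [starPart_apply, if_neg he]
    · rw [starPart_apply, starPart_apply, if_pos he, if_pos he']
      change A.onCell _ m e = A.onCell _ m e'
      rw [onCell_embed, onCell_embed]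
      congr 1
      by_cases h : m = n
      · subst h
        rw [coeff_weighted_left, coeff_weighted_left, (A.incident_left_iff v e).1 he,
          (A.incident_left_iff v e').1 he']
      · by_cases h' : m = n + 1
        · subst h'
          rw [coeff_weighted_right, coeff_weighted_right, (A.incident_right_iff v e).1 he,
            (A.incident_right_iff v e').1 he']
        · exact absurd he (A.not_incident h h' v e)
  · rw [inner_eq_zero_symm]
    exact A.inner_embed_eq_zero_of_sums
      (fun m => A.sum_conj_onCell_of_sym hf (by simp [Summand.block]) m) x

theorem embed_mem (i : A.Summand) (x : Lp ℂ 2 (A.summandMeasure i)) :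
    A.embed i x ∈ A.subspace i.block := by
  cases i with
  | sym => exact A.embed_sym_mem x
  | dirichlet n j => exact A.embed_dirichlet_mem n j x
  | weighted n j => exact A.embed_weighted_mem n j x

/-- On the cell in question every coefficient from another block either vanishes or has the form
$a(u)+b(v)$, and such functions are annihilated by vanishing row and column sums. -/
theorem sum_conj_onCell_of_zero {n : ℕ} {f : A.L2} (hf : f ∈ A.zeroSubspace (n + 1))
    {i : A.Summand} (hi : i.block ≠ .zero n) (m : ℕ) :
    ∑ e, starRingEnd ℂ (A.coeff i ⟨m, e⟩) • A.onCell f m e = 0 := by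
  by_cases hm : m = n + 1
  · subst hm
    have hadd : ∀ a b : V → ℂ, (∀ e : A.Sphere (n + 1) × A.Sphere (n + 2),
        A.coeff i ⟨n + 1, e⟩ = a e.1 + b e.2) →
        ∑ e, starRingEnd ℂ (A.coeff i ⟨n + 1, e⟩) • A.onCell f (n + 1) e = 0 := by
      intro a b h
      have h1 : ∀ u, ∑ v, A.onCell f (n + 1) (u, v) = 0 := hf.2.1
      have h2 : ∀ v, ∑ u, A.onCell f (n + 1) (u, v) = 0 := hf.2.2
      simp only [h, map_add, add_smul, Finset.sum_add_distrib]
      rw [Fintype.sum_prod_type, Fintype.sum_prod_type_right]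
      simp only [← Finset.smul_sum, h1, h2, smul_zero, Finset.sum_const_zero, add_zero]
    cases i with
    | sym => exact hadd (fun _ => 1) (fun _ => 0) fun e => by simp [coeff]
    | weighted n' j =>
      exact hadd (fun v => Real.sqrt (A.s (n' + 1)) * A.sphereBasis (n' + 1) j v)
        (fun v => Real.sqrt (A.s (n' + 1)) * A.sphereBasis (n' + 1) j v) fun e => mul_add _ _ _
    | dirichlet n' j =>
      have : n + 1 ≠ n' + 1 := fun h => hi (by simp [Summand.block, Nat.succ_injective h])
      simp [A.coeff_dirichlet_of_ne this]
  · have h : ∀ e, A.onCell f m e = 0 := fun e => hf.1 m e hm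
    simp [h]

theorem sum_coeff_left {n : ℕ} {i : A.Summand} (hi : i.block ≠ .sphere n) (hi' : i.block ≠ .sym)
    (v : A.Sphere (n + 1)) : ∑ u, A.coeff i ⟨n, (u, v)⟩ = 0 := by
  cases i with
  | sym => exact absurd rfl hi'
  | dirichlet n' j => exact A.sum_coeff_dirichlet_left n' n j v
  | weighted n' j =>
    have : n + 1 ≠ n' + 1 := fun h => hi (by simp [Summand.block, Nat.succ_injective h])
    simp only [coeff, A.sphereBasis_of_ne this, add_zero, ← Finset.mul_sum, sum_sphereBasis,
      mul_zero]

theorem sum_coeff_right {n : ℕ} {i : A.Summand} (hi : i.block ≠ .sphere n) (hi' : i.block ≠ .sym)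
    (v : A.Sphere (n + 1)) : ∑ w, A.coeff i ⟨n + 1, (v, w)⟩ = 0 := by
  cases i with
  | sym => exact absurd rfl hi'
  | dirichlet n' j => exact A.sum_coeff_dirichlet_right n' (n + 1) j v
  | weighted n' j =>
    have : n + 1 ≠ n' + 1 := fun h => hi (by simp [Summand.block, Nat.succ_injective h])
    simp only [coeff, A.sphereBasis_of_ne this, zero_add, ← Finset.mul_sum, sum_sphereBasis,
      mul_zero]

/-- On each half of the star `f` is one fixed function, so the weighted sum is a multiple of the sum
of the coefficients over that half, which vanishes for the blocks considered. -/
theorem sum_conj_onCell_of_star {n : ℕ} {v : A.Sphere (n + 1)} {f : A.L2}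
    (hf : f ∈ A.starSubspace v) {i : A.Summand} (hi : i.block ≠ .sphere n)
    (hi' : i.block ≠ .sym) (m : ℕ) :
    ∑ e, starRingEnd ℂ (A.coeff i ⟨m, e⟩) • A.onCell f m e = 0 := by
  have h0 : ∀ m e, ¬ A.Incident v ⟨m, e⟩ → A.onCell f m e = 0 := fun m e h => hf.1 _ h
  by_cases h : m = n
  · subst h
    rw [Fintype.sum_prod_type_right, Finset.sum_eq_single v]
    · obtain ⟨u₀⟩ : Nonempty (A.Sphere m) := inferInstance
      have h1 : ∀ u, A.onCell f m (u, v) = A.onCell f m (u₀, v) := fun u =>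
        hf.2 m _ _ ((A.incident_left_iff v _).2 rfl) ((A.incident_left_iff v _).2 rfl)
      simp only [h1, ← Finset.sum_smul, ← map_sum, A.sum_coeff_left hi hi', map_zero, zero_smul]
    · intro w _ hw
      refine Finset.sum_eq_zero fun u _ => ?_
      rw [h0 m (u, w) fun h => hw ((A.incident_left_iff v _).1 h), smul_zero]
    · exact fun h => absurd (Finset.mem_univ _) h
  · by_cases h' : m = n + 1
    · subst h'
      rw [Fintype.sum_prod_type, Finset.sum_eq_single v]
      · obtain ⟨u₀⟩ : Nonempty (A.Sphere (n + 2)) := inferInstance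
        have h1 : ∀ u, A.onCell f (n + 1) (v, u) = A.onCell f (n + 1) (v, u₀) := fun u =>
          hf.2 (n + 1) _ _ ((A.incident_right_iff v _).2 rfl) ((A.incident_right_iff v _).2 rfl)
        simp only [h1, ← Finset.sum_smul, ← map_sum, A.sum_coeff_right hi hi', map_zero, zero_smul]
      · intro w _ hw
        refine Finset.sum_eq_zero fun u _ => ?_
        rw [h0 (n + 1) (w, u) fun h => hw ((A.incident_right_iff v _).1 h), smul_zero]
      · exact fun h => absurd (Finset.mem_univ _) h
    · simp [h0 m _ (A.not_incident h h' v _)]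

theorem modelEquiv_apply_of_mem {b : Block} {f : A.L2} (hf : f ∈ A.subspace b) {i : A.Summand}
    (hi : i.block ≠ b) : A.modelEquiv f i = 0 := by
  refine A.modelEquiv_apply_eq_zero fun x => ?_
  cases b with
  | sym => exact A.inner_embed_eq_zero_of_sums (A.sum_conj_onCell_of_sym hf hi) x
  | zero n => exact A.inner_embed_eq_zero_of_sums (A.sum_conj_onCell_of_zero hf hi) x
  | sphere n =>
    by_cases hi' : i.block = .sym
    · cases i with
      | sym => exact (Submodule.mem_orthogonal _ _).1 hf.2 _ (A.embed_sym_mem x)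
      | dirichlet n j => cases hi'
      | weighted n j => cases hi'
    -- Orthogonality to one vector defines a subspace, so it passes from the single stars to their
    -- supremum.
    · have hle : ⨆ v : A.Sphere (n + 1), A.starSubspace v ≤
          (Submodule.span ℂ {A.embed i x})ᗮ := by
        refine iSup_le fun v g hg => Submodule.mem_orthogonal_singleton_iff_inner_right.2 ?_
        exact A.inner_embed_eq_zero_of_sums (A.sum_conj_onCell_of_star hg hi hi') x
      exact Submodule.mem_orthogonal_singleton_iff_inner_right.1 (hle hf.1)

omit [Infinite V] in
-- Finiteness makes a vector with components in one block a finite sum of embedded vectors, so no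
-- closure has to be taken in `mem_subspace_iff`.
theorem finite_block (b : Block) : {i : A.Summand | i.block = b}.Finite := by
  cases b with
  | sym =>
    refine (Set.finite_singleton Summand.sym).subset fun i hi => ?_
    cases i with
    | sym => rfl
    | dirichlet n j => cases hi
    | weighted n j => cases hi
  | zero n =>
    refine (Set.finite_range (Summand.dirichlet n)).subset fun i hi => ?_
    cases i with
    | sym => cases hi
    | dirichlet n j => cases hi; exact ⟨j, rfl⟩
    | weighted n j => cases hi
  | sphere n =>
    refine (Set.finite_range (Summand.weighted n)).subset fun i hi => ?_
    cases i with
    | sym => cases hi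
    | dirichlet n j => cases hi
    | weighted n j => cases hi; exact ⟨j, rfl⟩

/-- This carries the abstract subspaces over to the model: closedness, mutual orthogonality and the
reducing property are all read off from components. -/
theorem mem_subspace_iff (b : Block) (f : A.L2) :
    f ∈ A.subspace b ↔ ∀ i : A.Summand, i.block ≠ b → A.modelEquiv f i = 0 := by
  refine ⟨fun hf i hi => A.modelEquiv_apply_of_mem hf hi, fun h => ?_⟩
  have h1 : HasSum (fun i => A.embed i (A.modelEquiv f i))
      (∑ i ∈ (A.finite_block b).toFinset, A.embed i (A.modelEquiv f i)) :=
    hasSum_sum_of_ne_finset_zero fun i hi => by rw [h i (by simpa using hi), map_zero]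
  rw [(A.hasSum_embed f).unique h1]
  refine Submodule.sum_mem _ fun i hi => ?_
  have hb : i.block = b := by simpa using hi
  exact hb ▸ A.embed_mem i _

end RadialAntitree

/-! ### Solutions on single cells -/

section CellSolutions

variable {ν μ : Measure ℝ} {w : ℝ → ℝ} {J : Set ℝ} {F Q h : ℝ → ℂ} {a b : ℝ}

theorem IsSL.of_sum {ι : Type*} (s : Finset ι) (c : ι → ℂ) {F Q h : ι → ℝ → ℂ}
    (H : ∀ i ∈ s, IsSL ν w J (F i) (Q i) (h i)) :
    IsSL ν w J (∑ i ∈ s, c i • F i) (∑ i ∈ s, c i • Q i) (∑ i ∈ s, c i • h i) := by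
  classical
  induction s using Finset.induction_on with
  | empty => exact .zero (.of_forall fun x => rfl)
  | insert i s hi ih =>
    rw [Finset.sum_insert hi, Finset.sum_insert hi, Finset.sum_insert hi]
    have h1 : IsSL ν w J (c i • F i) (c i • Q i) (c i • h i) :=
      (H i (Finset.mem_insert_self i s)).smul (c i) (.of_forall fun x => rfl)
    exact h1.add (ih fun j hj => H j (Finset.mem_insert_of_mem hj)) (.of_forall fun x => rfl)

/-- On an interval on which the weight is constant, one may pass to the weight `1`. -/
theorem IsSL.of_weight_const (H : IsSL ν w J F Q h) {κ : ℝ} (hκ : κ ≠ 0) (hJ : Icc a b ⊆ J)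
    (hac : volume.restrict (Icc a b) ≪ ν) (hw : ∀ᵐ x ∂volume.restrict (Icc a b), w x = κ)
    (hh : h' =ᵐ[volume.restrict (Icc a b)] h) :
    IsSL (volume.restrict (Icc a b)) (fun _ => 1) (Icc a b) F ((κ : ℂ)⁻¹ • Q) h' where
  ac c d hcd hs := H.ac c d hcd (hs.trans hJ)
  ac_quasi c d hcd hs := (H.ac_quasi c d hcd (hs.trans hJ)).const_smul (κ : ℂ)⁻¹
  deriv_eq := by
    filter_upwards [hac.ae_le H.deriv_eq, hw] with x h1 h2
    rw [h2] at h1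
    simpa using h1
  deriv_quasi_eq := by
    filter_upwards [hac.ae_le H.deriv_quasi_eq, hw, hh] with x h1 h2 h3
    rw [h2] at h1
    have hκ' : (κ : ℂ) ≠ 0 := by exact_mod_cast hκ
    refine (h1.const_smul (κ : ℂ)⁻¹).congr_deriv ?_
    rw [h3, smul_eq_mul, mul_neg, inv_mul_cancel_left₀ hκ', Complex.ofReal_one, one_mul]

theorem AbsolutelyContinuousOnInterval.eqOn_of_ae_hasDerivAt {F G φ : ℝ → ℂ} (hab : a ≤ b)
    (hF : AbsolutelyContinuousOnInterval F a b) (hG : AbsolutelyContinuousOnInterval G a b)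
    (hFd : ∀ᵐ x ∂volume.restrict (Icc a b), HasDerivAt F (φ x) x)
    (hGd : ∀ᵐ x ∂volume.restrict (Icc a b), HasDerivAt G (φ x) x) (ha : F a = G a) :
    EqOn F G (Icc a b) := by
  obtain ⟨C, hC⟩ := (hF.sub hG).const_of_ae_hasDerivAt_zero (by
    rw [uIcc_of_le hab, ← ae_restrict_iff' measurableSet_Icc]
    filter_upwards [hFd, hGd] with x h1 h2
    simpa using h1.sub h2)
  intro x hx
  rw [uIcc_of_le hab] at hC
  have h1 := hC x hx
  have h2 := hC a (left_mem_Icc.2 hab)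
  simp only [Pi.sub_apply, ha, sub_self] at h1 h2
  rwa [← h2, sub_eq_zero] at h1

theorem AbsolutelyContinuousOnInterval.eqOn_zero_of_ae (hab : a < b)
    (hF : AbsolutelyContinuousOnInterval F a b) (h0 : F =ᵐ[volume.restrict (Icc a b)] 0) :
    EqOn F 0 (Icc a b) := by
  have hc := hF.continuousOn
  rw [uIcc_of_le hab.le] at hc
  exact Measure.eqOn_Icc_of_ae_eq volume hab.ne h0 hc continuousOn_const

end CellSolutions

/-! ### Bounds for the weight and gluing of solutions across spheres -/

namespace RadialAntitree

variable {V : Type*} (A : RadialAntitree V)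

theorem ae_weight_eq (m : ℕ) :
    ∀ᵐ x ∂A.cellMeasure m, A.weight x = ((A.s m * A.s (m + 1) : NNReal) : ℝ) := by
  filter_upwards [A.ae_mem_Ioo_cell m] with x hx
  simpa using A.weight_eq (Ioo_subset_Ico_self hx)

variable [Infinite V]

theorem one_le_weight {x : ℝ} (hx : x ∈ A.radialInterval) : 1 ≤ A.weight x := by
  obtain ⟨m, hm⟩ := A.mem_radialInterval_iff.1 hx
  rw [A.weight_eq hm]
  exact_mod_cast Nat.mul_pos (A.s_pos m) (A.s_pos (m + 1))

theorem restrict_le_weightedMeasure {J J' : Set ℝ} (hJm : MeasurableSet J) (hJ : J ⊆ A.radialInterval)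
    (hJJ' : J ⊆ J') : volume.restrict J ≤ (1 : NNReal) • A.weightedMeasure J' := by
  rw [one_smul]
  calc volume.restrict J = (volume.restrict J).withDensity 1 := withDensity_one.symm
    _ ≤ A.weightedMeasure J := by
      refine withDensity_mono ?_
      filter_upwards [ae_restrict_mem hJm] with x hx
      simpa using A.one_le_weight (hJ hx)
    _ ≤ A.weightedMeasure J' := by
      refine Measure.le_iff.2 fun s hs => ?_
      rw [weightedMeasure, weightedMeasure, withDensity_apply _ hs, withDensity_apply _ hs]
      exact lintegral_mono' (Measure.restrict_mono le_rfl (Measure.restrict_mono hJJ' le_rfl)) le_rfl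

omit [Infinite V] in
theorem weight_le {N : ℕ} {x : ℝ} (h0 : 0 ≤ x) (hx : x ≤ A.t N) :
    A.weight x ≤ ∑ m ∈ Finset.range (N + 1), (A.s m * A.s (m + 1) : ℝ) := by
  obtain ⟨m, hm⟩ := A.mem_radialInterval_iff.1 ⟨h0, N + 1, hx.trans_lt (A.t_lt N)⟩
  rw [A.weight_eq hm]
  -- The range goes up to `N` inclusive because the point `t N` itself belongs to the cell `N`.
  refine Finset.single_le_sum (f := fun m => (A.s m * A.s (m + 1) : ℝ))
    (fun k _ => by positivity) (Finset.mem_range.2 ?_)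
  by_contra hc
  have : A.t (N + 1) ≤ A.t m := A.t_mono (not_lt.1 hc)
  exact absurd (hm.1.trans hx) (not_le.2 ((A.t_lt N).trans_le this))

theorem isRegularWeight {p N : ℕ} (hpN : p < N) :
    IsRegularWeight (A.weightedMeasure (Icc (A.t p) (A.t N))) A.weight (A.t p) (A.t N)
      (∑ m ∈ Finset.range (N + 1), (A.s m * A.s (m + 1) : ℝ)) 1 := by
  have hsub := A.Icc_subset_radialInterval p N
  have hle : ∀ x ∈ Icc (A.t p) (A.t N), A.weight x ≤
      ∑ m ∈ Finset.range (N + 1), (A.s m * A.s (m + 1) : ℝ) := fun x hx =>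
    A.weight_le (hsub hx).1 hx.2
  refine ⟨(A.t_lt p).trans_le (A.t_mono hpN), A.measurable_weight,
    fun x hx => A.weight_pos (hsub hx), hle, fun x hx => ?_,
    withDensity_absolutelyContinuous _ _, ?_, ?_⟩
  -- The same constant bounds the inverse, since $1/\mu\le 1\le\mu$.
  · have h1 := A.one_le_weight (hsub hx)
    exact (inv_le_one_of_one_le₀ h1).trans (h1.trans (hle x hx))
  · exact A.restrict_le_weightedMeasure measurableSet_Icc hsub subset_rfl
  · refine isFiniteMeasure_withDensity (ne_of_lt ?_)
    calc _ ≤ ∫⁻ _ in Icc (A.t p) (A.t N),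
          ENNReal.ofReal (∑ m ∈ Finset.range (N + 1), (A.s m * A.s (m + 1) : ℝ)) := by
          refine lintegral_mono_ae ?_
          filter_upwards [ae_restrict_mem measurableSet_Icc] with x hx
          exact ENNReal.ofReal_le_ofReal (hle x hx)
      _ < ⊤ := by
          rw [lintegral_const]
          simp [ENNReal.mul_lt_top]

omit [Infinite V] in
theorem isRegularWeight_one (m : ℕ) :
    IsRegularWeight (A.cellMeasure m) (fun _ => 1) (A.t m) (A.t (m + 1)) 1 1 where
  lt := A.t_lt m
  measurable := measurable_const
  pos _ _ := one_pos
  le _ _ := le_rfl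
  inv_le _ _ := by simp
  ac := Measure.AbsolutelyContinuous.refl _
  le_smul := by rw [one_smul, cellMeasure]
  finite := by
    rw [cellMeasure]
    infer_instance

theorem integrableOn_Lp {J : Set ℝ} {p N : ℕ} (hJ : Icc (A.t p) (A.t N) ⊆ J)
    (z : Lp ℂ 2 (A.weightedMeasure J)) : IntegrableOn z (Icc (A.t p) (A.t N)) := by
  have h := (Lp.memLp z).of_measure_le_smul (c := ((1 : NNReal) : ENNReal)) ENNReal.coe_ne_top
    (A.restrict_le_weightedMeasure measurableSet_Icc (A.Icc_subset_radialInterval p N) hJ)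
  exact h.integrable (by norm_num)

omit [Infinite V] in
theorem Icc_cell_subset {p N m : ℕ} (hp : p ≤ m) (hN : m < N) :
    Icc (A.t m) (A.t (m + 1)) ⊆ Icc (A.t p) (A.t N) :=
  Icc_subset_Icc (A.t_mono hp) (A.t_mono hN)

theorem cellMeasure_ac {J : Set ℝ} {m : ℕ} (hJ : Icc (A.t m) (A.t (m + 1)) ⊆ J) :
    A.cellMeasure m ≪ A.weightedMeasure J :=
  Measure.absolutelyContinuous_of_le_smul
    (A.restrict_le_weightedMeasure measurableSet_Icc (A.Icc_subset_radialInterval m (m + 1)) hJ)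

/-- The function on the radial interval that is obtained by integrating the equation from `a`. -/
noncomputable def radialSolution (a : ℝ) (f₀ q₀ : ℂ) (z : ℝ → ℂ) (x : ℝ) : ℂ :=
  f₀ + weightPrimitive A.weight a (fun s => q₀ + quasiPrimitive A.weight a z s) x

/-- Solutions on the single cells with matching values and quasi-derivatives are the restrictions of
one solution. -/
theorem eqOn_radialSolution {p N : ℕ} {F q : ℕ → ℝ → ℂ} {z : ℝ → ℂ}
    (hz : IntegrableOn z (Icc (A.t p) (A.t N)))
    (H : ∀ m, p ≤ m → m < N →
      IsSL (A.cellMeasure m) (fun _ => 1) (Icc (A.t m) (A.t (m + 1))) (F m) (q m) z)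
    (hF : ∀ m, p ≤ m → m + 1 < N → F m (A.t (m + 1)) = F (m + 1) (A.t (m + 1)))
    (hq : ∀ m, p ≤ m → m + 1 < N → (A.s m * A.s (m + 1) : ℂ) * q m (A.t (m + 1)) =
      (A.s (m + 1) * A.s (m + 2) : ℂ) * q (m + 1) (A.t (m + 1)))
    (m : ℕ) (hpm : p ≤ m) (hmN : m < N) :
    EqOn (fun x => (A.s p * A.s (p + 1) : ℂ) * q p (A.t p) + quasiPrimitive A.weight (A.t p) z x)
        (fun x => (A.s m * A.s (m + 1) : ℂ) * q m x) (Icc (A.t m) (A.t (m + 1))) ∧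
      EqOn (A.radialSolution (A.t p) (F p (A.t p)) ((A.s p * A.s (p + 1) : ℂ) * q p (A.t p)) z)
        (F m) (Icc (A.t m) (A.t (m + 1))) := by
  set q₀ : ℂ := (A.s p * A.s (p + 1) : ℂ) * q p (A.t p) with hq₀
  have hsl := (A.isRegularWeight (hpm.trans_lt hmN)).isSL_of_integral hz (F p (A.t p)) q₀
  have step : ∀ m, p ≤ m → m < N →
      q₀ + quasiPrimitive A.weight (A.t p) z (A.t m) = (A.s m * A.s (m + 1) : ℂ) * q m (A.t m) →
      A.radialSolution (A.t p) (F p (A.t p)) q₀ z (A.t m) = F m (A.t m) →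
      EqOn (fun x => q₀ + quasiPrimitive A.weight (A.t p) z x)
        (fun x => (A.s m * A.s (m + 1) : ℂ) * q m x) (Icc (A.t m) (A.t (m + 1))) ∧
      EqOn (A.radialSolution (A.t p) (F p (A.t p)) q₀ z) (F m) (Icc (A.t m) (A.t (m + 1))) := by
    -- On a single cell the weight is constant. Matching initial values determine first the
    -- quasi-derivative and then, as its equation involves the latter, the function.
    intro m hpm hmN h1 h2
    have hsub := A.Icc_cell_subset hpm hmN
    have hac := A.cellMeasure_ac hsub
    have hs : (A.s m * A.s (m + 1) : ℂ) ≠ 0 := by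
      exact_mod_cast (Nat.mul_pos (A.s_pos m) (A.s_pos (m + 1))).ne'
    have hm := H m hpm hmN
    have hle := (A.t_lt m).le
    have hQ : EqOn (fun x => q₀ + quasiPrimitive A.weight (A.t p) z x)
        (fun x => (A.s m * A.s (m + 1) : ℂ) * q m x) (Icc (A.t m) (A.t (m + 1))) := by
      have hac2 : AbsolutelyContinuousOnInterval (fun x => (A.s m * A.s (m + 1) : ℂ) * q m x)
          (A.t m) (A.t (m + 1)) :=
        (hm.ac_quasi _ _ hle subset_rfl).const_smul (A.s m * A.s (m + 1) : ℂ)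
      refine AbsolutelyContinuousOnInterval.eqOn_of_ae_hasDerivAt hle
        (hsl.ac_quasi _ _ hle hsub) hac2 (hac.ae_le hsl.deriv_quasi_eq) ?_ h1
      filter_upwards [hm.deriv_quasi_eq, A.ae_weight_eq m] with x hx hw
      refine (hx.const_mul (A.s m * A.s (m + 1) : ℂ)).congr_deriv ?_
      rw [hw]
      push_cast
      ring
    refine ⟨hQ, AbsolutelyContinuousOnInterval.eqOn_of_ae_hasDerivAt hle
      (hsl.ac _ _ hle hsub) (hm.ac _ _ hle subset_rfl) (hac.ae_le hsl.deriv_eq) ?_ h2⟩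
    filter_upwards [hm.deriv_eq, A.ae_weight_eq m, A.ae_mem_Ioo_cell m] with x hx hw hx'
    refine hx.congr_deriv ?_
    have h3 := hQ (Ioo_subset_Icc_self hx')
    simp only at h3
    rw [h3, hw]
    push_cast
    rw [inv_mul_cancel_left₀ hs, inv_one, one_mul]
  -- Induction over the cells: agreement at the end of one cell passes to the start of the next
  -- through the matching hypotheses `hF` and `hq`.
  have hstart : ∀ k, p + k < N →
      q₀ + quasiPrimitive A.weight (A.t p) z (A.t (p + k)) =
        (A.s (p + k) * A.s (p + k + 1) : ℂ) * q (p + k) (A.t (p + k)) ∧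
      A.radialSolution (A.t p) (F p (A.t p)) q₀ z (A.t (p + k)) = F (p + k) (A.t (p + k)) := by
    intro k
    induction k with
    | zero =>
      intro _
      simp [quasiPrimitive, radialSolution, weightPrimitive, hq₀]
    | succ k ih =>
      intro hk
      obtain ⟨h1, h2⟩ := ih (by omega)
      obtain ⟨h3, h4⟩ := step (p + k) (by omega) (by omega) h1 h2
      have hmem : A.t (p + k + 1) ∈ Icc (A.t (p + k)) (A.t (p + k + 1)) :=
        right_mem_Icc.2 (A.t_lt _).le
      exact ⟨(h3 hmem).trans (hq (p + k) (by omega) hk), (h4 hmem).trans (hF (p + k) (by omega) hk)⟩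
  obtain ⟨k, rfl⟩ := Nat.exists_eq_add_of_le hpm
  exact step _ hpm hmN (hstart k hmN).1 (hstart k hmN).2

end RadialAntitree

/-! ### From the model to the antitree -/

namespace RadialAntitree

variable {V : Type*} (A : RadialAntitree V) [Infinite V]

theorem s_ne_zero (n : ℕ) : (A.s n : ℂ) ≠ 0 := by exact_mod_cast (A.s_pos n).ne'

/-- On a cell of weight $\kappa$ the quasi-derivative is $Q=\kappa F'$, so the lift $cF$ has edge
derivative $c\,\kappa^{-1}Q$. On cells of weight zero the lift vanishes, and nothing is asked of `F`
there. -/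
theorem embed_mem_preKirchhoffGraph {i : A.Summand} {x z : Lp ℂ 2 (A.summandMeasure i)}
    {F Q : ℝ → ℂ} {N : ℕ} (hN : ∀ m, N ≤ m → ∀ e, A.onCell (A.embed i x) m e = 0)
    (hcell : ∀ m, A.cellWeight (A.coeff i) m ≠ 0 →
      A.cellRestrict (A.summandMeasure i) m x =ᵐ[A.cellMeasure m] F ∧
      IsSL (A.cellMeasure m) (fun _ => 1) (Icc (A.t m) (A.t (m + 1))) F
        (((A.cellWeight (A.coeff i) m : ℝ) : ℂ)⁻¹ • Q)
        (A.cellRestrict (A.summandMeasure i) m z))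
    (hK : A.Kirchhoff (fun e => A.coeff i e • F)
      fun e => (A.coeff i e * ((A.cellWeight (A.coeff i) e.1 : ℝ) : ℂ)⁻¹) • Q) :
    (A.embed i x, A.embed i z) ∈ A.preKirchhoffGraph := by
  refine ⟨?_, _, _, fun e => ?_, hK⟩
  · refine (((Finset.range N).sigma fun m =>
      (Finset.univ : Finset (A.Sphere m × A.Sphere (m + 1)))).finite_toSet).subset ?_
    rintro ⟨m, e⟩ he
    have : m < N := by
      by_contra hc
      exact he (hN m (not_lt.1 hc) e)
    simpa using this
  · obtain ⟨m, e⟩ := e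
    change (A.onCell (A.embed i x) m e) =ᵐ[A.cellMeasure m] _ ∧
      IsSL _ _ _ _ _ (A.onCell (A.embed i z) m e)
    rw [onCell_embed, onCell_embed]
    have hx := Lp.coeFn_smul (A.coeff i ⟨m, e⟩) (A.cellRestrict (A.summandMeasure i) m x)
    have hz := Lp.coeFn_smul (A.coeff i ⟨m, e⟩) (A.cellRestrict (A.summandMeasure i) m z)
    by_cases hm : A.cellWeight (A.coeff i) m = 0
    · rw [cellWeight_eq_zero.1 hm e] at hx hz ⊢
      rw [zero_smul, zero_mul, zero_smul, zero_smul, zero_smul]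
      exact ⟨Lp.coeFn_zero _ _ _, .zero (Lp.coeFn_zero _ _ _)⟩
    · obtain ⟨h1, h2⟩ := hcell m hm
      refine ⟨hx.trans (h1.const_smul _), ?_⟩
      rw [mul_smul]
      exact h2.smul _ hz

theorem summand_cell_isSL {i : A.Summand} {w : ℝ → ℝ} {J : Set ℝ}
    {x z : Lp ℂ 2 (A.summandMeasure i)} {F Q : ℝ → ℂ} (hF : x =ᵐ[A.summandMeasure i] F)
    (H : IsSL (A.summandMeasure i) w J F Q z) {m : ℕ} (hm : A.cellWeight (A.coeff i) m ≠ 0)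
    (hJ : Icc (A.t m) (A.t (m + 1)) ⊆ J)
    (hw : ∀ᵐ x ∂A.cellMeasure m, w x = A.cellWeight (A.coeff i) m) :
    A.cellRestrict (A.summandMeasure i) m x =ᵐ[A.cellMeasure m] F ∧
      IsSL (A.cellMeasure m) (fun _ => 1) (Icc (A.t m) (A.t (m + 1))) F
        (((A.cellWeight (A.coeff i) m : ℝ) : ℂ)⁻¹ • Q)
        (A.cellRestrict (A.summandMeasure i) m z) := by
  have hν := A.isCellSum_summand i
  refine ⟨(hν.coeFn_cellRestrict hm x).trans ((hν.ac hm).ae_le hF), ?_⟩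
  exact H.of_weight_const (by exact_mod_cast hm) hJ (hν.ac hm) hw (hν.coeFn_cellRestrict hm z)

/-- At a vertex of $S_{n+1}$ there are $s_{n+2}$ outgoing edges with derivative $Q/(s_{n+1}s_{n+2})$
and $s_n$ incoming ones with derivative $Q/(s_ns_{n+1})$. Both totals equal $Q/s_{n+1}$, so
continuity of $Q$ is the flux condition. -/
theorem embed_radial_mem {x z : Lp ℂ 2 (A.summandMeasure .sym)}
    (h : (x, z) ∈ slGraph (A.weightedMeasure A.radialInterval) A.weight A.radialInterval
      (neumannCompactSupport A.radialInterval A.zero_mem_radialInterval)) :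
    (A.embed .sym x, A.embed .sym z) ∈ A.preKirchhoffGraph := by
  obtain ⟨F, Q, hF, H, hQ0, c, ⟨-, N, hcN⟩, hc⟩ := h
  simp only at hF H hQ0 hc
  have hκ : ∀ m, A.cellWeight (A.coeff .sym) m ≠ 0 := fun m => by
    rw [cellWeight_sym]
    exact_mod_cast (Nat.mul_pos (A.s_pos m) (A.s_pos (m + 1))).ne'
  have hcell := fun m => A.summand_cell_isSL hF H (hκ m) (A.Icc_subset_radialInterval m (m + 1))
    (by rw [cellWeight_sym]; exact A.ae_weight_eq m)
  refine A.embed_mem_preKirchhoffGraph (N := N) (fun m hm e => ?_) (fun m _ => hcell m)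
    ⟨⟨fun v => F (A.t (A.graph.dist A.root v)), fun n u v => ?_⟩, fun u => ?_, fun n v => ?_⟩
  · rw [onCell_embed]
    refine smul_eq_zero_of_right _ (Lp.ext ?_)
    filter_upwards [(hcell m).1, A.ae_mem_Ioo_cell m, Lp.coeFn_zero ℂ 2 (A.cellMeasure m)]
      with y h1 h2 h3
    rw [h1, h3]
    exact hc y (A.Icc_subset_radialInterval m (m + 1) (Ioo_subset_Icc_self h2))
      (hcN.le.trans ((A.t_mono hm).trans h2.1.le))
  · simp [coeff, u.2, v.2]
  · have : A.t 0 = 0 := by simp [t]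
    simp [this, hQ0]
  · simp only [cellWeight_sym]
    have h1 := A.s_ne_zero n
    have h2 := A.s_ne_zero (n + 1)
    have h3 := A.s_ne_zero (n + 2)
    have e1 : (Fintype.card (A.Sphere n) : ℂ) = A.s n := rfl
    have e2 : (Fintype.card (A.Sphere (n + 2)) : ℂ) = A.s (n + 2) := rfl
    simp only [coeff, Pi.smul_apply, Finset.sum_const, Finset.card_univ, nsmul_eq_mul, smul_eq_mul,
      e1, e2]
    push_cast
    field_simp
    ring

/-- All vertex values vanish by the Dirichlet conditions. The fluxes cancel whatever `Q` is, because
the coefficients at every vertex sum to zero over the incoming and over the outgoing edges. -/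
theorem embed_dirichlet_graph_mem {n : ℕ} {j : Fin ((A.s (n + 1) - 1) * (A.s (n + 2) - 1))}
    {x z : Lp ℂ 2 (A.summandMeasure (.dirichlet n j))}
    (h : (x, z) ∈ slGraph (A.cellMeasure (n + 1)) (fun _ => 1) (Icc (A.t (n + 1)) (A.t (n + 2)))
      (dirichletConditions (A.t (n + 1)) (A.t (n + 2)))) :
    (A.embed (.dirichlet n j) x, A.embed (.dirichlet n j) z) ∈ A.preKirchhoffGraph := by
  obtain ⟨F, Q, hF, H, h0, h1⟩ := h
  simp only at hF H h0 h1
  have hm : ∀ m, A.cellWeight (A.coeff (.dirichlet n j)) m ≠ 0 → m = n + 1 := fun m hm => by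
    by_contra hc
    exact hm (cellWeight_eq_zero.2 (A.coeff_dirichlet_of_ne hc j))
  refine A.embed_mem_preKirchhoffGraph (F := F) (Q := Q) (N := n + 2) (fun m hm' e => ?_)
    (fun m hκ => ?_) ⟨⟨fun _ => 0, fun m u v => ?_⟩, fun u => ?_, fun m v => ?_⟩
  · rw [onCell_embed, A.coeff_dirichlet_of_ne (by omega), zero_smul]
  · obtain rfl := hm m hκ
    exact A.summand_cell_isSL hF H hκ subset_rfl (.of_forall fun x => by
      rw [cellWeight_dirichlet, NNReal.coe_one])
  · by_cases h : m = n + 1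
    · subst h
      simp [h0, h1]
    · simp [A.coeff_dirichlet_of_ne h]
  · simp only [Pi.smul_apply, ← Finset.sum_smul, ← Finset.sum_mul, sum_coeff_dirichlet_right,
      zero_mul, zero_smul]
  · simp only [Pi.smul_apply, ← Finset.sum_smul, ← Finset.sum_mul, sum_coeff_dirichlet_right,
      sum_coeff_dirichlet_left, zero_mul, zero_smul, Finset.sum_neg_distrib, neg_zero, add_zero]

theorem sum_coeff_weighted_left (n : ℕ) (j : Fin (A.s (n + 1) - 1)) (u : A.Sphere n) :
    ∑ v, A.coeff (.weighted n j) ⟨n, (u, v)⟩ = 0 := by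
  simp only [coeff_weighted_left, ← Finset.mul_sum, sum_sphereBasis, mul_zero]

theorem sum_coeff_weighted_right (n : ℕ) (j : Fin (A.s (n + 1) - 1)) (w : A.Sphere (n + 2)) :
    ∑ v, A.coeff (.weighted n j) ⟨n + 1, (v, w)⟩ = 0 := by
  simp only [coeff_weighted_right, ← Finset.mul_sum, sum_sphereBasis, mul_zero]

theorem eq_or_eq_of_cellWeight_weighted {n m : ℕ} {j : Fin (A.s (n + 1) - 1)}
    (h : A.cellWeight (A.coeff (.weighted n j)) m ≠ 0) : m = n ∨ m = n + 1 := by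
  by_contra hc
  rw [not_or] at hc
  exact h (cellWeight_eq_zero.2 (A.coeff_weighted_of_ne hc.1 hc.2 j))

theorem cellWeight_weighted {n m : ℕ} {j : Fin (A.s (n + 1) - 1)} (h : m = n ∨ m = n + 1) :
    A.cellWeight (A.coeff (.weighted n j)) m = A.s m * A.s (m + 1) := by
  rcases h with rfl | rfl
  · exact A.cellWeight_weighted_left _ j
  · exact A.cellWeight_weighted_right _ j

/-- On the middle sphere the flux balances as for radial functions. On the two outer spheres the
values vanish by the Dirichlet conditions and the fluxes by the zero sum of `sphereBasis`. -/
theorem embed_weighted_graph_mem {n : ℕ} {j : Fin (A.s (n + 1) - 1)}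
    {x z : Lp ℂ 2 (A.summandMeasure (.weighted n j))}
    (h : (x, z) ∈ slGraph (A.weightedMeasure (Icc (A.t n) (A.t (n + 2)))) A.weight
      (Icc (A.t n) (A.t (n + 2))) (dirichletConditions (A.t n) (A.t (n + 2)))) :
    (A.embed (.weighted n j) x, A.embed (.weighted n j) z) ∈ A.preKirchhoffGraph := by
  obtain ⟨F, Q, hF, H, h0, h1⟩ := h
  simp only at hF H h0 h1
  have hψ : ∀ {m : ℕ} (v : A.Sphere m), m ≠ n + 1 → A.sphereBasis (n + 1) j v = 0 :=
    fun v hv => A.sphereBasis_of_ne hv j v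
  refine A.embed_mem_preKirchhoffGraph (F := F) (Q := Q) (N := n + 2) (fun m hm' e => ?_)
    (fun m hκ => ?_) ⟨⟨fun v => (Real.sqrt (A.s (n + 1)) : ℂ) * A.sphereBasis (n + 1) j v *
      F (A.t (n + 1)), fun m u v => ?_⟩, fun u => ?_, fun m v => ?_⟩
  · rw [onCell_embed, A.coeff_weighted_of_ne (by omega) (by omega), zero_smul]
  · have hm := A.eq_or_eq_of_cellWeight_weighted hκ
    refine A.summand_cell_isSL hF H hκ ?_ ?_
    · exact A.Icc_cell_subset (p := n) (N := n + 2) (by omega) (by omega)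
    · rw [A.cellWeight_weighted hm]
      exact A.ae_weight_eq m
  · by_cases h : m = n
    · subst h
      simp [coeff_weighted_left, h0, hψ u (by omega)]
    · by_cases h' : m = n + 1
      · subst h'
        simp only [coeff_weighted_right, Pi.smul_apply, smul_eq_mul, hψ v (by omega)]
        simp [h1]
      · simp [A.coeff_weighted_of_ne h h', hψ u (by omega), hψ v (by omega)]
  · rcases Nat.eq_zero_or_pos n with h | h
    · subst h
      simp only [Pi.smul_apply, ← Finset.sum_smul, ← Finset.sum_mul, sum_coeff_weighted_left,
        zero_mul, zero_smul]
    · simp [A.coeff_weighted_of_ne (show 0 ≠ n by omega) (show 0 ≠ n + 1 by omega)]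
  · by_cases h : m = n
    · subst h
      simp only [coeff_weighted_left, coeff_weighted_right, cellWeight_weighted_left,
        cellWeight_weighted_right]
      have h1 := A.s_ne_zero m
      have h2 := A.s_ne_zero (m + 1)
      have h3 := A.s_ne_zero (m + 2)
      have e1 : (Fintype.card (A.Sphere m) : ℂ) = A.s m := rfl
      have e2 : (Fintype.card (A.Sphere (m + 2)) : ℂ) = A.s (m + 2) := rfl
      simp only [Pi.smul_apply, Finset.sum_const, Finset.card_univ, nsmul_eq_mul, smul_eq_mul,
        e1, e2]
      push_cast
      field_simp
      ring
    · by_cases h' : m + 1 = n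
      · subst h'
        simp only [Pi.smul_apply, ← Finset.sum_smul, ← Finset.sum_mul, sum_coeff_weighted_left,
          zero_mul, zero_smul, zero_add]
        simp [A.coeff_weighted_of_ne (show m ≠ m + 1 by omega) (show m ≠ m + 1 + 1 by omega)]
      · by_cases h'' : m = n + 1
        · subst h''
          simp only [Finset.sum_neg_distrib, Pi.smul_apply, ← Finset.sum_smul, ← Finset.sum_mul,
            sum_coeff_weighted_right, zero_mul, zero_smul, neg_zero, add_zero]
          simp [A.coeff_weighted_of_ne (show n + 1 + 1 ≠ n by omega)
            (show n + 1 + 1 ≠ n + 1 by omega)]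
        · simp [A.coeff_weighted_of_ne h h'',
            A.coeff_weighted_of_ne h' (show m + 1 ≠ n + 1 by omega)]

/-! ### From the antitree to the model -/

theorem _root_.MeasureTheory.Lp.coeFn_sum_smul {ι : Type*} {μ : Measure ℝ} (s : Finset ι) (c : ι → ℂ)
    {f : ι → Lp ℂ 2 μ} {F : ι → ℝ → ℂ} (h : ∀ i ∈ s, f i =ᵐ[μ] F i) :
    (∑ i ∈ s, c i • f i : Lp ℂ 2 μ) =ᵐ[μ] ∑ i ∈ s, c i • F i := by
  classical
  induction s using Finset.induction_on with
  | empty => exact Lp.coeFn_zero _ _ _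
  | insert i s hi ih =>
    rw [Finset.sum_insert hi, Finset.sum_insert hi]
    refine (Lp.coeFn_add _ _).trans (Filter.EventuallyEq.add ?_
      (ih fun j hj => h j (Finset.mem_insert_of_mem hj)))
    exact (Lp.coeFn_smul _ _).trans ((h i (Finset.mem_insert_self i s)).const_smul _)

/-- The component of a family of functions on the edges of a cell in a summand. -/
noncomputable def avg (i : A.Summand) (m : ℕ) (F : A.Edge → ℝ → ℂ) : ℝ → ℂ :=
  ((A.cellWeight (A.coeff i) m : ℝ) : ℂ)⁻¹ •
    ∑ e, starRingEnd ℂ (A.coeff i ⟨m, e⟩) • F ⟨m, e⟩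

theorem avg_apply (i : A.Summand) (m : ℕ) (F : A.Edge → ℝ → ℂ) (x : ℝ) :
    A.avg i m F x = ((A.cellWeight (A.coeff i) m : ℝ) : ℂ)⁻¹ *
      ∑ e, starRingEnd ℂ (A.coeff i ⟨m, e⟩) * F ⟨m, e⟩ x := by
  simp [avg, Finset.sum_apply]

theorem cellRestrict_modelEquiv (f : A.L2) {i : A.Summand} {m : ℕ}
    (hm : A.cellWeight (A.coeff i) m ≠ 0) :
    A.cellRestrict (A.summandMeasure i) m (A.modelEquiv f i) =
      ((A.cellWeight (A.coeff i) m : ℝ) : ℂ)⁻¹ •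
        ∑ e, starRingEnd ℂ (A.coeff i ⟨m, e⟩) • A.onCell f m e := by
  rw [sum_conj_onCell, smul_smul, inv_mul_cancel₀, one_smul]
  exact_mod_cast hm

theorem modelEquiv_ae_eq_avg {f : A.L2} {F : A.Edge → ℝ → ℂ}
    (hF : ∀ e, f e =ᵐ[A.cellMeasure e.1] F e) {i : A.Summand} {m : ℕ}
    (hm : A.cellWeight (A.coeff i) m ≠ 0) :
    A.modelEquiv f i =ᵐ[A.cellMeasure m] A.avg i m F := by
  refine ((A.isCellSum_summand i).coeFn_cellRestrict hm _).symm.trans ?_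
  rw [A.cellRestrict_modelEquiv f hm]
  exact (Lp.coeFn_smul _ _).trans
    ((Lp.coeFn_sum_smul _ _ fun e _ => hF ⟨m, e⟩).const_smul _)

theorem isSL_avg {g : A.L2} {F Q : A.Edge → ℝ → ℂ}
    (H : ∀ e : A.Edge, IsSL (A.cellMeasure e.1) (fun _ => 1) (Icc (A.t e.1) (A.t (e.1 + 1)))
      (F e) (Q e) (g e)) {i : A.Summand} {m : ℕ} (hm : A.cellWeight (A.coeff i) m ≠ 0) :
    IsSL (A.cellMeasure m) (fun _ => 1) (Icc (A.t m) (A.t (m + 1))) (A.avg i m F)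
      (A.avg i m Q) (A.modelEquiv g i) := by
  have h1 := IsSL.of_sum (ν := A.cellMeasure m) (w := fun _ => 1)
    (J := Icc (A.t m) (A.t (m + 1))) (F := fun e => F ⟨m, e⟩) (Q := fun e => Q ⟨m, e⟩)
    (h := fun e => A.onCell g m e) Finset.univ (fun e => starRingEnd ℂ (A.coeff i ⟨m, e⟩))
    fun e _ => H ⟨m, e⟩
  refine h1.smul _ (A.modelEquiv_ae_eq_avg (F := fun e => g e) (fun e => .rfl) hm)

/-- The components of a function in the domain of the Kirchhoff Laplacian match at the spheres at
which the coefficients depend on the vertex only. -/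
theorem avg_match {F Q : A.Edge → ℝ → ℂ} (hK : A.Kirchhoff F Q) {i : A.Summand} {m : ℕ}
    (h1 : A.cellWeight (A.coeff i) m = A.s m * A.s (m + 1))
    (h2 : A.cellWeight (A.coeff i) (m + 1) = A.s (m + 1) * A.s (m + 2))
    {γ : A.Sphere (m + 1) → ℂ} (hγ : ∀ u v, A.coeff i ⟨m, (u, v)⟩ = γ v)
    (hγ' : ∀ v w, A.coeff i ⟨m + 1, (v, w)⟩ = γ v) :
    A.avg i m F (A.t (m + 1)) = A.avg i (m + 1) F (A.t (m + 1)) ∧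
      (A.s m * A.s (m + 1) : ℂ) * A.avg i m Q (A.t (m + 1)) =
        (A.s (m + 1) * A.s (m + 2) : ℂ) * A.avg i (m + 1) Q (A.t (m + 1)) := by
  obtain ⟨⟨φ, hφ⟩, -, hflux⟩ := hK
  have n1 := A.s_ne_zero m
  have n2 := A.s_ne_zero (m + 1)
  have n3 := A.s_ne_zero (m + 2)
  have e1 : (Fintype.card (A.Sphere m) : ℂ) = A.s m := rfl
  have e2 : (Fintype.card (A.Sphere (m + 2)) : ℂ) = A.s (m + 2) := rfl
  simp only [avg_apply, h1, h2]
  push_cast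
  constructor
  -- By continuity each edge contributes the vertex value, and after counting the edges both
  -- averages equal $s_{m+1}^{-1}\sum_v\overline{\gamma(v)}\varphi(v)$.
  · have hX : ∀ c : ℂ, ∑ v, starRingEnd ℂ (γ v) * (c * φ v) =
        c * ∑ v, starRingEnd ℂ (γ v) * φ v := fun c => by
      rw [Finset.mul_sum]
      exact Finset.sum_congr rfl fun v _ => mul_left_comm _ _ _
    rw [Fintype.sum_prod_type_right, Fintype.sum_prod_type]
    simp only [hγ, hγ', (hφ _ _ _).1, (hφ _ _ _).2, ← Finset.mul_sum, Finset.sum_const,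
      Finset.card_univ, nsmul_eq_mul, e1, e2, hX]
    field_simp
  -- The factors cancel the normalisation of the averages; what remains is the flux condition at
  -- each `v`, weighted with the conjugate of `γ v`.
  · rw [mul_inv_cancel_left₀ (mul_ne_zero n1 n2), mul_inv_cancel_left₀ (mul_ne_zero n2 n3),
      Fintype.sum_prod_type_right, Fintype.sum_prod_type]
    simp only [hγ, hγ', ← Finset.mul_sum]
    refine Finset.sum_congr rfl fun v _ => ?_
    have := hflux m v
    rw [Finset.sum_neg_distrib, add_neg_eq_zero] at this
    rw [this]

/-- At an end of the cell all edges meeting a vertex share its value, so the component there is a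
combination of row or column sums of the coefficients, which vanish. -/
theorem modelEquiv_dirichlet_mem {f g : A.L2} (h : (f, g) ∈ A.preKirchhoffGraph) (n : ℕ)
    (j : Fin ((A.s (n + 1) - 1) * (A.s (n + 2) - 1))) :
    (A.modelEquiv f (.dirichlet n j), A.modelEquiv g (.dirichlet n j)) ∈
      slGraph (A.cellMeasure (n + 1)) (fun _ => 1) (Icc (A.t (n + 1)) (A.t (n + 2)))
        (dirichletConditions (A.t (n + 1)) (A.t (n + 2))) := by
  obtain ⟨-, F, Q, hs, ⟨φ, hφ⟩, -, -⟩ := h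
  have hκ : A.cellWeight (A.coeff (.dirichlet n j)) (n + 1) ≠ 0 := by
    rw [cellWeight_dirichlet]
    exact one_ne_zero
  refine ⟨_, _, A.modelEquiv_ae_eq_avg (fun e => (hs e).1) hκ,
    A.isSL_avg (fun e => (hs e).2) hκ, ?_, ?_⟩
  · simp only [avg_apply]
    rw [Fintype.sum_prod_type]
    simp only [(hφ _ _ _).1, ← Finset.sum_mul, ← map_sum, sum_coeff_dirichlet_right, map_zero,
      zero_mul, Finset.sum_const_zero, mul_zero]
  · simp only [avg_apply]
    rw [Fintype.sum_prod_type_right]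
    simp only [(hφ _ _ _).2, ← Finset.sum_mul, ← map_sum, sum_coeff_dirichlet_left, map_zero,
      zero_mul, Finset.sum_const_zero, mul_zero]

/-- The averages on the two cells are glued at the middle sphere by `avg_match`. At the outer
spheres the zero sums turn continuity into Dirichlet conditions. -/
theorem modelEquiv_weighted_mem {f g : A.L2} (h : (f, g) ∈ A.preKirchhoffGraph) (n : ℕ)
    (j : Fin (A.s (n + 1) - 1)) :
    (A.modelEquiv f (.weighted n j), A.modelEquiv g (.weighted n j)) ∈
      slGraph (A.weightedMeasure (Icc (A.t n) (A.t (n + 2)))) A.weight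
        (Icc (A.t n) (A.t (n + 2))) (dirichletConditions (A.t n) (A.t (n + 2))) := by
  obtain ⟨-, F, Q, hs, hK⟩ := h
  set i : A.Summand := .weighted n j with hi
  have hcases : ∀ m, n ≤ m → m < n + 2 → m = n ∨ m = n + 1 := fun m h1 h2 => by omega
  have hκ : ∀ m, n ≤ m → m < n + 2 → A.cellWeight (A.coeff i) m ≠ 0 := fun m h1 h2 => by
    rw [A.cellWeight_weighted (hcases m h1 h2)]
    exact_mod_cast (Nat.mul_pos (A.s_pos m) (A.s_pos (m + 1))).ne'
  have hz : IntegrableOn (A.modelEquiv g i) (Icc (A.t n) (A.t (n + 2))) :=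
    A.integrableOn_Lp subset_rfl (A.modelEquiv g i)
  have hmatch := A.avg_match hK (i := i) (m := n) (A.cellWeight_weighted_left n j)
    (A.cellWeight_weighted_right n j)
    (γ := fun v => (Real.sqrt (A.s (n + 1)) : ℂ) * A.sphereBasis (n + 1) j v)
    (fun u v => A.coeff_weighted_left n j (u, v))
    (fun v w => A.coeff_weighted_right n j (v, w))
  have hglue := A.eqOn_radialSolution hz (F := fun m => A.avg i m F) (q := fun m => A.avg i m Q)
    (fun m h1 h2 => A.isSL_avg (fun e => (hs e).2) (hκ m h1 h2))
    (fun m h1 h2 => by obtain rfl : m = n := by omega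
                       exact hmatch.1)
    (fun m h1 h2 => by obtain rfl : m = n := by omega
                       exact hmatch.2)
  obtain ⟨φ, hφ⟩ := hK.continuous
  have hleft : A.avg i n F (A.t n) = 0 := by
    rw [avg_apply, Fintype.sum_prod_type]
    simp only [(hφ _ _ _).1, ← Finset.sum_mul, ← map_sum, hi, sum_coeff_weighted_left, map_zero,
      zero_mul, Finset.sum_const_zero, mul_zero]
  have hright : A.avg i (n + 1) F (A.t (n + 2)) = 0 := by
    rw [avg_apply, Fintype.sum_prod_type_right]
    simp only [(hφ _ _ _).2, ← Finset.sum_mul, ← map_sum, hi, sum_coeff_weighted_right, map_zero,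
      zero_mul, Finset.sum_const_zero, mul_zero]
  refine ⟨_, _, ?_, (A.isRegularWeight (Nat.lt_add_of_pos_right two_pos)).isSL_of_integral hz
    (A.avg i n F (A.t n)) ((A.s n * A.s (n + 1) : ℂ) * A.avg i n Q (A.t n)), ?_, ?_⟩
  · refine (A.isCellSum_summand i).ae fun m hm => ?_
    have hm' := A.eq_or_eq_of_cellWeight_weighted hm
    filter_upwards [A.modelEquiv_ae_eq_avg (fun e => (hs e).1) hm, A.ae_mem_Ioo_cell m]
      with x h1 h2
    exact h1.trans ((hglue m (by omega) (by omega)).2 (Ioo_subset_Icc_self h2)).symm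
  · exact ((hglue n le_rfl (by omega)).2 (left_mem_Icc.2 (A.t_lt n).le)).trans hleft
  · exact ((hglue (n + 1) (by omega) (by omega)).2 (right_mem_Icc.2 (A.t_lt (n + 1)).le)).trans
      hright

theorem modelEquiv_sym_mem {f g : A.L2} (h : (f, g) ∈ A.preKirchhoffGraph) :
    (A.modelEquiv f .sym, A.modelEquiv g .sym) ∈
      slGraph (A.weightedMeasure A.radialInterval) A.weight A.radialInterval
        (neumannCompactSupport A.radialInterval A.zero_mem_radialInterval) := by
  obtain ⟨hfin, F, Q, hs, hK⟩ := h
  have ht0 : A.t 0 = 0 := by simp [t]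
  have hκ : ∀ m, A.cellWeight (A.coeff .sym) m ≠ 0 := fun m => by
    rw [cellWeight_sym]
    exact_mod_cast (Nat.mul_pos (A.s_pos m) (A.s_pos (m + 1))).ne'
  have hz : ∀ N, IntegrableOn (A.modelEquiv g .sym) (Icc (A.t 0) (A.t N)) := fun N =>
    A.integrableOn_Lp (A.Icc_subset_radialInterval 0 N) (A.modelEquiv g .sym)
  have hmatch := fun m => A.avg_match hK (i := .sym) (m := m) (A.cellWeight_sym m)
    (A.cellWeight_sym (m + 1)) (γ := fun _ => 1) (fun _ _ => rfl) (fun _ _ => rfl)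
  have hglue := fun m => A.eqOn_radialSolution (hz (m + 1)) (F := fun m => A.avg .sym m F)
    (q := fun m => A.avg .sym m Q) (fun m _ _ => A.isSL_avg (fun e => (hs e).2) (hκ m))
    (fun m _ _ => (hmatch m).1) (fun m _ _ => (hmatch m).2) m (Nat.zero_le m) (Nat.lt_succ_self m)
  set f₀ := A.avg .sym 0 F (A.t 0)
  set q₀ := (A.s 0 * A.s (0 + 1) : ℂ) * A.avg .sym 0 Q (A.t 0) with hq₀
  have hsl := fun N => (A.isRegularWeight (Nat.succ_pos N)).isSL_of_integral (hz (N + 1)) f₀ q₀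
  -- The radial interval need not be compact and its weight need not be bounded, but every compact
  -- part lies in some $[0,t_{N+1}]$, where the weight is regular. The glued solution does not
  -- depend on `N`.
  have hsub : ∀ a b, a ≤ b → Icc a b ⊆ A.radialInterval →
      ∃ N, Icc a b ⊆ Icc (A.t 0) (A.t (N + 1)) := by
    intro a b hab hJ
    obtain ⟨N, hN⟩ := (hJ (right_mem_Icc.2 hab)).2
    refine ⟨N, Icc_subset_Icc ?_ (hN.le.trans (A.t_lt N).le)⟩
    rw [ht0]
    exact (hJ (left_mem_Icc.2 hab)).1
  have hac : ∀ m, A.cellMeasure m ≪ A.weightedMeasure (Icc (A.t 0) (A.t (m + 1))) := fun m =>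
    A.cellMeasure_ac (Icc_subset_Icc_left (A.t_mono (Nat.zero_le m)))
  have hν := A.isCellSum_summand .sym
  refine ⟨A.radialSolution (A.t 0) f₀ q₀ (A.modelEquiv g .sym),
    fun x => q₀ + quasiPrimitive A.weight (A.t 0) (A.modelEquiv g .sym) x, ?_,
    ⟨fun a b hab hJ => ?_, fun a b hab hJ => ?_, ?_, ?_⟩, ?_, ?_⟩
  · refine hν.ae fun m hm => ?_
    filter_upwards [A.modelEquiv_ae_eq_avg (fun e => (hs e).1) hm, A.ae_mem_Ioo_cell m]
      with x h1 h2
    exact h1.trans ((hglue m).2 (Ioo_subset_Icc_self h2)).symm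
  · obtain ⟨N, hN⟩ := hsub a b hab hJ
    exact (hsl N).ac a b hab hN
  · obtain ⟨N, hN⟩ := hsub a b hab hJ
    exact (hsl N).ac_quasi a b hab hN
  · exact hν.ae fun m _ => (hac m).ae_le (hsl m).deriv_eq
  · exact hν.ae fun m _ => (hac m).ae_le (hsl m).deriv_quasi_eq
  · have h0 : A.avg .sym 0 Q (A.t 0) = 0 := by
      rw [avg_apply, Fintype.sum_prod_type]
      have : ∀ e, A.coeff .sym e = 1 := fun _ => rfl
      simp only [this, map_one, one_mul, hK.flux_root, Finset.sum_const_zero, mul_zero]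
    have hq : q₀ = 0 := by rw [hq₀, h0, mul_zero]
    simp [quasiPrimitive, hq, ht0]
  -- Only finitely many edges carry `f`, so beyond some sphere all its edge components vanish.
  · obtain ⟨N, hN⟩ : ∃ N, ∀ m, N ≤ m → ∀ e, f ⟨m, e⟩ = 0 := by
      obtain ⟨N, hN⟩ := (hfin.image Sigma.fst).bddAbove
      refine ⟨N + 1, fun m hm e => ?_⟩
      by_contra hc
      have : m ≤ N := hN ⟨⟨m, e⟩, hc, rfl⟩
      omega
    refine ⟨A.t N, A.Icc_subset_radialInterval N N ⟨le_rfl, le_rfl⟩, fun x hx hNx => ?_⟩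
    obtain ⟨m, hm⟩ := A.mem_radialInterval_iff.1 hx
    have hNm : N ≤ m := by
      by_contra hc
      exact absurd (hm.2.trans_le (A.t_mono (not_le.1 hc))) (not_lt.2 hNx)
    have hx' : x ∈ Icc (A.t m) (A.t (m + 1)) := Ico_subset_Icc_self hm
    refine ((hglue m).2 hx').trans ?_
    rw [avg_apply]
    refine mul_eq_zero_of_right _ (Finset.sum_eq_zero fun e _ => mul_eq_zero_of_right _ ?_)
    have h1 := (hs ⟨m, e⟩).1
    simp only [hN m hNm e] at h1
    -- The representative is continuous and almost everywhere zero on the cell, hence zero at every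
    -- point, endpoints included.
    exact ((hs ⟨m, e⟩).2.ac _ _ (A.t_lt m).le subset_rfl).eqOn_zero_of_ae (A.t_lt m)
      (h1.symm.trans (Lp.coeFn_zero _ _ _)) hx'

end RadialAntitree

/-! ### Closures, reducing subspaces and the main theorem -/

theorem LinearPMap.isClosable_of_forall {E : Type*} [NormedAddCommGroup E] [NormedSpace ℂ E]
    {T : E →ₗ.[ℂ] E} (h : ∀ g, ((0 : E), g) ∈ T.graph.topologicalClosure → g = 0) :
    T.IsClosable := by
  refine ⟨T.graph.topologicalClosure.toLinearPMap,
    (Submodule.toLinearPMap_graph_eq _ ?_).symm⟩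
  rintro ⟨f, g⟩ hp h0
  obtain rfl : f = 0 := h0
  exact h g hp

open Classical in
/-- The part of `y` in the summands from `s`. -/
noncomputable def lp.cutoff {ι : Type*} {E : ι → Type*} [∀ i, NormedAddCommGroup (E i)] (s : Set ι)
    (y : lp E 2) : lp E 2 :=
  ⟨fun i => if i ∈ s then y i else 0, memℓp_gen (by
    have hf : Summable fun i => ‖y i‖ ^ (2 : ENNReal).toReal := (lp.memℓp y).summable (by norm_num)
    refine Summable.of_nonneg_of_le (fun e => by positivity) (fun e => ?_) hf
    split_ifs
    · exact le_rfl
    · exact (by simp :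
        ‖(0 : E e)‖ ^ (2 : ENNReal).toReal ≤ ‖y e‖ ^ (2 : ENNReal).toReal))⟩

section Cutoff

variable {ι : Type*} {E : ι → Type*} [∀ i, NormedAddCommGroup (E i)] {s : Set ι}

theorem lp.cutoff_of_mem {i : ι} (h : i ∈ s) (y : lp E 2) : lp.cutoff s y i = y i := if_pos h

theorem lp.cutoff_of_notMem {i : ι} (h : i ∉ s) (y : lp E 2) : lp.cutoff s y i = 0 := if_neg h

theorem lp.cutoff_add_cutoff_compl (y : lp E 2) : lp.cutoff s y + lp.cutoff sᶜ y = y := by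
  ext1
  funext i
  rw [lp.coeFn_add, Pi.add_apply]
  by_cases h : i ∈ s
  · rw [lp.cutoff_of_mem h, lp.cutoff_of_notMem (notMem_compl_iff.2 h), add_zero]
  · rw [lp.cutoff_of_notMem h, lp.cutoff_of_mem (mem_compl h), zero_add]

end Cutoff

/-! ### Closability, equality of the graphs and reduction -/

namespace RadialAntitree

variable {V : Type*} (A : RadialAntitree V)

/-- The edgewise equation without boundary conditions has a closed graph, so it survives limits. It
already determines the image from the function, and this yields closability. -/
theorem cell_mem_of_mem_closure {p : A.L2 × A.L2} (hp : p ∈ A.preKirchhoffGraph.topologicalClosure)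
    (m : ℕ) (e : A.Sphere m × A.Sphere (m + 1)) :
    (A.onCell p.1 m e, A.onCell p.2 m e) ∈
      slGraph (A.cellMeasure m) (fun _ => 1) (Icc (A.t m) (A.t (m + 1))) ⊤ := by
  have hcl := (A.isRegularWeight_one m).isClosed_slGraph_top
  refine hcl.closure_subset (map_mem_closure (f := fun p : A.L2 × A.L2 =>
    (A.onCellCLM m e p.1, A.onCellCLM m e p.2)) (by fun_prop) hp ?_)
  rintro ⟨f, g⟩ ⟨-, F, Q, hs, -⟩
  exact ⟨F ⟨m, e⟩, Q ⟨m, e⟩, (hs ⟨m, e⟩).1, (hs ⟨m, e⟩).2, trivial⟩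

theorem eq_zero_of_mem_cell {m : ℕ} {h : Lp ℂ 2 (A.cellMeasure m)}
    (hp : (0, h) ∈ slGraph (A.cellMeasure m) (fun _ => 1) (Icc (A.t m) (A.t (m + 1))) ⊤) :
    h = 0 := by
  obtain ⟨F, Q, hF, H, -⟩ := hp
  have h0 : F =ᵐ[A.cellMeasure m] 0 := hF.symm.trans (Lp.coeFn_zero _ _ _)
  have h1 : h =ᵐ[A.cellMeasure m] 0 := H.eq_zero ordConnected_Icc
    (Measure.AbsolutelyContinuous.refl _) (Measure.AbsolutelyContinuous.refl _) (by simp) h0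
  exact Lp.ext (h1.trans (Lp.coeFn_zero _ _ _).symm)

theorem isClosable_preKirchhoff : A.preKirchhoff.IsClosable := by
  refine LinearPMap.isClosable_of_forall fun g hg => ?_
  rw [preKirchhoff_graph] at hg
  ext1
  funext ⟨m, e⟩
  exact A.eq_zero_of_mem_cell (A.cell_mem_of_mem_closure hg m e)

theorem kirchhoff_graph : A.kirchhoff.graph = A.preKirchhoffGraph.topologicalClosure := by
  rw [kirchhoff, ← A.isClosable_preKirchhoff.graph_closure_eq_closure_graph, preKirchhoff_graph]

variable [Infinite V]

theorem embed_mem_closure_of_radial {p : Lp ℂ 2 (A.summandMeasure .sym) ×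
    Lp ℂ 2 (A.summandMeasure .sym)} (hp : p ∈ A.preRadial.graph.topologicalClosure) :
    (A.embed .sym p.1, A.embed .sym p.2) ∈ A.preKirchhoffGraph.topologicalClosure := by
  refine map_mem_closure (f := fun p : Lp ℂ 2 (A.summandMeasure .sym) ×
    Lp ℂ 2 (A.summandMeasure .sym) => (A.embed .sym p.1, A.embed .sym p.2)) ?_ hp ?_
  · exact ((A.embed .sym).continuous.comp continuous_fst).prodMk
      ((A.embed .sym).continuous.comp continuous_snd)
  · rintro ⟨x, z⟩ h
    have h' : (x, z) ∈ A.preRadial.graph := h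
    rw [preRadial_graph] at h'
    exact A.embed_radial_mem h'

/-- A limit pair `(0, g)` is carried by the isometry into the graph of the closed Kirchhoff
operator, which is single-valued; so the image of `g` is zero, and injectivity gives `g = 0`. -/
theorem isClosable_preRadial : A.preRadial.IsClosable := by
  refine LinearPMap.isClosable_of_forall fun g hg => ?_
  have h1 := A.embed_mem_closure_of_radial hg
  rw [← kirchhoff_graph] at h1
  have h2 := LinearPMap.graph_fst_eq_zero_snd _ h1 (map_zero _)
  exact (A.embed .sym).injective (h2.trans (map_zero _).symm)

theorem preRadial_closure_graph :
    A.preRadial.closure.graph = A.preRadial.graph.topologicalClosure :=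
  A.isClosable_preRadial.graph_closure_eq_closure_graph.symm

theorem isClosed_summandOp_graph (i : A.Summand) :
    IsClosed ((A.summandOp i).graph : Set (Lp ℂ 2 (A.summandMeasure i) ×
      Lp ℂ 2 (A.summandMeasure i))) := by
  cases i with
  | sym => exact A.isClosable_preRadial.closure_isClosed
  | dirichlet n j =>
    have h := (A.isRegularWeight_one (n + 1)).isClosed_slGraph_dirichlet
    rw [← dirichlet_graph] at h
    exact h
  | weighted n j =>
    have h := (A.isRegularWeight (p := n) (N := n + 2) (by omega)).isClosed_slGraph_dirichlet
    rw [← weightedDirichlet_graph] at h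
    exact h

theorem embed_mem_closure {i : A.Summand} {x z : Lp ℂ 2 (A.summandMeasure i)}
    (h : (x, z) ∈ (A.summandOp i).graph) :
    (A.embed i x, A.embed i z) ∈ A.preKirchhoffGraph.topologicalClosure := by
  cases i with
  | sym =>
    refine A.embed_mem_closure_of_radial (p := (x, z)) ?_
    rw [← preRadial_closure_graph]
    exact h
  | dirichlet n j =>
    have h' : (x, z) ∈ (A.dirichlet (n + 1)).graph := h
    rw [dirichlet_graph] at h'
    exact Submodule.le_topologicalClosure _ (A.embed_dirichlet_graph_mem h')
  | weighted n j =>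
    have h' : (x, z) ∈ (A.weightedDirichlet n).graph := h
    rw [weightedDirichlet_graph] at h'
    exact Submodule.le_topologicalClosure _ (A.embed_weighted_graph_mem h')

theorem modelEquiv_mem_graph {f g : A.L2} (h : (f, g) ∈ A.preKirchhoffGraph) (i : A.Summand) :
    (A.modelEquiv f i, A.modelEquiv g i) ∈ (A.summandOp i).graph := by
  cases i with
  | sym =>
    have h1 := A.modelEquiv_sym_mem h
    rw [← preRadial_graph] at h1
    exact A.preRadial_closure_graph.ge (Submodule.le_topologicalClosure A.preRadial.graph h1)
  | dirichlet n j =>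
    have h1 := A.modelEquiv_dirichlet_mem h n j
    rw [← dirichlet_graph] at h1
    exact h1
  | weighted n j =>
    have h1 := A.modelEquiv_weighted_mem h n j
    rw [← weightedDirichlet_graph] at h1
    exact h1

/-- A component in the model as a bounded operator. -/
noncomputable def componentCLM (i : A.Summand) : A.L2 →L[ℂ] Lp ℂ 2 (A.summandMeasure i) :=
  (lp.evalCLM ℂ (fun i : A.Summand => Lp ℂ 2 (A.summandMeasure i)) 2 i).comp
    (A.modelEquiv.toContinuousLinearEquiv : A.L2 →L[ℂ] A.Model)

theorem componentCLM_apply (i : A.Summand) (f : A.L2) :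
    A.componentCLM i f = A.modelEquiv f i := rfl

/-- In one direction each component lands in a closed graph, so the inclusion extends from the
pre-minimal graph to its closure. In the other, the finite partial sums of the embedded components
lie in the closure and converge to the pair. -/
theorem intertwines : Intertwines A.modelEquiv A.kirchhoff (orthSum A.summandOp) := by
  intro f g
  rw [kirchhoff_graph, orthSum_graph]
  constructor
  · intro h i
    refine (A.isClosed_summandOp_graph i).closure_subset (map_mem_closure
      (f := fun p : A.L2 × A.L2 => (A.componentCLM i p.1, A.componentCLM i p.2))
      (by fun_prop) h ?_)
    rintro ⟨f, g⟩ hfg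
    exact A.modelEquiv_mem_graph hfg i
  · intro h
    have hsum := (A.hasSum_embed f).prodMk (A.hasSum_embed g)
    refine A.preKirchhoffGraph.isClosed_topologicalClosure.mem_of_tendsto hsum
      (.of_forall fun s => ?_)
    exact Submodule.sum_mem _ fun i _ => A.embed_mem_closure (h i)

theorem isClosed_subspace (b : Block) : IsClosed (A.subspace b : Set A.L2) := by
  have : (A.subspace b : Set A.L2) = ⋂ i : A.Summand, ⋂ _ : i.block ≠ b,
      {f | A.componentCLM i f = 0} := by
    ext f
    simp only [SetLike.mem_coe, mem_subspace_iff, mem_iInter, mem_ofPred_eq, componentCLM_apply]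
  rw [this]
  exact isClosed_iInter fun i => isClosed_iInter fun _ =>
    isClosed_eq (A.componentCLM i).continuous continuous_const

theorem inner_eq_zero_of_components {f g : A.L2}
    (h : ∀ i, A.modelEquiv f i = 0 ∨ A.modelEquiv g i = 0) : inner ℂ f g = 0 := by
  rw [← A.modelEquiv.inner_map_map, lp.inner_eq_tsum]
  refine (tsum_congr fun i => ?_).trans tsum_zero
  rcases h i with h | h <;> simp [h]

theorem isHilbertSum_subspace :
    IsHilbertSum ℂ (fun b => A.subspace b) (fun b => (A.subspace b).subtypeₗᵢ) := by
  have : ∀ b, CompleteSpace (A.subspace b) := fun b => (A.isClosed_subspace b).completeSpace_coe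
  refine IsHilbertSum.mkInternal (A.subspace) (fun b b' hb f g => ?_) fun f _ => ?_
  · refine A.inner_eq_zero_of_components fun i => ?_
    by_cases h : i.block = b
    · exact .inr ((A.mem_subspace_iff _ _).1 g.2 i (h ▸ hb))
    · exact .inl ((A.mem_subspace_iff _ _).1 f.2 i h)
  · refine mem_closure_of_tendsto (A.hasSum_embed f) (.of_forall fun s => ?_)
    exact Submodule.sum_mem _ fun i _ => Submodule.mem_iSup_of_mem _ (A.embed_mem i _)

/-- Setting some components to zero keeps a pair in the graph of an orthogonal sum. Cutting off to a
block and to its complement therefore splits the operator. -/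
theorem reduces_subspace (b : Block) : Reduces (A.subspace b) A.kirchhoff := by
  refine ⟨A.isClosed_subspace b, fun f => ?_⟩
  set s : Set A.Summand := {i | i.block = b}
  have hgraph : ∀ s : Set A.Summand, (A.modelEquiv.symm (lp.cutoff s (A.modelEquiv f)),
      A.modelEquiv.symm (lp.cutoff s (A.modelEquiv (A.kirchhoff f)))) ∈ A.kirchhoff.graph := by
    intro s
    have hf := (A.intertwines _ _).1 (A.kirchhoff.mem_graph f)
    refine (A.intertwines _ _).2 ?_
    rw [orthSum_graph] at hf ⊢
    intro i
    simp only [LinearIsometryEquiv.apply_symm_apply]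
    by_cases h : i ∈ s
    · rw [lp.cutoff_of_mem h, lp.cutoff_of_mem h]
      exact hf i
    · rw [lp.cutoff_of_notMem h, lp.cutoff_of_notMem h]
      exact Submodule.zero_mem _
  have hmem : ∀ y : A.Model, A.modelEquiv.symm (lp.cutoff s y) ∈ A.subspace b := fun y => by
    rw [mem_subspace_iff]
    intro i hi
    rw [LinearIsometryEquiv.apply_symm_apply]
    exact lp.cutoff_of_notMem (s := s) (i := i) hi y
  have horth : ∀ y : A.Model, A.modelEquiv.symm (lp.cutoff sᶜ y) ∈ (A.subspace b)ᗮ := fun y => by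
    refine (Submodule.mem_orthogonal _ _).2 fun k hk => A.inner_eq_zero_of_components fun i => ?_
    rw [LinearIsometryEquiv.apply_symm_apply]
    by_cases h : i.block = b
    · exact .inr (lp.cutoff_of_notMem (s := sᶜ) (i := i) (fun h' => h' h) y)
    · exact .inl ((A.mem_subspace_iff _ _).1 hk i h)
  obtain ⟨f₁, h1, h1'⟩ := (LinearPMap.mem_graph_iff _).1 (hgraph s)
  obtain ⟨f₂, h2, h2'⟩ := (LinearPMap.mem_graph_iff _).1 (hgraph sᶜ)
  simp only at h1 h1' h2 h2'
  refine ⟨f₁, f₂, Subtype.ext ?_, ?_, ?_, ?_, ?_⟩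
  · rw [Submodule.coe_add, h1, h2, ← map_add, lp.cutoff_add_cutoff_compl,
      LinearIsometryEquiv.symm_apply_apply]
  · rw [h1]
    exact hmem _
  · rw [h1']
    exact hmem _
  · rw [h2]
    exact horth _
  · rw [h2']
    exact horth _

end RadialAntitree

theorem mainTheorem1 {V : Type*} [Infinite V] (A : RadialAntitree V) :
    A.preKirchhoff.IsClosable ∧ A.preRadial.IsClosable ∧
    IsHilbertSum ℂ (fun b => A.subspace b) (fun b => (A.subspace b).subtypeₗᵢ) ∧
    (∀ b, Reduces (A.subspace b) A.kirchhoff) ∧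
    ∃ Φ : A.L2 ≃ₗᵢ[ℂ] A.Model,
      (∀ b f, f ∈ A.subspace b ↔ ∀ i : A.Summand, i.block ≠ b → Φ f i = 0) ∧
      Intertwines Φ A.kirchhoff (orthSum A.summandOp) :=
  ⟨A.isClosable_preKirchhoff, A.isClosable_preRadial, A.isHilbertSum_subspace,
    A.reduces_subspace, A.modelEquiv, A.mem_subspace_iff, A.intertwines⟩
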